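/- **Setting.** Let $s>\frac12$ and $\theta=\theta(s)=\min\{2s-1,\frac12\}$. Write $\hat f(\xi)=\int_{\mathbb R}f(x)e^{-ix\xi}\,dx$ (extended to tempered distributions), $\langle\xi\rangle=(1+\xi^2)^{1/2}$ and $\|f\|_{H^\sigma}=(2\pi)^{-1/2}\|\langle\xi\rangle^\sigma\hat f\|_{L^2_\xi(\mathbb R)}$. *Ordered trees.* An ordered tree $T\in\mathfrak T(J)$ of generation $J$ is a planar ternary tree together with the way it grew: one starts from a single node and, at step $j=1,\dots,J$, chooses a terminal node $r^{(j)}$ of the current tree and gives it three children $r^{(j)}_1,r^{(j)}_2,r^{(j)}_3$. Let $T^\infty$ be the set of terminal nodes of the final tree, so $|T^\infty|=2J+1$. For $\xi\in\mathbb R$, $\Xi_\xi(T)$ is the set of families $(\xi_a)_{a\in T}$ of real numbers with $\xi_{r^{(1)}}=\xi$ and $\xi_a=\xi_{a_1}-\xi_{a_2}+\xi_{a_3}$ for every non-terminal $a$ with children $a_1,a_2,a_3$. Put $\xi^{(j)}=\xi_{r^{(j)}}$ and $\xi^{(j)}_k=\xi_{r^{(j)}_k}$; integrals over $\Xi_\xi(T)$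 are with respect to $d\xi^{(J)}_1d\xi^{(J)}_2\cdots d\xi^{(1)}_1d\xi^{(1)}_2$. Let $$\mu_j=(\xi^{(j)})^2-(\xi^{(j)}_1)^2+(\xi^{(j)}_2)^2-(\xi^{(j)}_3)^2,\qquad \widetilde\mu_j=\sum_{k=1}^j\mu_k .$$ *The remainder.* Let $N>1$ and let $\beta=(\beta_j)_{j\ge0}$ satisfy $\beta_0=1$ and $\beta_j\ge2$ for $j\ge1$. For $J\ge1$, $t\in\mathbb R$ and $v\in H^s(\mathbb R)$, $\mathcal T^{(J+1)}_{\mathcal T}(v)$ is the tempered distribution with Fourier transform $$\xi\mapsto\sum_{T\in\mathfrak T(J+1)}\int_{\Xi_\xi(T)}\mathbf 1_{F_J}\Big(\prod_{j=1}^J\frac{e^{i\mu_jt}\,\xi^{(j)}_2}{\widetilde\mu_j}\Big)\,e^{i\mu_{J+1}t}\,\xi^{(J+1)}_2\prod_{a\in T^\infty}\hat v(\xi_a),$$ where $F_J$ is the set on which $|\mu_1|>N$ and $|\widetilde\mu_j+\mu_{j+1}|>\beta_j|\widetilde\mu_j|$ for $1\le j\le J-1$. In this formula complex conjugates are suppressed: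 any of the factors $\hat v(\xi_a)$ may be replaced by $\overline{\hat v(\xi_a)}$ and the sign of any $\mu_j$ may be reversed (also inside the $\widetilde\mu_k$ and $F_J$), the choice being made once for each possible position of a node in the planar ternary tree. The statement below holds for every such choice. One choice is the formula exactly as displayed; another is the formula with all conjugates restored, in which a factor is conjugated, and the sign of a $\mu_j$ reversed, exactly at the nodes reached from the root through an odd number of second children. For $K>0$ call $\beta$ *$K$-admissible* if, with $c_{J+1}=1\cdot3\cdot5\cdots(2J+1)$ and $b_j=\prod_{i=0}^{j-1}\beta_i$, $$\sup_{J\ge1}\frac{c_{J+1}\,\beta_J\,K^{J+1}(2J+6)}{b_1^\theta\cdots b_{J-1}^\theta}<\infty .$$ **Lemma.** Let $s>\frac12$. 1. The sequence $\beta_0=1$, $\beta_j=(2j+3)^{2/\theta}$ $(j\ge1)$ is $K$-admissible for every $K>0$. 2. There is $K=K(s)>0$ such that for every $K$-admissible $\beta$ there is a constant $C=C(s,\beta)>0$ for which the following holds for every $N>1$, $t\in\mathbb R$ and $v\in H^s(\mathbb R)$. For every $J\ge1$, the integrals defining $\mathcal T^{(J+1)}_{\mathcal T}(v)$ converge absolutely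 for almost every $\xi$, the resulting function is the Fourier transform of a tempered distribution, and $$\|\mathcal T^{(J+1)}_{\mathcal T}(v)\|_{H^{s-1}(\mathbb R)}\le C\,N^{-\theta J}\,\|v\|_{H^s(\mathbb R)}^{2J+3}.$$ Moreover, if $N^\theta>\|v\|_{H^s}^2$, then $\mathcal T^{(J+1)}_{\mathcal T}(v)\to0$ in $H^{s-1}(\mathbb R)$ as $J\to\infty$. 3. For the sequence $\beta$ of item 1, $\mathcal T^{(J+1)}_{\mathcal T}(v)\to0$ in $H^{s-1}(\mathbb R)$ as $J\to\infty$ for every $N>1$, $t\in\mathbb R$ and $v\in H^s(\mathbb R)$. -/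

import Mathlib

open MeasureTheory Filter Topology
open scoped ENNReal FourierTransform SchwartzMap

noncomputable section

namespace NormalForm

/-! ### Sobolev spaces on the line, with the convention `f̂ ξ = ∫ f x * exp (-i x ξ) dx` -/

/-- The Fourier transform (convention `∫ f x * exp (-i x ξ) dx`) of the tempered distribution `f`
is the function `g`. Mathlib's transform uses `exp (-2 π i x η)`, so it is `η ↦ g (2 π η)`. -/
def HasFourier (f : 𝓢'(ℝ, ℂ)) (g : ℝ → ℂ) : Prop :=
  AEStronglyMeasurable g volume ∧
    ∀ φ : 𝓢(ℝ, ℂ), Integrable (fun η : ℝ => φ η * g (2 * Real.pi * η)) volume ∧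
      (𝓕 f) φ = ∫ η : ℝ, φ η * g (2 * Real.pi * η)

/-- A function representing the Fourier transform of `f` (unique up to null sets), if there is
one. -/
def hat (f : 𝓢'(ℝ, ℂ)) : ℝ → ℂ :=
  open Classical in if h : ∃ g, HasFourier f g then h.choose else 0

/-- The tempered distribution whose Fourier transform is the function `g` (it is unique), if there
is one. -/
def invHat (g : ℝ → ℂ) : 𝓢'(ℝ, ℂ) :=
  open Classical in if h : ∃ f, HasFourier f g then h.choose else 0

/-- The norm of `H^σ(ℝ)`: `(2π)^(-1/2) ‖⟨ξ⟩^σ f̂‖_{L²} = ‖⟨∂ₓ⟩^σ f‖_{L²}`, and `∞` if `f` is not in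
`H^σ(ℝ)`. All functions `g` in the infimum agree almost everywhere. -/
def sobolevNorm (σ : ℝ) (f : 𝓢'(ℝ, ℂ)) : ℝ≥0∞ :=
  ⨅ (g : ℝ → ℂ) (_ : HasFourier f g),
    ENNReal.ofReal ((2 * Real.pi) ^ (-(1 / 2) : ℝ)) *
      eLpNorm (fun ξ : ℝ => (((1 + ξ ^ 2) ^ (σ / 2) : ℝ) : ℂ) * g ξ) 2 volume

/-! ### Ordered ternary trees -/

/-- Nodes of planar ternary trees, as words: `[]` is the root, and `0 :: a`, `1 :: a`, `2 :: a` are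
the first, second and third child of `a`. -/
abbrev Node := List (Fin 3)

/-- The nodes of the ternary tree with set `P` of parental nodes: the root and the children of the
parental nodes. -/
def nodes (P : Finset Node) : Finset Node :=
  insert [] (P.biUnion fun a => Finset.univ.image fun k : Fin 3 => k :: a)

/-- The terminal nodes of the ternary tree with set `P` of parental nodes. -/
def terminal (P : Finset Node) : Finset Node := nodes P \ P

/-- Ordered trees of the `J`-th generation, i.e. chronicles: `r j` is the root node of the
`(j+1)`-st generation; it is a terminal node of the tree grown so far (a single node at the start),
and it gets three children at this step. -/
@[ext] structure OrderedTree (J : ℕ) where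
  r : Fin J → Node
  grows : ∀ j, r j ∈ terminal ((Finset.univ.filter (· < j)).image r)

namespace OrderedTree

variable {J : ℕ}

theorem length_le (T : OrderedTree J) (j : Fin J) : (T.r j).length ≤ j := by
  induction j using WellFoundedLT.induction with
  | ind j ih =>
    have h := (Finset.mem_sdiff.1 (T.grows j)).1
    simp only [nodes, Finset.mem_insert, Finset.mem_biUnion, Finset.mem_image, Finset.mem_filter,
      Finset.mem_univ, true_and] at h
    rcases h with h | ⟨a, ⟨i, hi, rfl⟩, k, hk⟩
    · simp [h]
    · have := ih i hi
      rw [← hk, List.length_cons]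
      have : (i : ℕ) < j := hi
      omega

instance : Finite (OrderedTree J) := by
  have hfin : Finite {l : Node // l.length ≤ J} := (List.finite_length_le (Fin 3) J).to_subtype
  refine Finite.of_injective
    (fun T : OrderedTree J => fun j : Fin J =>
      (⟨T.r j, (T.length_le j).trans j.2.le⟩ : {l : Node // l.length ≤ J})) ?_
  intro S T h
  ext1
  funext j
  exact congrArg Subtype.val (congrFun h j)

instance : Fintype (OrderedTree J) := Fintype.ofFinite _

theorem r_injective (T : OrderedTree J) : Function.Injective T.r := by
  have key : ∀ i j : Fin J, i < j → T.r i ≠ T.r j := by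
    intro i j hij h
    have h2 := (Finset.mem_sdiff.1 (T.grows j)).2
    exact h2 (Finset.mem_image.2 ⟨i, by simp [hij], h⟩)
  intro i j h
  rcases lt_trichotomy i j with hij | hij | hij
  · exact absurd h (key i j hij)
  · exact hij
  · exact absurd h.symm (key j i hij)

/-- The parental nodes of the full tree. -/
def parents (T : OrderedTree J) : Finset Node := Finset.univ.image T.r

/-- The terminal nodes of the full tree. -/
def leaves (T : OrderedTree J) : Finset Node := terminal T.parents

/-- The index function of `T` with frequency `ξ` at the root, in the coordinates
`η j = (ξ₁, ξ₂)` of the `(j+1)`-st generation; the third child of a node with frequency `x` then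
has frequency `x - ξ₁ + ξ₂`. (At most one term of the sum is present.) -/
def freq (T : OrderedTree J) (ξ : ℝ) (η : Fin J → ℝ × ℝ) : Node → ℝ
  | [] => ξ
  | k :: a => ∑ j : Fin J,
      if T.r j = a then ![(η j).1, (η j).2, freq T ξ η a - (η j).1 + (η j).2] k else 0

/-- The index function satisfies the defining relation at every parental node. -/
theorem freq_relation (T : OrderedTree J) (ξ : ℝ) (η : Fin J → ℝ × ℝ) (j : Fin J) :
    T.freq ξ η (T.r j) =
      T.freq ξ η (0 :: T.r j) - T.freq ξ η (1 :: T.r j) + T.freq ξ η (2 :: T.r j) := by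
  simp [freq, T.r_injective.eq_iff]

end OrderedTree

/-! ### The remainder term -/

/-- A way to place signs and complex conjugates in the formula of the remainder. `flip a` says that
the modulation at the parental node `a` is counted with the sign `-`; `conj a` says that the factor
at the terminal node `a` is conjugated. -/
structure Convention where
  flip : Node → Bool
  conj : Node → Bool

/-- The formula as it is displayed, with all conjugates suppressed. -/
def Convention.displayed : Convention := ⟨fun _ => false, fun _ => false⟩

/-- All conjugates restored: passing to a second child conjugates, so a factor is conjugated, and a
phase changes sign, at the nodes that are reached through an odd number of second children. -/
def Convention.restored : Convention :=
  ⟨fun a => decide (Odd (a.count 1)), fun a => decide (Odd (a.count 1))⟩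

section

variable {J : ℕ} (κ : Convention) (T : OrderedTree J) (ξ : ℝ) (η : Fin J → ℝ × ℝ)

/-- The modulation `μ_{j+1}` introduced at the `(j+1)`-st generation. -/
def modulation (j : Fin J) : ℝ :=
  (if κ.flip (T.r j) then -1 else 1) *
    (T.freq ξ η (T.r j) ^ 2 - T.freq ξ η (0 :: T.r j) ^ 2 + T.freq ξ η (1 :: T.r j) ^ 2
      - T.freq ξ η (2 :: T.r j) ^ 2)

/-- The sum `μ̃_n = μ_1 + ⋯ + μ_n` of the modulations of the first `n` generations. -/
def modulationSum (n : ℕ) : ℝ :=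
  ∑ i ∈ Finset.univ.filter (fun i : Fin J => (i : ℕ) < n), modulation κ T ξ η i

/-- The domain of integration after `n` reductions: `|μ_1| > N`, and
`|μ̃_j + μ_{j+1}| = |μ̃_{j+1}| > β_j |μ̃_j|` for `1 ≤ j ≤ n - 1`. -/
def farFromResonance (β : ℕ → ℝ) (N : ℝ) (n : ℕ) : Prop :=
  N < |modulationSum κ T ξ η 1| ∧
    ∀ j : ℕ, 1 ≤ j → j + 1 ≤ n →
      β j * |modulationSum κ T ξ η j| < |modulationSum κ T ξ η (j + 1)|

/-- The product of the factors `v̂ (ξ_a)` over the terminal nodes `a`, some of them conjugated. -/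
def leafProduct (w : ℝ → ℂ) : ℂ :=
  ∏ a ∈ T.leaves,
    if κ.conj a then (starRingEnd ℂ) (w (T.freq ξ η a)) else w (T.freq ξ η a)

/-- The factor `e^{i μ_{j+1} t} ξ₂` of the `(j+1)`-st generation. -/
def generationFactor (t : ℝ) (j : Fin J) : ℂ :=
  Complex.exp (Complex.I * (modulation κ T ξ η j : ℂ) * (t : ℂ)) *
    (T.freq ξ η (1 :: T.r j) : ℂ)

end

/-- The integrand attached to an ordered tree of generation `J + 1` in the remainder after `J`
reductions, for `w = v̂`. -/
def integrand (κ : Convention) (β : ℕ → ℝ) (N t : ℝ) {J : ℕ} (w : ℝ → ℂ)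
    (T : OrderedTree (J + 1)) (ξ : ℝ) (η : Fin (J + 1) → ℝ × ℝ) : ℂ :=
  open Classical in
  if farFromResonance κ T ξ η β N J then
    (∏ j : Fin J, generationFactor κ T ξ η t j.castSucc /
        (modulationSum κ T ξ η ((j : ℕ) + 1) : ℂ)) *
      generationFactor κ T ξ η t (Fin.last J) * leafProduct κ T ξ η w
  else 0

/-- The Fourier transform of the remainder after `J` reductions, for `w = v̂`. -/
def remainderHat (κ : Convention) (β : ℕ → ℝ) (N t : ℝ) (J : ℕ) (w : ℝ → ℂ) (ξ : ℝ) : ℂ :=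
  ∑ T : OrderedTree (J + 1), ∫ η : Fin (J + 1) → ℝ × ℝ, integrand κ β N t w T ξ η

/-- The remainder after `J` reductions, evaluated at time `t` on `v = v(t)`. -/
def remainder (κ : Convention) (β : ℕ → ℝ) (N t : ℝ) (J : ℕ) (v : 𝓢'(ℝ, ℂ)) : 𝓢'(ℝ, ℂ) :=
  invHat (remainderHat κ β N t J (hat v))

/-! ### The parameters -/

/-- The exponent `θ(s) = min {2s - 1, 1/2}`. -/
def theta (s : ℝ) : ℝ := min (2 * s - 1) (1 / 2)

/-- `b_J = β_0 β_1 ⋯ β_{J-1}`. -/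
def bProd (β : ℕ → ℝ) (J : ℕ) : ℝ := ∏ j ∈ Finset.range J, β j

/-- The requirements on the thresholds: `β_0 = 1`, `β_j ≥ 2` for `j ≥ 1`, and
`sup_{J ≥ 1} c_{J+1} β_J K^{J+1} (2J+6) / (b_1^θ ⋯ b_{J-1}^θ) < ∞`, where
`c_{J+1} = 1 · 3 · 5 ⋯ (2J+1)`. -/
def Admissible (s K : ℝ) (β : ℕ → ℝ) : Prop :=
  β 0 = 1 ∧ (∀ j, 1 ≤ j → 2 ≤ β j) ∧
    ∃ A : ℝ, ∀ J : ℕ, 1 ≤ J →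
      (∏ i ∈ Finset.range (J + 1), (2 * (i : ℝ) + 1)) * β J * K ^ (J + 1) * (2 * (J : ℝ) + 6) /
        ∏ j ∈ Finset.Icc 1 (J - 1), bProd β j ^ theta s ≤ A

/-- The thresholds `β_0 = 1` and `β_j = (2j+3)^{2/θ}` for `j ≥ 1`. -/
def modelBeta (s : ℝ) (j : ℕ) : ℝ := if j = 0 then 1 else (2 * (j : ℝ) + 3) ^ (2 / theta s)

end NormalForm

end

open NormalForm

namespace NormalForm

/-! All estimates are made on absolute values in Fourier space, so phases, conjugates and the signs
of the modulations play no role.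

One generation: for c = x - a + b one has x² - a² + b² - c² = 2(x - a)(a - b). On the domain of
integration the thresholds make |μ̃_j| at least b_j N, and β_j ≥ 2 makes it comparable from above to
|μ_j|. Writing |μ̃_j|⁻¹ = |μ̃_j|^{-θ} |μ̃_j|^{-(1-θ)}, the first power gives the decay (b_j N)^{-θ}
and the second gives the smoothing weight (1 + |x - a||a - b|)^{-(1-θ)}; this is `norm_factor_le`.

Trilinear bounds (`exists_generationBound`): with that weight, the product with a derivative on the
second factor maps H^s × H^s × H^s to H^s, and it maps to H^{s-1} if any one of the three inputs is
only in H^{s-1}. Without the weight it maps H^s × H^s × H^s to H^{s-1}. With γ = 1 - min(s, 3/4) the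
smoothing exponent is 2γ, and 1/4 ≤ γ < 1/2 is what the kernel bounds need.

Trees: the last generation has no denominator and yields a function in H^{s-1} at one leaf of the
smaller tree. Peeling off the remaining generations one by one, exactly one leaf has the low
regularity at every stage, so each tree costs one constant per generation
(`OrderedTree.nrm_treeIntegral_le`, `OrderedTree.nrm_remainder_tree_le`). There are at most
1·3·5⋯(2J+1) trees (`OrderedTree.card_le`), and admissibility says that the product of the factors
b_j^{-θ} absorbs this number together with the geometric constants (`const_le_of_admissible`).

Convergence follows from the factor N^{-θJ} when ‖v‖² < N^θ. The model thresholds beat every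
geometric constant (`admissible_modelBeta`), hence also powers of ‖v‖² + 1, and then no smallness is
needed. -/

/-! ### The Japanese bracket -/

/-- The Japanese bracket `⟨x⟩ = (1 + x²)^{1/2}`. -/
noncomputable def br (x : ℝ) : ℝ := √(1 + x ^ 2)

theorem br_sq (x : ℝ) : br x ^ 2 = 1 + x ^ 2 := Real.sq_sqrt (by positivity)

theorem one_le_br (x : ℝ) : 1 ≤ br x := Real.one_le_sqrt.2 (by nlinarith [sq_nonneg x])

theorem br_pos (x : ℝ) : 0 < br x := one_pos.trans_le (one_le_br x)

theorem abs_le_br (x : ℝ) : |x| ≤ br x := Real.abs_le_sqrt (by linarith)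

theorem br_le_one_add_abs (x : ℝ) : br x ≤ 1 + |x| :=
  Real.sqrt_le_iff.2 ⟨by positivity, by nlinarith [abs_nonneg x, sq_abs x]⟩

/-- The additive form of the comparison of brackets; all case distinctions between the frequencies
rest on it. After squaring, only y(x - y) ≤ ⟨y⟩|x - y| is needed. -/
theorem br_le_add (x y : ℝ) : br x ≤ br y + |x - y| := by
  refine abs_le_of_sq_le_sq' ?_ (by positivity [br_pos y]) |>.2
  have h1 := br_sq x
  have h2 := br_sq y
  have h3 := sq_abs (x - y)
  have h4 : y * (x - y) ≤ br y * |x - y| := by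
    calc y * (x - y) ≤ |y * (x - y)| := le_abs_self _
      _ = |y| * |x - y| := abs_mul _ _
      _ ≤ _ := by gcongr; exact abs_le_br y
  nlinarith

theorem br_le_two_mul_abs {x : ℝ} (hx : 1 ≤ |x|) : br x ≤ 2 * |x| := by
  linarith [br_le_one_add_abs x]

theorem continuous_br : Continuous br := by unfold br; fun_prop

@[fun_prop] theorem measurable_br : Measurable br := continuous_br.measurable

theorem one_add_sq_rpow (x σ : ℝ) : (1 + x ^ 2) ^ (σ / 2) = br x ^ σ := by
  rw [br, Real.sqrt_eq_rpow, ← Real.rpow_mul (by positivity)]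
  congr 1; ring

theorem br_rpow_le_one (x : ℝ) {p : ℝ} (hp : p ≤ 0) : br x ^ p ≤ 1 :=
  Real.rpow_le_one_of_one_le_of_nonpos (one_le_br x) hp

theorem integrable_br_rpow {p : ℝ} (hp : 1 < p) : Integrable (fun x => br x ^ (-p)) := by
  have := integrable_rpow_neg_one_add_norm_sq (E := ℝ) (μ := volume) (r := p) (by simpa using hp)
  refine this.congr (Eventually.of_forall fun x => ?_)
  simp only [Real.norm_eq_abs, sq_abs]
  exact one_add_sq_rpow x (-p)

theorem lintegral_br_rpow_lt_top {p : ℝ} (hp : 1 < p) :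
    ∫⁻ x, ENNReal.ofReal (br x ^ (-p)) < ∞ :=
  (integrable_br_rpow hp).lintegral_lt_top

/-- The exponent -1 + δ is integrable at the origin, and at infinity the total exponent -1 + δ - q
lies below -1. -/
theorem lintegral_abs_rpow_mul_br_rpow_lt_top {δ q : ℝ} (h0 : 0 < δ) (hq : δ < q) (hδ : δ ≤ 1) :
    ∫⁻ x, ENNReal.ofReal (|x| ^ (-1 + δ) * br x ^ (-q)) < ∞ := by
  have hint : Integrable (fun x : ℝ => (Set.Icc (-1) 1).indicator (fun x => |x| ^ (-1 + δ)) x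
      + 2 * br x ^ (-(1 + q - δ))) := by
    refine Integrable.add ?_ ((integrable_br_rpow (by linarith)).const_mul 2)
    refine IntegrableOn.integrable_indicator ?_ measurableSet_Icc
    have hr : IntegrableOn (fun x : ℝ => |x| ^ (-1 + δ)) (Set.Ioc 0 1) := by
      have := intervalIntegral.intervalIntegrable_rpow' (a := 0) (b := 1) (r := -1 + δ)
        (by linarith)
      rw [intervalIntegrable_iff_integrableOn_Ioc_of_le zero_le_one] at this
      refine this.congr_fun (fun x hx => ?_) measurableSet_Ioc
      simp only [abs_of_pos hx.1]
    have hl : IntegrableOn (fun x : ℝ => |x| ^ (-1 + δ)) (Set.Ico (-1) 0) := by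
      have h2 := (integrable_indicator_iff measurableSet_Ioc).2 hr
      have h3 := h2.comp_neg
      rw [← integrable_indicator_iff measurableSet_Ico]
      refine h3.congr (Eventually.of_forall fun x => ?_)
      simp only [Set.indicator, Set.mem_Ioc, Set.mem_Ico, abs_neg]
      refine if_congr ⟨fun h => ⟨by linarith [h.2], by linarith [h.1]⟩,
        fun h => ⟨by linarith [h.2], by linarith [h.1]⟩⟩ rfl rfl
    have : Set.Icc (-1 : ℝ) 1 ⊆ Set.Ico (-1) 0 ∪ Set.Icc 0 1 := by
      intro x hx
      rcases lt_or_ge x 0 with h | h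
      · exact Or.inl ⟨hx.1, h⟩
      · exact Or.inr ⟨h, hx.2⟩
    exact (hl.union ((integrableOn_Icc_iff_integrableOn_Ioc (by simp)).2 hr)).mono_set this
  refine lt_of_le_of_lt (lintegral_mono fun x => ENNReal.ofReal_le_ofReal ?_) hint.lintegral_lt_top
  have hb := br_pos x
  by_cases hx : |x| ≤ 1
  · rw [Set.indicator_of_mem (Set.mem_Icc.2 (abs_le.1 hx))]
    have h1 : br x ^ (-q) ≤ 1 := br_rpow_le_one x (by linarith)
    have : 0 ≤ |x| ^ (-1 + δ) := by positivity
    have : 0 ≤ br x ^ (-(1 + q - δ)) := by positivity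
    nlinarith
  · rw [Set.indicator_of_notMem (by rwa [Set.mem_Icc, ← abs_le])]
    push Not at hx
    have h1 : |x| ^ (-1 + δ) ≤ (br x / 2) ^ (-1 + δ) :=
      Real.rpow_le_rpow_of_nonpos (by positivity) (by linarith [br_le_two_mul_abs hx.le])
        (by linarith)
    rw [Real.div_rpow hb.le (by norm_num)] at h1
    have h2 : (2 : ℝ)⁻¹ ≤ 2 ^ (-1 + δ) := by
      rw [← Real.rpow_neg_one]
      exact Real.rpow_le_rpow_of_exponent_le (by norm_num) (by linarith)
    have h3 : br x ^ (-1 + δ) / 2 ^ (-1 + δ) ≤ br x ^ (-1 + δ) * 2 := by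
      rw [div_eq_mul_inv]
      gcongr
      rw [inv_le_comm₀ (by positivity) (by norm_num)]
      exact h2
    calc |x| ^ (-1 + δ) * br x ^ (-q) ≤ (br x ^ (-1 + δ) * 2) * br x ^ (-q) := by
          gcongr; exact h1.trans h3
      _ = 0 + 2 * br x ^ (-(1 + q - δ)) := by
          rw [mul_right_comm, ← Real.rpow_add hb]; ring_nf

/-! ### Trilinear operators with nonnegative kernels -/

/-- The trilinear operator with kernel `k` over the frequencies `x = a - b + c`. -/
noncomputable def tri (k : ℝ → ℝ → ℝ → ℝ≥0∞) (f₁ f₂ f₃ : ℝ → ℝ≥0∞) (x : ℝ) : ℝ≥0∞ :=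
  ∫⁻ η : ℝ × ℝ, k x η.1 η.2 * (f₁ η.1 * f₂ η.2 * f₃ (x - η.1 + η.2))

/-- The squared `L²` norm. -/
noncomputable def sqNorm (f : ℝ → ℝ≥0∞) : ℝ≥0∞ := ∫⁻ x, f x ^ 2

/-- Boundedness of `tri k` from `L² × L² × L²` to `L²`. -/
def TriBdd (k : ℝ → ℝ → ℝ → ℝ≥0∞) : Prop :=
  ∃ C : ℝ≥0∞, C ≠ ∞ ∧ ∀ f₁ f₂ f₃ : ℝ → ℝ≥0∞, Measurable f₁ → Measurable f₂ → Measurable f₃ →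
    sqNorm (tri k f₁ f₂ f₃) ≤ C * (sqNorm f₁ * sqNorm f₂ * sqNorm f₃)

theorem lintegral_mul_sq_le {α : Type*} [MeasurableSpace α] (μ : Measure α) {f g : α → ℝ≥0∞}
    (hf : AEMeasurable f μ) (hg : AEMeasurable g μ) :
    (∫⁻ x, f x * g x ∂μ) ^ 2 ≤ (∫⁻ x, f x ^ 2 ∂μ) * ∫⁻ x, g x ^ 2 ∂μ := by
  have h := ENNReal.lintegral_mul_le_Lp_mul_Lq μ Real.HolderConjugate.two_two hf hg
  simp only [Pi.mul_apply, ENNReal.rpow_two] at h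
  calc (∫⁻ x, f x * g x ∂μ) ^ 2 ≤ ((∫⁻ x, f x ^ 2 ∂μ) ^ (1 / 2 : ℝ) *
        (∫⁻ x, g x ^ 2 ∂μ) ^ (1 / 2 : ℝ)) ^ 2 := by gcongr
    _ = _ := by
      rw [mul_pow, ← ENNReal.rpow_two, ← ENNReal.rpow_two, ← ENNReal.rpow_mul, ← ENNReal.rpow_mul]
      norm_num

theorem measurable_tri_integrand {k : ℝ → ℝ → ℝ → ℝ≥0∞}
    (hk : Measurable fun p : ℝ × ℝ × ℝ => k p.1 p.2.1 p.2.2) {f₁ f₂ f₃ : ℝ → ℝ≥0∞}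
    (h₁ : Measurable f₁) (h₂ : Measurable f₂) (h₃ : Measurable f₃) :
    Measurable fun p : ℝ × ℝ × ℝ =>
      k p.1 p.2.1 p.2.2 * (f₁ p.2.1 * f₂ p.2.2 * f₃ (p.1 - p.2.1 + p.2.2)) := by
  fun_prop

theorem measurable_tri {k : ℝ → ℝ → ℝ → ℝ≥0∞}
    (hk : Measurable fun p : ℝ × ℝ × ℝ => k p.1 p.2.1 p.2.2) {f₁ f₂ f₃ : ℝ → ℝ≥0∞}
    (h₁ : Measurable f₁) (h₂ : Measurable f₂) (h₃ : Measurable f₃) :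
    Measurable (tri k f₁ f₂ f₃) :=
  (measurable_tri_integrand hk h₁ h₂ h₃).lintegral_prod_right'

theorem add_sq_le_two_mul (a b : ℝ≥0∞) : (a + b) ^ 2 ≤ 2 * (a ^ 2 + b ^ 2) := by
  have := ENNReal.rpow_add_le_mul_rpow_add_rpow a b (p := 2) (by norm_num)
  have e : (2 : ℝ) - 1 = 1 := by norm_num
  rwa [e, ENNReal.rpow_one, ENNReal.rpow_two, ENNReal.rpow_two, ENNReal.rpow_two] at this

theorem TriBdd.add {k k' : ℝ → ℝ → ℝ → ℝ≥0∞} (h : TriBdd k) (h' : TriBdd k')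
    (hk : Measurable fun p : ℝ × ℝ × ℝ => k p.1 p.2.1 p.2.2) :
    TriBdd (fun x a b => k x a b + k' x a b) := by
  obtain ⟨C, hC, hb⟩ := h
  obtain ⟨C', hC', hb'⟩ := h'
  refine ⟨2 * (C + C'), by finiteness, fun f₁ f₂ f₃ h₁ h₂ h₃ => ?_⟩
  have hm := measurable_tri_integrand hk h₁ h₂ h₃
  calc sqNorm (tri (fun x a b => k x a b + k' x a b) f₁ f₂ f₃)
      ≤ ∫⁻ x, 2 * (tri k f₁ f₂ f₃ x ^ 2 + tri k' f₁ f₂ f₃ x ^ 2) := by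
        refine lintegral_mono fun x => ?_
        refine le_trans (le_of_eq ?_) (add_sq_le_two_mul _ _)
        congr 1
        simp only [tri, add_mul]
        exact lintegral_add_left (hm.comp measurable_prodMk_left) _
    _ = 2 * (sqNorm (tri k f₁ f₂ f₃) + sqNorm (tri k' f₁ f₂ f₃)) := by
        rw [lintegral_const_mul' _ _ (by finiteness), lintegral_add_left]
        · rfl
        · exact (measurable_tri hk h₁ h₂ h₃).pow_const 2
    _ ≤ 2 * (C * (sqNorm f₁ * sqNorm f₂ * sqNorm f₃) + C' * (sqNorm f₁ * sqNorm f₂ * sqNorm f₃)) := by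
        gcongr
        · exact hb _ _ _ h₁ h₂ h₃
        · exact hb' _ _ _ h₁ h₂ h₃
    _ = _ := by ring

theorem tri_swap {k : ℝ → ℝ → ℝ → ℝ≥0∞}
    (hk : Measurable fun p : ℝ × ℝ × ℝ => k p.1 p.2.1 p.2.2) {f₁ f₂ f₃ : ℝ → ℝ≥0∞}
    (h₁ : Measurable f₁) (h₂ : Measurable f₂) (h₃ : Measurable f₃) (x : ℝ) :
    tri (fun x a b => k x (x - a + b) b) f₁ f₂ f₃ x = tri k f₃ f₂ f₁ x := by
  unfold tri
  have hm := measurable_tri_integrand hk h₃ h₂ h₁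
  rw [Measure.volume_eq_prod, lintegral_prod_symm', lintegral_prod_symm']
  · refine lintegral_congr fun b => ?_
    -- With b fixed, the reflection a ↦ x + b - a exchanges the first and the third child.
    rw [← lintegral_sub_left_eq_self _ (x + b)]
    refine lintegral_congr fun a => ?_
    simp only
    have e1 : x - (x + b - a) + b = a := by ring
    have e2 : x - a + b = x + b - a := by ring
    rw [e1, e2]
    ring
  · exact hm.comp measurable_prodMk_left
  · fun_prop

theorem TriBdd.swap {k : ℝ → ℝ → ℝ → ℝ≥0∞} (h : TriBdd k)
    (hk : Measurable fun p : ℝ × ℝ × ℝ => k p.1 p.2.1 p.2.2) :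
    TriBdd (fun x a b => k x (x - a + b) b) := by
  obtain ⟨C, hC, hb⟩ := h
  refine ⟨C, hC, fun f₁ f₂ f₃ h₁ h₂ h₃ => ?_⟩
  have : tri (fun x a b => k x (x - a + b) b) f₁ f₂ f₃ = tri k f₃ f₂ f₁ :=
    funext fun x => tri_swap hk h₁ h₂ h₃ x
  rw [this]
  refine (hb _ _ _ h₃ h₂ h₁).trans (le_of_eq ?_)
  ring

/-- The `L²` integral over all frequencies of a product factors. -/
theorem lintegral_triple_sq {f₁ f₂ f₃ : ℝ → ℝ≥0∞}
    (h₁ : Measurable f₁) (h₂ : Measurable f₂) (h₃ : Measurable f₃) :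
    ∫⁻ x : ℝ, ∫⁻ η : ℝ × ℝ, (f₁ η.1 * f₂ η.2 * f₃ (x - η.1 + η.2)) ^ 2 =
      sqNorm f₁ * sqNorm f₂ * sqNorm f₃ := by
  rw [lintegral_lintegral_swap (by fun_prop)]
  have : ∀ η : ℝ × ℝ, ∫⁻ x : ℝ, (f₁ η.1 * f₂ η.2 * f₃ (x - η.1 + η.2)) ^ 2 =
      (f₁ η.1 ^ 2 * f₂ η.2 ^ 2) * sqNorm f₃ := by
    intro η
    simp_rw [mul_pow]
    rw [lintegral_const_mul _ (by fun_prop)]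
    congr 1
    have := lintegral_add_right_eq_self (μ := (volume : Measure ℝ)) (fun x => f₃ x ^ 2) (- η.1 + η.2)
    simp_rw [sub_eq_add_neg, add_assoc]
    exact this
  simp_rw [this]
  rw [lintegral_mul_const _ (by fun_prop), Measure.volume_eq_prod,
    lintegral_prod_mul (f := fun a => f₁ a ^ 2) (g := fun a => f₂ a ^ 2) (by fun_prop) (by fun_prop)]
  rfl

/-- Cauchy–Schwarz with the kernel square integrable in the inner variables. -/
theorem TriBdd.of_sq {k : ℝ → ℝ → ℝ → ℝ≥0∞}
    (hk : Measurable fun p : ℝ × ℝ × ℝ => k p.1 p.2.1 p.2.2) (C : ℝ≥0∞) (hC : C ≠ ∞)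
    (h : ∀ x, ∫⁻ η : ℝ × ℝ, k x η.1 η.2 ^ 2 ≤ C) : TriBdd k := by
  refine ⟨C, hC, fun f₁ f₂ f₃ h₁ h₂ h₃ => ?_⟩
  rw [← lintegral_triple_sq h₁ h₂ h₃, ← lintegral_const_mul' _ _ hC]
  refine lintegral_mono fun x => ?_
  unfold tri
  refine (lintegral_mul_sq_le _ ?_ ?_).trans ?_
  · exact (hk.comp measurable_prodMk_left).aemeasurable
  · fun_prop
  · gcongr
    exact h x

theorem le_rpow_half_of_sq_le {a b : ℝ≥0∞} (h : a ^ 2 ≤ b) : a ≤ b ^ (1 / 2 : ℝ) := by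
  calc a = (a ^ 2) ^ (1 / 2 : ℝ) := by
        rw [← ENNReal.rpow_two, ← ENNReal.rpow_mul]; norm_num
    _ ≤ _ := by gcongr

theorem rpow_half_sq (a : ℝ≥0∞) : (a ^ (1 / 2 : ℝ)) ^ 2 = a := by
  rw [← ENNReal.rpow_two, ← ENNReal.rpow_mul]; norm_num

/-- If the kernel depends on the outer variable and the third child only, then the first two factors
can be taken out by the Cauchy–Schwarz inequality. -/
theorem tri_third_sq_le {k : ℝ → ℝ → ℝ≥0∞} (hk : Measurable fun p : ℝ × ℝ => k p.1 p.2)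
    {f₁ f₂ f₃ : ℝ → ℝ≥0∞} (h₁ : Measurable f₁) (h₂ : Measurable f₂) (h₃ : Measurable f₃) (x : ℝ) :
    tri (fun x a b => k x (x - a + b)) f₁ f₂ f₃ x ^ 2 ≤
      sqNorm f₁ * sqNorm f₂ * (∫⁻ c, k x c * f₃ c) ^ 2 := by
  have hkx : Measurable (k x) := hk.comp measurable_prodMk_left
  -- With the third frequency c as a variable, the rest is a correlation of f₁ and f₂. It is bounded
  -- by the product of their L² norms uniformly in the shift, see `e2`.
  have e1 : tri (fun x a b => k x (x - a + b)) f₁ f₂ f₃ x =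
      ∫⁻ c : ℝ, k x c * f₃ c * ∫⁻ a : ℝ, f₁ a * f₂ (c - x + a) := by
    unfold tri
    rw [Measure.volume_eq_prod, lintegral_prod _ (by fun_prop)]
    have : ∀ a : ℝ, ∫⁻ b : ℝ, k x (x - a + b) * (f₁ a * f₂ b * f₃ (x - a + b)) =
        ∫⁻ c : ℝ, k x c * (f₁ a * f₂ (c - x + a) * f₃ c) := by
      intro a
      rw [← lintegral_add_right_eq_self _ (a - x)]
      refine lintegral_congr fun c => ?_
      have e : x - a + (c + (a - x)) = c := by ring
      have e' : c + (a - x) = c - x + a := by ring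
      rw [e, e']
    simp_rw [this]
    rw [lintegral_lintegral_swap (by fun_prop)]
    refine lintegral_congr fun c => ?_
    rw [← lintegral_const_mul _ (by fun_prop)]
    refine lintegral_congr fun a => ?_
    ring
  have e2 : ∀ y, ∫⁻ a : ℝ, f₁ a * f₂ (y + a) ≤ (sqNorm f₁ * sqNorm f₂) ^ (1 / 2 : ℝ) := by
    intro y
    refine le_rpow_half_of_sq_le
      ((lintegral_mul_sq_le _ (by fun_prop) (by fun_prop)).trans (le_of_eq ?_))
    congr 1
    exact lintegral_add_left_eq_self (μ := (volume : Measure ℝ)) (fun x => f₂ x ^ 2) y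
  rw [e1, ← rpow_half_sq (sqNorm f₁ * sqNorm f₂), ← mul_pow, ← lintegral_const_mul _ (by fun_prop)]
  refine pow_le_pow_left' (lintegral_mono fun c => ?_) 2
  rw [mul_comm]
  exact mul_le_mul_left (e2 _) _

/-- Two weights that are square integrable, one in the outer variable and one at the third child. -/
theorem TriBdd.of_outer_third {u w : ℝ → ℝ≥0∞} (hu : Measurable u) (hw : Measurable w)
    (hu' : sqNorm u ≠ ∞) (hw' : sqNorm w ≠ ∞) : TriBdd (fun x a b => u x * w (x - a + b)) := by
  refine ⟨sqNorm u * sqNorm w, by finiteness, fun f₁ f₂ f₃ h₁ h₂ h₃ => ?_⟩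
  calc sqNorm (tri (fun x a b => u x * w (x - a + b)) f₁ f₂ f₃)
      ≤ ∫⁻ x, u x ^ 2 * (sqNorm w * (sqNorm f₁ * sqNorm f₂ * sqNorm f₃)) := by
        refine lintegral_mono fun x => ?_
        refine (tri_third_sq_le (k := fun x c => u x * w c) (by fun_prop) h₁ h₂ h₃ x).trans ?_
        simp_rw [mul_assoc]
        rw [lintegral_const_mul _ (by fun_prop), mul_pow]
        calc sqNorm f₁ * (sqNorm f₂ * (u x ^ 2 * (∫⁻ c, w c * f₃ c) ^ 2))
            ≤ sqNorm f₁ * (sqNorm f₂ * (u x ^ 2 * (sqNorm w * sqNorm f₃))) := by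
              gcongr
              exact lintegral_mul_sq_le _ hw.aemeasurable h₃.aemeasurable
          _ = _ := by ring
    _ = _ := by
        rw [lintegral_mul_const _ (by fun_prop)]
        change sqNorm u * _ = _
        ring

/-- An integrable function of the difference between the outer variable and the third child. -/
theorem TriBdd.of_conv {κ : ℝ → ℝ≥0∞} (hκ : Measurable κ) (hκ' : ∫⁻ x, κ x ≠ ∞) :
    TriBdd (fun _ a b => κ (a - b)) := by
  refine ⟨(∫⁻ x, κ x) ^ 2, by finiteness, fun f₁ f₂ f₃ h₁ h₂ h₃ => ?_⟩
  have hκi : ∀ x, ∫⁻ c, κ (x - c) = ∫⁻ c, κ c := fun x => lintegral_sub_left_eq_self κ x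
  have hk : (fun (_ : ℝ) a b => κ (a - b)) = fun x a b => κ (x - (x - a + b)) := by
    funext x a b; congr 1; ring
  rw [hk]
  calc sqNorm (tri (fun x a b => κ (x - (x - a + b))) f₁ f₂ f₃)
      ≤ ∫⁻ x, sqNorm f₁ * sqNorm f₂ * ((∫⁻ c, κ c) * ∫⁻ c, κ (x - c) * f₃ c ^ 2) := by
        refine lintegral_mono fun x => ?_
        refine (tri_third_sq_le (k := fun x c => κ (x - c)) (by fun_prop) h₁ h₂ h₃ x).trans ?_
        gcongr
        -- Proof of Young's inequality L¹ * L² → L²: one half power of κ goes with each factor in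
        -- Cauchy–Schwarz.
        have := lintegral_mul_sq_le volume (f := fun c => κ (x - c) ^ (1 / 2 : ℝ))
          (g := fun c => κ (x - c) ^ (1 / 2 : ℝ) * f₃ c) (by fun_prop) (by fun_prop)
        simp_rw [← mul_assoc, ← sq, mul_pow, rpow_half_sq, hκi] at this
        exact this
    _ = sqNorm f₁ * sqNorm f₂ * ((∫⁻ c, κ c) * ∫⁻ x, ∫⁻ c, κ (x - c) * f₃ c ^ 2) := by
        rw [lintegral_const_mul _ (by fun_prop), lintegral_const_mul _ (by fun_prop)]
    _ = sqNorm f₁ * sqNorm f₂ * ((∫⁻ c, κ c) * ((∫⁻ c, κ c) * sqNorm f₃)) := by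
        congr 2
        rw [lintegral_lintegral_swap (by fun_prop)]
        have : ∀ c, ∫⁻ x, κ (x - c) * f₃ c ^ 2 = (∫⁻ c, κ c) * f₃ c ^ 2 := fun c => by
          rw [lintegral_mul_const _ (by fun_prop), lintegral_sub_right_eq_self κ c]
        simp_rw [this]
        rw [lintegral_const_mul _ (by fun_prop)]
        rfl
    _ = _ := by ring

/-! ### Real kernels and criteria for their boundedness -/

/-- `tri` with a real kernel is bounded. -/
def TriBddReal (k : ℝ → ℝ → ℝ → ℝ) : Prop := TriBdd fun x a b => ENNReal.ofReal (k x a b)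

/-- The modulation vanishes exactly on these two lines. Discarding them allows negative powers of |x
- a| and |a - b| in kernel comparisons. -/
theorem ae_ne_diagonal (x : ℝ) : ∀ᵐ η : ℝ × ℝ, η.1 ≠ x ∧ η.1 ≠ η.2 := by
  refine Filter.Eventually.and ?_ ?_
  · have : ∀ᵐ a : ℝ, a ≠ x := by simp [ae_iff]
    exact Measure.quasiMeasurePreserving_fst.ae this
  · rw [Measure.volume_eq_prod, Measure.ae_prod_iff_ae_ae]
    · refine Eventually.of_forall fun a => ?_
      simp only
      have : ∀ᵐ b : ℝ, b ≠ a := by simp [ae_iff]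
      filter_upwards [this] with b hb using hb.symm
    · exact (measurableSet_eq_fun measurable_fst measurable_snd).compl

theorem TriBddReal.mono {k k' : ℝ → ℝ → ℝ → ℝ} (h : TriBddReal k') (A : ℝ) (hA : 0 ≤ A)
    (hk : ∀ x a b, a ≠ x → a ≠ b → k x a b ≤ A * k' x a b) : TriBddReal k := by
  obtain ⟨C, hC, hb⟩ := h
  refine ⟨ENNReal.ofReal A ^ 2 * C, by finiteness, fun f₁ f₂ f₃ h₁ h₂ h₃ => ?_⟩
  refine le_trans ?_ ((mul_le_mul_right (hb f₁ f₂ f₃ h₁ h₂ h₃) _).trans (mul_assoc _ _ _).symm.le)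
  unfold sqNorm
  rw [← lintegral_const_mul' _ _ (by finiteness)]
  refine lintegral_mono fun x => ?_
  simp only
  rw [← mul_pow]
  refine pow_le_pow_left' ?_ 2
  unfold tri
  rw [← lintegral_const_mul' _ _ (by finiteness)]
  refine lintegral_mono_ae ?_
  filter_upwards [ae_ne_diagonal x] with η hη
  rw [← mul_assoc (ENNReal.ofReal A), ← ENNReal.ofReal_mul hA]
  exact mul_le_mul_left (ENNReal.ofReal_le_ofReal (hk _ _ _ hη.1 hη.2)) _

theorem TriBddReal.add {k k' : ℝ → ℝ → ℝ → ℝ} (h : TriBddReal k) (h' : TriBddReal k')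
    (hk : Measurable fun p : ℝ × ℝ × ℝ => k p.1 p.2.1 p.2.2)
    (h0 : ∀ x a b, 0 ≤ k x a b) (h0' : ∀ x a b, 0 ≤ k' x a b) :
    TriBddReal fun x a b => k x a b + k' x a b := by
  have := TriBdd.add h h' (by fun_prop)
  unfold TriBddReal
  simp_rw [fun x a b => ENNReal.ofReal_add (h0 x a b) (h0' x a b)]
  exact this

theorem TriBddReal.swap {k : ℝ → ℝ → ℝ → ℝ} (h : TriBddReal k)
    (hk : Measurable fun p : ℝ × ℝ × ℝ => k p.1 p.2.1 p.2.2) :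
    TriBddReal fun x a b => k x (x - a + b) b :=
  TriBdd.swap h (by fun_prop)

/-- As `u` does not depend on b, the square integral of the kernel can be taken in b first,
uniformly in a, and then in a. -/
theorem TriBddReal.of_sq {u w : ℝ → ℝ → ℝ → ℝ}
    (hu : Measurable fun p : ℝ × ℝ × ℝ => u p.1 p.2.1 p.2.2)
    (hw : Measurable fun p : ℝ × ℝ × ℝ => w p.1 p.2.1 p.2.2)
    (hu0 : ∀ x a b, 0 ≤ u x a b) (C D : ℝ≥0∞) (hC : C ≠ ∞) (hD : D ≠ ∞)
    (hub : ∀ x a b b', u x a b = u x a b')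
    (huC : ∀ x, ∫⁻ a, ENNReal.ofReal (u x a 0) ^ 2 ≤ C)
    (hwD : ∀ x a, ∫⁻ b, ENNReal.ofReal (w x a b) ^ 2 ≤ D) :
    TriBddReal fun x a b => u x a b * w x a b := by
  refine TriBdd.of_sq (by fun_prop) (C * D) (by finiteness) fun x => ?_
  have hux : Measurable fun p : ℝ × ℝ => u x p.1 p.2 := hu.comp measurable_prodMk_left
  have hwx : Measurable fun p : ℝ × ℝ => w x p.1 p.2 := hw.comp measurable_prodMk_left
  rw [Measure.volume_eq_prod, lintegral_prod _ (by fun_prop)]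
  calc ∫⁻ a, ∫⁻ b, ENNReal.ofReal (u x a b * w x a b) ^ 2
      ≤ ∫⁻ a, ENNReal.ofReal (u x a 0) ^ 2 * D := by
        refine lintegral_mono fun a => ?_
        simp_rw [fun b => ENNReal.ofReal_mul (hu0 x a b) (q := w x a b), mul_pow, fun b => hub x a b 0]
        rw [lintegral_const_mul' _ _ (by finiteness)]
        gcongr
        exact hwD x a
    _ ≤ C * D := by
        rw [lintegral_mul_const' _ _ hD]
        gcongr
        exact huC x

theorem lintegral_ofReal_sq_br {p : ℝ} (hp : 1 / 2 < p) :
    sqNorm (fun y => ENNReal.ofReal (br y ^ (-p))) ≠ ∞ := by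
  refine ne_of_lt (lt_of_le_of_lt (le_of_eq ?_) (lintegral_br_rpow_lt_top (p := 2 * p) (by linarith)))
  refine lintegral_congr fun y => ?_
  have := br_pos y
  rw [← ENNReal.ofReal_pow (by positivity), ← Real.rpow_mul_natCast (by positivity)]
  congr 2; push_cast; ring

/-- The square is |y|^{-1+δ}⟨y⟩^{-2δ}, which is barely integrable at both ends. This profile absorbs
the modulation weight near its zeros. -/
theorem lintegral_ofReal_sq_sing {δ : ℝ} (h0 : 0 < δ) (h1 : δ ≤ 1) :
    sqNorm (fun y => ENNReal.ofReal (|y| ^ ((-1 + δ) / 2) * br y ^ (-δ))) ≠ ∞ := by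
  refine ne_of_lt (lt_of_le_of_lt (le_of_eq ?_)
    (lintegral_abs_rpow_mul_br_rpow_lt_top (δ := δ) (q := 2 * δ) h0 (by linarith) h1))
  refine lintegral_congr fun y => ?_
  have := br_pos y
  rw [← ENNReal.ofReal_pow (by positivity), mul_pow, ← Real.rpow_mul_natCast (by positivity),
    ← Real.rpow_mul_natCast (by positivity)]
  congr 3 <;> push_cast <;> ring

theorem TriBddReal.of_first_diff_third {u w : ℝ → ℝ} (hu : Measurable u) (hw : Measurable w)
    (hu0 : ∀ x, 0 ≤ u x) (hu' : sqNorm (fun y => ENNReal.ofReal (u y)) ≠ ∞)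
    (hw' : sqNorm (fun y => ENNReal.ofReal (w y)) ≠ ∞) :
    TriBddReal fun x a b => u (x - a) * w (x - a + b) := by
  refine TriBddReal.of_sq (u := fun x a _ => u (x - a)) (w := fun x a b => w (x - a + b))
    (by fun_prop) (by fun_prop) (fun _ _ _ => hu0 _) _ _ hu' hw' (fun _ _ _ _ => rfl)
    (fun x => le_of_eq ?_) (fun x a => le_of_eq ?_)
  · exact lintegral_sub_left_eq_self (fun y => ENNReal.ofReal (u y) ^ 2) x
  · exact lintegral_add_left_eq_self (fun y => ENNReal.ofReal (w y) ^ 2) (x - a)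

theorem TriBddReal.of_first_third {u w : ℝ → ℝ} (hu : Measurable u) (hw : Measurable w)
    (hu0 : ∀ x, 0 ≤ u x) (hu' : sqNorm (fun y => ENNReal.ofReal (u y)) ≠ ∞)
    (hw' : sqNorm (fun y => ENNReal.ofReal (w y)) ≠ ∞) :
    TriBddReal fun x a b => u a * w (x - a + b) := by
  refine TriBddReal.of_sq (u := fun x a _ => u a) (w := fun x a b => w (x - a + b))
    (by fun_prop) (by fun_prop) (fun _ _ _ => hu0 _) _ _ hu' hw' (fun _ _ _ _ => rfl)
    (fun x => le_rfl) (fun x a => le_of_eq ?_)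
  exact lintegral_add_left_eq_self (fun y => ENNReal.ofReal (w y) ^ 2) (x - a)

theorem TriBddReal.of_diffs {u w : ℝ → ℝ} (hu : Measurable u) (hw : Measurable w)
    (hu0 : ∀ x, 0 ≤ u x) (hu' : sqNorm (fun y => ENNReal.ofReal (u y)) ≠ ∞)
    (hw' : sqNorm (fun y => ENNReal.ofReal (w y)) ≠ ∞) :
    TriBddReal fun x a b => u (x - a) * w (a - b) := by
  refine TriBddReal.of_sq (u := fun x a _ => u (x - a)) (w := fun x a b => w (a - b))
    (by fun_prop) (by fun_prop) (fun _ _ _ => hu0 _) _ _ hu' hw' (fun _ _ _ _ => rfl)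
    (fun x => le_of_eq ?_) (fun x a => le_of_eq ?_)
  · exact lintegral_sub_left_eq_self (fun y => ENNReal.ofReal (u y) ^ 2) x
  · exact lintegral_sub_left_eq_self (fun y => ENNReal.ofReal (w y) ^ 2) a

theorem TriBddReal.of_outer_third {u w : ℝ → ℝ} (hu : Measurable u) (hw : Measurable w)
    (hu0 : ∀ x, 0 ≤ u x) (hu' : sqNorm (fun y => ENNReal.ofReal (u y)) ≠ ∞)
    (hw' : sqNorm (fun y => ENNReal.ofReal (w y)) ≠ ∞) :
    TriBddReal fun x a b => u x * w (x - a + b) := by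
  unfold TriBddReal
  simp_rw [fun x a b => ENNReal.ofReal_mul (hu0 x) (q := w (x - a + b))]
  exact TriBdd.of_outer_third (by fun_prop) (by fun_prop) hu' hw'

/-! ### Pointwise bounds for the kernels -/

/-- For exponents in [0, 1] one has M^p ≤ M, so the comparability constants below are numerical and
do not depend on γ. -/
theorem rpow_le_mul_rpow {y z M p : ℝ} (hy : 0 ≤ y) (hz : 0 ≤ z) (hM : 1 ≤ M) (h : y ≤ M * z)
    (hp : 0 ≤ p) (hp1 : p ≤ 1) : y ^ p ≤ M * z ^ p := by
  calc y ^ p ≤ (M * z) ^ p := Real.rpow_le_rpow hy h hp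
    _ = M ^ p * z ^ p := Real.mul_rpow (by linarith) hz
    _ ≤ M * z ^ p := by
      gcongr
      calc M ^ p ≤ M ^ (1 : ℝ) := Real.rpow_le_rpow_of_exponent_le hM hp1
        _ = M := Real.rpow_one M

theorem rpow_neg_le_mul_rpow_neg {y z M p : ℝ} (hy : 0 < y) (hz : 0 < z) (hM : 1 ≤ M)
    (h : z ≤ M * y) (hp : 0 ≤ p) (hp1 : p ≤ 1) : y ^ (-p) ≤ M * z ^ (-p) := by
  rw [Real.rpow_neg hy.le, Real.rpow_neg hz.le, ← div_eq_mul_inv, inv_eq_one_div,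
    div_le_div_iff₀ (by positivity) (by positivity), one_mul]
  exact rpow_le_mul_rpow hz.le hy.le hM h hp hp1

section pointwise

variable {γ X P Q R α β : ℝ}

/-- The sum of the kernels that control the trilinear form with one factor of low regularity. -/
noncomputable def lowMajorant (γ X R α β a' b' : ℝ) : ℝ :=
  (α ^ ((-1 + (1 / 2 - γ)) / 2) * a' ^ (-(1 / 2 - γ))) *
      (β ^ ((-1 + (1 / 2 - γ)) / 2) * b' ^ (-(1 / 2 - γ))) +
    (α ^ ((-1 + (1 / 2 - γ)) / 2) * a' ^ (-(1 / 2 - γ))) * R ^ (-((1 + (1 / 2 - γ)) / 2)) +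
    a' ^ (-(3 * γ)) * R ^ (-(1 - γ)) + X ^ (-(3 * γ)) * R ^ (-(1 - γ)) +
    β ^ (-1 + (1 - 2 * γ)) * b' ^ (-(1 : ℝ))

theorem modulation_weight_le (hα : 0 < α) (hβ : 0 < β) {p : ℝ} (hp : 0 ≤ p) :
    (1 + α * β) ^ (-p) ≤ α ^ (-p) * β ^ (-p) := by
  rw [← Real.mul_rpow hα.le hβ.le]
  exact Real.rpow_le_rpow_of_nonpos (by positivity) (by linarith) (by linarith)

/-- Here X, P, Q, R are the brackets of x, a, b, c = x - a + b, while α = |x - a| = |b - c| and β =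
|a - b| = |x - c|. If α is small, P ≲ X and Q ≲ R, which leaves R^{-2δ} with δ = 1/2 - γ. One factor
R^{-δ} supplies the decay in α; the other supplies the decay in β when β ≤ R, and otherwise joins
the power of β to give a square integrable power of R. -/
theorem low_kernel_near (h1 : 1 / 4 ≤ γ) (h2 : γ < 1 / 2) (hX : 1 ≤ X) (hP : 1 ≤ P) (hQ : 1 ≤ Q)
    (hR : 1 ≤ R) (hα : 0 < α) (hβ : 0 < β) (hPX : P ≤ X + α) (hQR : Q ≤ R + α)
    {a' b' : ℝ} (ha : 1 ≤ a') (hb : 1 ≤ b') (ha' : a' ≤ 1 + α) (hb' : b' ≤ 1 + β)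
    (c1 : α ≤ 4 * R) (c2 : α ≤ 4 * X) :
    X ^ (-γ) * Q ^ γ * P ^ γ * R ^ (-(1 - γ)) * (1 + α * β) ^ (-(2 * γ)) ≤
      1000 * ((α ^ ((-1 + (1 / 2 - γ)) / 2) * a' ^ (-(1 / 2 - γ))) *
      (β ^ ((-1 + (1 / 2 - γ)) / 2) * b' ^ (-(1 / 2 - γ)))) ∨
    X ^ (-γ) * Q ^ γ * P ^ γ * R ^ (-(1 - γ)) * (1 + α * β) ^ (-(2 * γ)) ≤
      1000 * ((α ^ ((-1 + (1 / 2 - γ)) / 2) * a' ^ (-(1 / 2 - γ))) *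
        R ^ (-((1 + (1 / 2 - γ)) / 2))) := by
  set δ := 1 / 2 - γ with hδ
  have hX0 : 0 < X := by linarith
  have hR0 : 0 < R := by linarith
  have hP0 : 0 < P := by linarith
  have hQ0 : 0 < Q := by linarith
  have e1 : P ^ γ ≤ 5 * X ^ γ :=
    rpow_le_mul_rpow hP0.le hX0.le (by norm_num) (by linarith) (by linarith) (by linarith)
  have e2 : Q ^ γ ≤ 5 * R ^ γ :=
    rpow_le_mul_rpow hQ0.le hR0.le (by norm_num) (by linarith) (by linarith) (by linarith)
  -- The full power 2γ may exceed 1/2 and would not be locally square integrable in α; it is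
  -- weakened to (1 - δ)/2 < 1/2.
  have e3 : (1 + α * β) ^ (-(2 * γ)) ≤ α ^ ((-1 + δ) / 2) * β ^ ((-1 + δ) / 2) := by
    have : -((1 - δ) / 2) = (-1 + δ) / 2 := by ring
    rw [← this]
    refine le_trans ?_ (modulation_weight_le hα hβ (by linarith))
    exact Real.rpow_le_rpow_of_exponent_le (by nlinarith [mul_pos hα hβ]) (by linarith)
  have e4 : R ^ (-δ) ≤ 5 * a' ^ (-δ) :=
    rpow_neg_le_mul_rpow_neg hR0 (by linarith) (by norm_num) (by linarith) (by linarith)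
      (by linarith)
  have e5 : X ^ (-γ) * X ^ γ = 1 := by rw [← Real.rpow_add hX0]; simp
  have e6 : R ^ γ * R ^ (-(1 - γ)) = R ^ (-δ) * R ^ (-δ) := by
    rw [← Real.rpow_add hR0, ← Real.rpow_add hR0]; congr 1; rw [hδ]; ring
  have main : X ^ (-γ) * Q ^ γ * P ^ γ * R ^ (-(1 - γ)) * (1 + α * β) ^ (-(2 * γ)) ≤
      125 * (α ^ ((-1 + δ) / 2) * a' ^ (-δ)) * (R ^ (-δ) * β ^ ((-1 + δ) / 2)) := by
    calc _ ≤ X ^ (-γ) * (5 * R ^ γ) * (5 * X ^ γ) * R ^ (-(1 - γ)) *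
          (α ^ ((-1 + δ) / 2) * β ^ ((-1 + δ) / 2)) := by gcongr
      _ = 25 * (X ^ (-γ) * X ^ γ) * (R ^ γ * R ^ (-(1 - γ))) *
          (α ^ ((-1 + δ) / 2) * β ^ ((-1 + δ) / 2)) := by ring
      _ = 25 * (α ^ ((-1 + δ) / 2) * R ^ (-δ)) * (R ^ (-δ) * β ^ ((-1 + δ) / 2)) := by
          rw [e5, e6]; ring
      _ ≤ 25 * (α ^ ((-1 + δ) / 2) * (5 * a' ^ (-δ))) * (R ^ (-δ) * β ^ ((-1 + δ) / 2)) := by gcongr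
      _ = _ := by ring
  have hR' : 0 ≤ α ^ ((-1 + δ) / 2) * a' ^ (-δ) := by positivity
  rcases le_total β R with h | h
  · left
    have : R ^ (-δ) ≤ 2 * b' ^ (-δ) :=
      rpow_neg_le_mul_rpow_neg hR0 (by linarith) (by norm_num) (by linarith) (by linarith)
        (by linarith)
    calc _ ≤ _ := main
      _ ≤ 125 * (α ^ ((-1 + δ) / 2) * a' ^ (-δ)) * ((2 * b' ^ (-δ)) * β ^ ((-1 + δ) / 2)) := by gcongr
      _ = 250 * ((α ^ ((-1 + δ) / 2) * a' ^ (-δ)) * (β ^ ((-1 + δ) / 2) * b' ^ (-δ))) := by ring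
      _ ≤ _ := by gcongr; norm_num
  · right
    have : β ^ ((-1 + δ) / 2) ≤ R ^ ((-1 + δ) / 2) :=
      Real.rpow_le_rpow_of_nonpos hR0 h (by linarith)
    have e : R ^ (-δ) * R ^ ((-1 + δ) / 2) = R ^ (-((1 + δ) / 2)) := by
      rw [← Real.rpow_add hR0]; congr 1; ring
    calc _ ≤ _ := main
      _ ≤ 125 * (α ^ ((-1 + δ) / 2) * a' ^ (-δ)) * (R ^ (-δ) * R ^ ((-1 + δ) / 2)) := by gcongr
      _ = 125 * ((α ^ ((-1 + δ) / 2) * a' ^ (-δ)) * R ^ (-((1 + δ) / 2))) := by rw [e]; ring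
      _ ≤ _ := by gcongr; norm_num

/-- Here X dominates R, so β ≥ X - R ≥ α/4 and both factors of the modulation are large. The power
3γ > 1/2 that remains is square integrable. -/
theorem low_kernel_middle (h1 : 1 / 4 ≤ γ) (h2 : γ < 1 / 2) (hX : 1 ≤ X) (hP : 1 ≤ P) (hQ : 1 ≤ Q)
    (hR : 1 ≤ R) (hα : 0 < α) (hβ : 0 < β) (hPX : P ≤ X + α) (hQR : Q ≤ R + α) (hXR : X ≤ R + β)
    {a' : ℝ} (ha : 1 ≤ a') (ha' : a' ≤ 1 + α) (c1 : 4 * R < α) (c2 : α ≤ 2 * X) :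
    X ^ (-γ) * Q ^ γ * P ^ γ * R ^ (-(1 - γ)) * (1 + α * β) ^ (-(2 * γ)) ≤
      1000 * (a' ^ (-(3 * γ)) * R ^ (-(1 - γ))) := by
  have hX0 : 0 < X := by linarith
  have hR0 : 0 < R := by linarith
  have hP0 : 0 < P := by linarith
  have hQ0 : 0 < Q := by linarith
  have ha0 : 0 < a' := by linarith
  have e1 : P ^ γ ≤ 3 * X ^ γ :=
    rpow_le_mul_rpow hP0.le hX0.le (by norm_num) (by linarith) (by linarith) (by linarith)
  have e2 : Q ^ γ ≤ 2 * α ^ γ :=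
    rpow_le_mul_rpow hQ0.le hα.le (by norm_num) (by linarith) (by linarith) (by linarith)
  have e3 := modulation_weight_le hα hβ (p := 2 * γ) (by linarith)
  have e4 : β ^ (-(2 * γ)) ≤ 8 * a' ^ (-(2 * γ)) :=
    rpow_neg_le_mul_rpow_neg hβ ha0 (by norm_num) (by linarith) (by linarith) (by linarith)
  have e5 : α ^ (-γ) ≤ 2 * a' ^ (-γ) :=
    rpow_neg_le_mul_rpow_neg hα ha0 (by norm_num) (by linarith) (by linarith) (by linarith)
  have e6 : X ^ (-γ) * X ^ γ = 1 := by rw [← Real.rpow_add hX0]; simp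
  have e7 : α ^ γ * α ^ (-(2 * γ)) = α ^ (-γ) := by rw [← Real.rpow_add hα]; congr 1; ring
  have e8 : a' ^ (-γ) * a' ^ (-(2 * γ)) = a' ^ (-(3 * γ)) := by
    rw [← Real.rpow_add ha0]; congr 1; ring
  calc _ ≤ X ^ (-γ) * (2 * α ^ γ) * (3 * X ^ γ) * R ^ (-(1 - γ)) *
          (α ^ (-(2 * γ)) * β ^ (-(2 * γ))) := by gcongr
    _ = 6 * (X ^ (-γ) * X ^ γ) * (α ^ γ * α ^ (-(2 * γ))) * R ^ (-(1 - γ)) * β ^ (-(2 * γ)) := by ring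
    _ ≤ 6 * 1 * (2 * a' ^ (-γ)) * R ^ (-(1 - γ)) * (8 * a' ^ (-(2 * γ))) := by
        rw [e6, e7]; gcongr
    _ = 96 * ((a' ^ (-γ) * a' ^ (-(2 * γ))) * R ^ (-(1 - γ))) := by ring
    _ ≤ _ := by rw [e8]; gcongr; norm_num

/-- Now R dominates X, so β ≥ R - X ≥ R/2. Both α and R exceed X, and their leftover powers -γ are
converted into powers of X. -/
theorem low_kernel_third (h1 : 1 / 4 ≤ γ) (h2 : γ < 1 / 2) (hX : 1 ≤ X) (hP : 1 ≤ P) (hQ : 1 ≤ Q)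
    (hR : 1 ≤ R) (hα : 0 < α) (hβ : 0 < β) (hPX : P ≤ X + α) (hQR : Q ≤ R + α) (hRX : R ≤ X + β)
    (c1 : 4 * X < α) (c2 : α ≤ 2 * R) :
    X ^ (-γ) * Q ^ γ * P ^ γ * R ^ (-(1 - γ)) * (1 + α * β) ^ (-(2 * γ)) ≤
      1000 * (X ^ (-(3 * γ)) * R ^ (-(1 - γ))) := by
  have hX0 : 0 < X := by linarith
  have hR0 : 0 < R := by linarith
  have hP0 : 0 < P := by linarith
  have hQ0 : 0 < Q := by linarith
  have e1 : P ^ γ ≤ 2 * α ^ γ :=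
    rpow_le_mul_rpow hP0.le hα.le (by norm_num) (by linarith) (by linarith) (by linarith)
  have e2 : Q ^ γ ≤ 3 * R ^ γ :=
    rpow_le_mul_rpow hQ0.le hR0.le (by norm_num) (by linarith) (by linarith) (by linarith)
  have e3 := modulation_weight_le hα hβ (p := 2 * γ) (by linarith)
  have e4 : β ^ (-(2 * γ)) ≤ 2 * R ^ (-(2 * γ)) :=
    rpow_neg_le_mul_rpow_neg hβ hR0 (by norm_num) (by linarith) (by linarith) (by linarith)
  have e5 : α ^ (-γ) ≤ X ^ (-γ) :=
    Real.rpow_le_rpow_of_nonpos hX0 (by linarith) (by linarith)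
  have e6 : R ^ (-γ) ≤ X ^ (-γ) :=
    Real.rpow_le_rpow_of_nonpos hX0 (by linarith) (by linarith)
  have e7 : α ^ γ * α ^ (-(2 * γ)) = α ^ (-γ) := by rw [← Real.rpow_add hα]; congr 1; ring
  have e8 : X ^ (-γ) * X ^ (-γ) * X ^ (-γ) = X ^ (-(3 * γ)) := by
    rw [← Real.rpow_add hX0, ← Real.rpow_add hX0]; congr 1; ring
  have e9 : R ^ γ * R ^ (-(2 * γ)) = R ^ (-γ) := by rw [← Real.rpow_add hR0]; congr 1; ring
  calc _ ≤ X ^ (-γ) * (3 * R ^ γ) * (2 * α ^ γ) * R ^ (-(1 - γ)) *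
          (α ^ (-(2 * γ)) * (2 * R ^ (-(2 * γ)))) := by
        gcongr
        exact e3.trans (by gcongr)
    _ = 12 * X ^ (-γ) * (α ^ γ * α ^ (-(2 * γ))) * (R ^ γ * R ^ (-(2 * γ))) * R ^ (-(1 - γ)) := by
        ring
    _ ≤ 12 * X ^ (-γ) * X ^ (-γ) * X ^ (-γ) * R ^ (-(1 - γ)) := by
        rw [e7, e9]; gcongr
    _ = 12 * ((X ^ (-γ) * X ^ (-γ) * X ^ (-γ)) * R ^ (-(1 - γ))) := by ring
    _ ≤ _ := by rw [e8]; gcongr; norm_num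

/-- Both P and Q are at most 2α, and the gain in α cancels their powers exactly, leaving
X^{-γ}R^{-(1-γ)}β^{-2γ}. If β ≤ X/2, then X ≲ R and an integrable function of β results; if not,
β^{-2γ} is traded for X^{-2γ}. -/
theorem low_kernel_far (h1 : 1 / 4 ≤ γ) (h2 : γ < 1 / 2) (hX : 1 ≤ X) (hP : 1 ≤ P) (hQ : 1 ≤ Q)
    (hR : 1 ≤ R) (hα : 0 < α) (hβ : 0 < β) (hPX : P ≤ X + α) (hQR : Q ≤ R + α) (hXR : X ≤ R + β)
    {b' : ℝ} (hb : 1 ≤ b') (hb' : b' ≤ 1 + β) (c1 : 2 * R < α) (c2 : 2 * X < α) :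
    X ^ (-γ) * Q ^ γ * P ^ γ * R ^ (-(1 - γ)) * (1 + α * β) ^ (-(2 * γ)) ≤
      1000 * (X ^ (-(3 * γ)) * R ^ (-(1 - γ))) ∨
    X ^ (-γ) * Q ^ γ * P ^ γ * R ^ (-(1 - γ)) * (1 + α * β) ^ (-(2 * γ)) ≤
      1000 * (β ^ (-1 + (1 - 2 * γ)) * b' ^ (-(1 : ℝ))) := by
  have hX0 : 0 < X := by linarith
  have hR0 : 0 < R := by linarith
  have hP0 : 0 < P := by linarith
  have hQ0 : 0 < Q := by linarith
  have hb0 : 0 < b' := by linarith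
  have e1 : P ^ γ ≤ 2 * α ^ γ :=
    rpow_le_mul_rpow hP0.le hα.le (by norm_num) (by linarith) (by linarith) (by linarith)
  have e2 : Q ^ γ ≤ 2 * α ^ γ :=
    rpow_le_mul_rpow hQ0.le hα.le (by norm_num) (by linarith) (by linarith) (by linarith)
  have e3 := modulation_weight_le hα hβ (p := 2 * γ) (by linarith)
  have e7 : α ^ γ * α ^ γ * α ^ (-(2 * γ)) = 1 := by
    rw [← Real.rpow_add hα, ← Real.rpow_add hα]; ring_nf; simp
  have main : X ^ (-γ) * Q ^ γ * P ^ γ * R ^ (-(1 - γ)) * (1 + α * β) ^ (-(2 * γ)) ≤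
      4 * X ^ (-γ) * R ^ (-(1 - γ)) * β ^ (-(2 * γ)) := by
    calc _ ≤ X ^ (-γ) * (2 * α ^ γ) * (2 * α ^ γ) * R ^ (-(1 - γ)) *
          (α ^ (-(2 * γ)) * β ^ (-(2 * γ))) := by gcongr
      _ = 4 * X ^ (-γ) * R ^ (-(1 - γ)) * β ^ (-(2 * γ)) * (α ^ γ * α ^ γ * α ^ (-(2 * γ))) := by ring
      _ = _ := by rw [e7, mul_one]
  rcases le_total β (X / 2) with h | h
  · right
    have e4 : R ^ (-(1 - γ)) ≤ 2 * X ^ (-(1 - γ)) :=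
      rpow_neg_le_mul_rpow_neg hR0 hX0 (by norm_num) (by linarith) (by linarith) (by linarith)
    have e5 : X ^ (-(1 : ℝ)) ≤ 2 * b' ^ (-(1 : ℝ)) :=
      rpow_neg_le_mul_rpow_neg hX0 hb0 (by norm_num) (by linarith) (by linarith) (by linarith)
    have e6 : X ^ (-γ) * X ^ (-(1 - γ)) = X ^ (-(1 : ℝ)) := by
      rw [← Real.rpow_add hX0]; congr 1; ring
    have e8 : -1 + (1 - 2 * γ) = -(2 * γ) := by ring
    rw [e8]
    calc _ ≤ _ := main
      _ ≤ 4 * X ^ (-γ) * (2 * X ^ (-(1 - γ))) * β ^ (-(2 * γ)) := by gcongr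
      _ = 8 * (β ^ (-(2 * γ)) * (X ^ (-γ) * X ^ (-(1 - γ)))) := by ring
      _ ≤ 8 * (β ^ (-(2 * γ)) * (2 * b' ^ (-(1 : ℝ)))) := by rw [e6]; gcongr
      _ = 16 * (β ^ (-(2 * γ)) * b' ^ (-(1 : ℝ))) := by ring
      _ ≤ _ := by gcongr; norm_num
  · left
    have e4 : β ^ (-(2 * γ)) ≤ 2 * X ^ (-(2 * γ)) :=
      rpow_neg_le_mul_rpow_neg hβ hX0 (by norm_num) (by linarith) (by linarith) (by linarith)
    have e6 : X ^ (-γ) * X ^ (-(2 * γ)) = X ^ (-(3 * γ)) := by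
      rw [← Real.rpow_add hX0]; congr 1; ring
    calc _ ≤ _ := main
      _ ≤ 4 * X ^ (-γ) * R ^ (-(1 - γ)) * (2 * X ^ (-(2 * γ))) := by gcongr
      _ = 8 * ((X ^ (-γ) * X ^ (-(2 * γ))) * R ^ (-(1 - γ))) := by ring
      _ ≤ _ := by rw [e6]; gcongr; norm_num

theorem low_kernel_le (h1 : 1 / 4 ≤ γ) (h2 : γ < 1 / 2) (hX : 1 ≤ X) (hP : 1 ≤ P) (hQ : 1 ≤ Q)
    (hR : 1 ≤ R) (hα : 0 < α) (hβ : 0 < β) (hPX : P ≤ X + α) (hQR : Q ≤ R + α) (hXR : X ≤ R + β)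
    (hRX : R ≤ X + β) {a' b' : ℝ} (ha : 1 ≤ a') (hb : 1 ≤ b') (ha' : a' ≤ 1 + α)
    (hb' : b' ≤ 1 + β) :
    X ^ (-γ) * Q ^ γ * P ^ γ * R ^ (-(1 - γ)) * (1 + α * β) ^ (-(2 * γ)) ≤
      1000 * lowMajorant γ X R α β a' b' := by
  have hX0 : 0 < X := by linarith
  have hR0 : 0 < R := by linarith
  have ha0 : 0 < a' := by linarith
  have hb0 : 0 < b' := by linarith
  have p1 : 0 ≤ (α ^ ((-1 + (1 / 2 - γ)) / 2) * a' ^ (-(1 / 2 - γ))) *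
      (β ^ ((-1 + (1 / 2 - γ)) / 2) * b' ^ (-(1 / 2 - γ))) := by positivity
  have p2 : 0 ≤ (α ^ ((-1 + (1 / 2 - γ)) / 2) * a' ^ (-(1 / 2 - γ))) *
      R ^ (-((1 + (1 / 2 - γ)) / 2)) := by positivity
  have p3 : 0 ≤ a' ^ (-(3 * γ)) * R ^ (-(1 - γ)) := by positivity
  have p4 : 0 ≤ X ^ (-(3 * γ)) * R ^ (-(1 - γ)) := by positivity
  have p5 : 0 ≤ β ^ (-1 + (1 - 2 * γ)) * b' ^ (-(1 : ℝ)) := by positivity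
  unfold lowMajorant
  by_cases c1 : α ≤ 4 * R ∧ α ≤ 4 * X
  · rcases low_kernel_near h1 h2 hX hP hQ hR hα hβ hPX hQR ha hb ha' hb' c1.1 c1.2 with h | h <;>
      linarith
  · by_cases c2 : 4 * R < α ∧ α ≤ 2 * X
    · linarith [low_kernel_middle h1 h2 hX hP hQ hR hα hβ hPX hQR hXR ha ha' c2.1 c2.2]
    · by_cases c3 : 4 * X < α ∧ α ≤ 2 * R
      · linarith [low_kernel_third h1 h2 hX hP hQ hR hα hβ hPX hQR hRX c3.1 c3.2]
      · have c4 : 2 * R < α ∧ 2 * X < α := by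
          by_contra hc
          rw [not_and_or] at c1 c2 c3 hc
          push Not at c1 c2 c3 hc
          grind
        rcases low_kernel_far h1 h2 hX hP hQ hR hα hβ hPX hQR hXR hb hb' c4.1 c4.2 with h | h <;>
          linarith

/-- The power Q^γ is absorbed by the largest of the other three brackets. Two factors with exponent
-(1 - γ) < -1/2 remain, each of them square integrable. -/
theorem base_kernel_le (h1 : 1 / 4 ≤ γ) (h2 : γ < 1 / 2) (hX : 1 ≤ X) (hP : 1 ≤ P) (hQ : 1 ≤ Q)
    (hR : 1 ≤ R) (h : Q ≤ X + P + R) :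
    X ^ (-γ) * Q ^ γ * P ^ (-(1 - γ)) * R ^ (-(1 - γ)) ≤
      3 * (P ^ (-(1 - γ)) * R ^ (-(1 - γ)) + X ^ (-(1 - γ)) * R ^ (-(1 - γ)) +
        X ^ (-(1 - γ)) * P ^ (-(1 - γ))) := by
  have hX0 : 0 < X := by linarith
  have hR0 : 0 < R := by linarith
  have hP0 : 0 < P := by linarith
  have hQ0 : 0 < Q := by linarith
  have p1 : 0 ≤ P ^ (-(1 - γ)) * R ^ (-(1 - γ)) := by positivity
  have p2 : 0 ≤ X ^ (-(1 - γ)) * R ^ (-(1 - γ)) := by positivity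
  have p3 : 0 ≤ X ^ (-(1 - γ)) * P ^ (-(1 - γ)) := by positivity
  -- The total exponent is -(1 - γ), and since 2γ - 1 ≤ 0 the smaller of X and Z can carry all of
  -- it.
  have key : ∀ Z : ℝ, 1 ≤ Z → X ^ (-γ) * Z ^ γ * Z ^ (-(1 - γ)) ≤
      X ^ (-(1 - γ)) + Z ^ (-(1 - γ)) := by
    intro Z hZ
    have hZ0 : 0 < Z := by linarith
    rcases le_total X Z with hXZ | hXZ
    · have : Z ^ γ * Z ^ (-(1 - γ)) ≤ X ^ γ * X ^ (-(1 - γ)) := by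
        rw [← Real.rpow_add hZ0, ← Real.rpow_add hX0]
        exact Real.rpow_le_rpow_of_nonpos hX0 hXZ (by linarith)
      calc _ = X ^ (-γ) * (Z ^ γ * Z ^ (-(1 - γ))) := by ring
        _ ≤ X ^ (-γ) * (X ^ γ * X ^ (-(1 - γ))) := by gcongr
        _ = X ^ (-(1 - γ)) := by rw [← mul_assoc, ← Real.rpow_add hX0]; simp
        _ ≤ _ := le_add_of_nonneg_right (by positivity)
    · have : X ^ (-γ) ≤ Z ^ (-γ) := Real.rpow_le_rpow_of_nonpos hZ0 hXZ (by linarith)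
      calc _ ≤ Z ^ (-γ) * Z ^ γ * Z ^ (-(1 - γ)) := by gcongr
        _ = Z ^ (-(1 - γ)) := by rw [← Real.rpow_add hZ0]; simp
        _ ≤ _ := le_add_of_nonneg_left (by positivity)
  have hmax : Q ≤ 3 * X ∨ Q ≤ 3 * P ∨ Q ≤ 3 * R := by
    by_contra hc; push Not at hc; linarith [hc.1, hc.2.1, hc.2.2]
  rcases hmax with hm | hm | hm
  · have e : Q ^ γ ≤ 3 * X ^ γ :=
      rpow_le_mul_rpow hQ0.le hX0.le (by norm_num) hm (by linarith) (by linarith)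
    calc _ ≤ X ^ (-γ) * (3 * X ^ γ) * P ^ (-(1 - γ)) * R ^ (-(1 - γ)) := by gcongr
      _ = 3 * (P ^ (-(1 - γ)) * R ^ (-(1 - γ))) * (X ^ (-γ) * X ^ γ) := by ring
      _ = 3 * (P ^ (-(1 - γ)) * R ^ (-(1 - γ))) := by rw [← Real.rpow_add hX0]; simp
      _ ≤ _ := by linarith
  · have e : Q ^ γ ≤ 3 * P ^ γ :=
      rpow_le_mul_rpow hQ0.le hP0.le (by norm_num) hm (by linarith) (by linarith)
    calc _ ≤ X ^ (-γ) * (3 * P ^ γ) * P ^ (-(1 - γ)) * R ^ (-(1 - γ)) := by gcongr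
      _ = 3 * (X ^ (-γ) * P ^ γ * P ^ (-(1 - γ))) * R ^ (-(1 - γ)) := by ring
      _ ≤ 3 * (X ^ (-(1 - γ)) + P ^ (-(1 - γ))) * R ^ (-(1 - γ)) := by gcongr; exact key P hP
      _ ≤ _ := by linarith
  · have e : Q ^ γ ≤ 3 * R ^ γ :=
      rpow_le_mul_rpow hQ0.le hR0.le (by norm_num) hm (by linarith) (by linarith)
    calc _ ≤ X ^ (-γ) * (3 * R ^ γ) * P ^ (-(1 - γ)) * R ^ (-(1 - γ)) := by gcongr
      _ = 3 * (X ^ (-γ) * R ^ γ * R ^ (-(1 - γ))) * P ^ (-(1 - γ)) := by ring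
      _ ≤ 3 * (X ^ (-(1 - γ)) + R ^ (-(1 - γ))) * P ^ (-(1 - γ)) := by gcongr; exact key R hR
      _ ≤ _ := by linarith

/-- A loss of one derivative at the second child is compensated by the modulation or is moved to
one of its siblings. -/
theorem middle_kernel_le (h1 : 1 / 4 ≤ γ) (h2 : γ < 1 / 2) (hX : 1 ≤ X) (hP : 1 ≤ P) (hQ : 1 ≤ Q)
    (hR : 1 ≤ R) (hα : 0 < α) (hβ : 0 < β) (hQP : Q ≤ P + β) (hQR : Q ≤ R + α) :
    X ^ (-γ) * Q ^ γ * P ^ (-(1 - γ)) * R ^ (-(1 - γ)) * (1 + α * β) ^ (-(2 * γ)) * Q ≤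
      4 * (X ^ (-γ) * Q ^ γ * P ^ (-(1 - γ)) * R ^ (-(1 - γ)) +
        X ^ (-γ) * Q ^ γ * P ^ (-(1 - γ)) * R ^ (-(1 - γ)) * (1 + α * β) ^ (-(2 * γ)) * P +
        X ^ (-γ) * Q ^ γ * P ^ (-(1 - γ)) * R ^ (-(1 - γ)) * (1 + α * β) ^ (-(2 * γ)) * R) := by
  have hX0 : 0 < X := by linarith
  have hR0 : 0 < R := by linarith
  have hP0 : 0 < P := by linarith
  have hQ0 : 0 < Q := by linarith
  set B := X ^ (-γ) * Q ^ γ * P ^ (-(1 - γ)) * R ^ (-(1 - γ)) with hB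
  have hB0 : 0 ≤ B := by positivity
  set W := (1 + α * β) ^ (-(2 * γ)) with hW
  have hW0 : 0 ≤ W := by positivity
  have hBW := mul_nonneg hB0 hW0
  have hBWP := mul_nonneg hBW hP0.le
  have hBWR := mul_nonneg hBW hR0.le
  by_cases c1 : Q ≤ 2 * P
  · have := mul_le_mul_of_nonneg_left c1 hBW
    nlinarith
  by_cases c2 : Q ≤ 2 * R
  · have := mul_le_mul_of_nonneg_left c2 hBW
    nlinarith
  push Not at c1 c2
  -- Both differences exceed Q/2, so the gain is of size Q^{-4γ}. It pays for the whole derivative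
  -- because γ ≥ 1/4; this is the reason for the cap θ ≤ 1/2.
  have e : W * Q ≤ 4 := by
    have a1 : α ^ (-(2 * γ)) ≤ 2 * Q ^ (-(2 * γ)) :=
      rpow_neg_le_mul_rpow_neg hα hQ0 (by norm_num) (by linarith) (by linarith) (by linarith)
    have a2 : β ^ (-(2 * γ)) ≤ 2 * Q ^ (-(2 * γ)) :=
      rpow_neg_le_mul_rpow_neg hβ hQ0 (by norm_num) (by linarith) (by linarith) (by linarith)
    calc W * Q ≤ (α ^ (-(2 * γ)) * β ^ (-(2 * γ))) * Q := by
          gcongr; exact modulation_weight_le hα hβ (by linarith)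
      _ ≤ ((2 * Q ^ (-(2 * γ))) * (2 * Q ^ (-(2 * γ)))) * Q := by gcongr
      _ = 4 * (Q ^ (-(2 * γ)) * Q ^ (-(2 * γ)) * Q ^ (1 : ℝ)) := by rw [Real.rpow_one]; ring
      _ = 4 * Q ^ (-(2 * γ) + -(2 * γ) + 1) := by rw [Real.rpow_add hQ0, Real.rpow_add hQ0]
      _ ≤ 4 * 1 := by
          gcongr
          exact Real.rpow_le_one_of_one_le_of_nonpos hQ (by linarith)
      _ = 4 := by norm_num
  have := mul_le_mul_of_nonneg_left e hB0
  nlinarith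

end pointwise
/-! ### Trilinear estimates -/

/-- The weighted kernel of the product with a derivative on the second factor, as an operator from
`H^{1-γ} × H^{1-γ} × H^{1-γ}` to `H^{-γ}`. -/
noncomputable def baseKernel (γ x a b : ℝ) : ℝ :=
  br x ^ (-γ) * br b ^ γ * br a ^ (-(1 - γ)) * br (x - a + b) ^ (-(1 - γ))

/-- The gain `⟨μ⟩^{-2γ}` from the modulation. -/
noncomputable def gain (γ x a b : ℝ) : ℝ := (1 + |x - a| * |a - b|) ^ (-(2 * γ))

theorem baseKernel_nonneg (γ x a b : ℝ) : 0 ≤ baseKernel γ x a b := by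
  have := br_pos x; have := br_pos a; have := br_pos b; have := br_pos (x - a + b)
  unfold baseKernel; positivity

theorem gain_nonneg (γ x a b : ℝ) : 0 ≤ gain γ x a b := by unfold gain; positivity

theorem measurable_baseKernel (γ : ℝ) :
    Measurable fun p : ℝ × ℝ × ℝ => baseKernel γ p.1 p.2.1 p.2.2 := by
  unfold baseKernel; fun_prop

theorem measurable_gain (γ : ℝ) : Measurable fun p : ℝ × ℝ × ℝ => gain γ p.1 p.2.1 p.2.2 := by
  unfold gain
  simp only [← Real.norm_eq_abs]
  fun_prop

theorem triBddReal_br_outer_third {p q : ℝ} (hp : 1 / 2 < p) (hq : 1 / 2 < q) :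
    TriBddReal fun x a b => br x ^ (-p) * br (x - a + b) ^ (-q) :=
  TriBddReal.of_outer_third (u := fun x => br x ^ (-p)) (w := fun x => br x ^ (-q))
    (by fun_prop) (by fun_prop) (fun x => Real.rpow_nonneg (br_pos x).le _)
    (lintegral_ofReal_sq_br hp) (lintegral_ofReal_sq_br hq)

theorem triBddReal_base {γ : ℝ} (h1 : 1 / 4 ≤ γ) (h2 : γ < 1 / 2) : TriBddReal (baseKernel γ) := by
  have hg : 1 / 2 < 1 - γ := by linarith
  have hb : ∀ x p : ℝ, 0 ≤ br x ^ p := fun x p => Real.rpow_nonneg (br_pos x).le _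
  have t1 : TriBddReal fun x a b => br a ^ (-(1 - γ)) * br (x - a + b) ^ (-(1 - γ)) :=
    TriBddReal.of_first_third (u := fun x => br x ^ (-(1 - γ))) (w := fun x => br x ^ (-(1 - γ)))
      (by fun_prop) (by fun_prop) (fun x => hb x _) (lintegral_ofReal_sq_br hg)
      (lintegral_ofReal_sq_br hg)
  have t2 := triBddReal_br_outer_third hg hg
  have t3 : TriBddReal fun x a b => br x ^ (-(1 - γ)) * br a ^ (-(1 - γ)) := by
    have := t2.swap (by fun_prop)
    have e : ∀ x a b : ℝ, x - (x - a + b) + b = a := fun x a b => by ring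
    simpa only [e] using this
  have ht := (t1.add t2 (by fun_prop) (fun x a b => mul_nonneg (hb _ _) (hb _ _))
    (fun x a b => mul_nonneg (hb _ _) (hb _ _))).add t3 (by fun_prop)
    (fun x a b => add_nonneg (mul_nonneg (hb _ _) (hb _ _)) (mul_nonneg (hb _ _) (hb _ _)))
    (fun x a b => mul_nonneg (hb _ _) (hb _ _))
  refine ht.mono 3 (by norm_num) fun x a b _ _ => ?_
  refine base_kernel_le h1 h2 (one_le_br x) (one_le_br a) (one_le_br b) (one_le_br _) ?_
  have e1 := br_le_add b (x - a + b)
  have e2 : b - (x - a + b) = a - x := by ring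
  rw [e2] at e1
  linarith [abs_sub a x, abs_le_br a, abs_le_br x]

/-- The extra bracket of a means that the first child has one derivative less. `t1` to `t5` are the
terms of `lowMajorant`: the first three are square integrable in (a, b), `t4` needs the decay in the
outer variable, and `t5` is of convolution type. -/
theorem triBddReal_first {γ : ℝ} (h1 : 1 / 4 ≤ γ) (h2 : γ < 1 / 2) :
    TriBddReal fun x a b => baseKernel γ x a b * gain γ x a b * br a := by
  have hb : ∀ x p : ℝ, 0 ≤ br x ^ p := fun x p => Real.rpow_nonneg (br_pos x).le _
  have ha : ∀ x p : ℝ, 0 ≤ |x| ^ p := fun x p => Real.rpow_nonneg (abs_nonneg x) _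
  set δ := 1 / 2 - γ with hδ
  let h : ℝ → ℝ := fun y => |y| ^ ((-1 + δ) / 2) * br y ^ (-δ)
  have h0 : ∀ y, 0 ≤ h y := fun y => mul_nonneg (ha _ _) (hb _ _)
  have hm : Measurable h := by
    simp only [h, ← Real.norm_eq_abs]; fun_prop
  have hL2 : sqNorm (fun y => ENNReal.ofReal (h y)) ≠ ∞ :=
    lintegral_ofReal_sq_sing (by linarith) (by linarith)
  have t1 : TriBddReal fun x a b => h (x - a) * h (a - b) := .of_diffs hm hm h0 hL2 hL2
  have t2 : TriBddReal fun x a b => h (x - a) * br (x - a + b) ^ (-((1 + δ) / 2)) :=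
    .of_first_diff_third (w := fun y => br y ^ (-((1 + δ) / 2))) hm (by fun_prop) h0 hL2
      (lintegral_ofReal_sq_br (by linarith))
  have t3 : TriBddReal fun x a b => br (x - a) ^ (-(3 * γ)) * br (x - a + b) ^ (-(1 - γ)) :=
    .of_first_diff_third (u := fun y => br y ^ (-(3 * γ))) (w := fun y => br y ^ (-(1 - γ)))
      (by fun_prop) (by fun_prop) (fun x => hb x _) (lintegral_ofReal_sq_br (by linarith))
      (lintegral_ofReal_sq_br (by linarith))
  have t4 := triBddReal_br_outer_third (p := 3 * γ) (q := 1 - γ) (by linarith) (by linarith)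
  have t5 : TriBddReal fun _ a b => |a - b| ^ (-1 + (1 - 2 * γ)) * br (a - b) ^ (-(1 : ℝ)) :=
    TriBdd.of_conv (κ := fun y => ENNReal.ofReal (|y| ^ (-1 + (1 - 2 * γ)) * br y ^ (-(1 : ℝ))))
      (by simp only [← Real.norm_eq_abs]; fun_prop)
      (lintegral_abs_rpow_mul_br_rpow_lt_top (by linarith) (by linarith) (by linarith)).ne
  have ht := (((t1.add t2 (by fun_prop) (fun x a b => mul_nonneg (h0 _) (h0 _))
    (fun x a b => mul_nonneg (h0 _) (hb _ _))).add t3 (by fun_prop)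
    (fun x a b => add_nonneg (mul_nonneg (h0 _) (h0 _)) (mul_nonneg (h0 _) (hb _ _)))
    (fun x a b => mul_nonneg (hb _ _) (hb _ _))).add t4 (by fun_prop)
    (fun x a b => add_nonneg (add_nonneg (mul_nonneg (h0 _) (h0 _)) (mul_nonneg (h0 _) (hb _ _)))
      (mul_nonneg (hb _ _) (hb _ _))) (fun x a b => mul_nonneg (hb _ _) (hb _ _))).add t5
    (by fun_prop)
    (fun x a b => add_nonneg (add_nonneg (add_nonneg (mul_nonneg (h0 _) (h0 _))
      (mul_nonneg (h0 _) (hb _ _))) (mul_nonneg (hb _ _) (hb _ _))) (mul_nonneg (hb _ _) (hb _ _)))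
    (fun x a b => mul_nonneg (ha _ _) (hb _ _))
  refine ht.mono 1000 (by norm_num) fun x a b hax hab => ?_
  have hα : 0 < |x - a| := abs_pos.2 (sub_ne_zero.2 hax.symm)
  have hβ : 0 < |a - b| := abs_pos.2 (sub_ne_zero.2 hab)
  have e1 := br_le_add a x
  have e2 := br_le_add b (x - a + b)
  have e3 := br_le_add x (x - a + b)
  have e4 := br_le_add (x - a + b) x
  rw [show b - (x - a + b) = a - x by ring, abs_sub_comm] at e2
  rw [abs_sub_comm] at e1
  rw [show x - (x - a + b) = a - b by ring] at e3
  rw [show x - a + b - x = -(a - b) by ring, abs_neg] at e4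
  have key := low_kernel_le h1 h2 (one_le_br x) (one_le_br a) (one_le_br b) (one_le_br (x - a + b))
    hα hβ e1 e2 e3 e4 (one_le_br (x - a)) (one_le_br (a - b))
    (br_le_one_add_abs _) (br_le_one_add_abs _)
  refine le_trans (le_of_eq ?_) key
  have e : br a ^ γ = br a ^ (-(1 - γ)) * br a := by
    nth_rewrite 3 [← Real.rpow_one (br a)]
    rw [← Real.rpow_add (br_pos a)]; congr 1; ring
  rw [e, baseKernel, gain]
  ring

/-- Exchanging a and c = x - a + b swaps |x - a| and |a - b|, so the kernel and the gain are
symmetric in the first and third child. -/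
theorem triBddReal_third {γ : ℝ} (h1 : 1 / 4 ≤ γ) (h2 : γ < 1 / 2) :
    TriBddReal fun x a b => baseKernel γ x a b * gain γ x a b * br (x - a + b) := by
  have hb := measurable_baseKernel γ
  have hg := measurable_gain γ
  refine ((triBddReal_first h1 h2).swap (by fun_prop)).mono 1 zero_le_one fun x a b _ _ => ?_
  rw [one_mul]
  refine le_of_eq ?_
  have e1 : a - b + b = a := by ring
  have e2 : x - (x - a + b) = a - b := by ring
  have e3 : x - a + b - b = x - a := by ring
  simp only [baseKernel, gain, e2, e1, e3]
  rw [mul_comm |a - b|]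
  ring

theorem triBddReal_second {γ : ℝ} (h1 : 1 / 4 ≤ γ) (h2 : γ < 1 / 2) :
    TriBddReal fun x a b => baseKernel γ x a b * gain γ x a b * br b := by
  have hb := measurable_baseKernel γ
  have hg := measurable_gain γ
  have hbg := fun x a b => mul_nonneg (baseKernel_nonneg γ x a b) (gain_nonneg γ x a b)
  have ht := ((triBddReal_base h1 h2).add (triBddReal_first h1 h2) (by fun_prop)
    (baseKernel_nonneg γ) (fun x a b => mul_nonneg (hbg x a b) (br_pos _).le)).add
    (triBddReal_third h1 h2) (by fun_prop)
    (fun x a b => add_nonneg (baseKernel_nonneg γ x a b) (mul_nonneg (hbg x a b) (br_pos _).le))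
    (fun x a b => mul_nonneg (hbg x a b) (br_pos _).le)
  refine ht.mono 4 (by norm_num) fun x a b hax hab => ?_
  have hα : 0 < |x - a| := abs_pos.2 (sub_ne_zero.2 hax.symm)
  have hβ : 0 < |a - b| := abs_pos.2 (sub_ne_zero.2 hab)
  have e2 := br_le_add b (x - a + b)
  have e1 := br_le_add b a
  rw [show b - (x - a + b) = a - x by ring, abs_sub_comm] at e2
  rw [abs_sub_comm] at e1
  exact middle_kernel_le h1 h2 (one_le_br x) (one_le_br a) (one_le_br b) (one_le_br (x - a + b))
    hα hβ e1 e2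

/-- Since ⟨x⟩ ≤ ⟨a⟩ + ⟨b⟩ + ⟨c⟩, an extra derivative on the output falls on one of the inputs. -/
theorem triBddReal_outer {γ : ℝ} (h1 : 1 / 4 ≤ γ) (h2 : γ < 1 / 2) :
    TriBddReal fun x a b => baseKernel γ x a b * gain γ x a b * br x := by
  have hb := measurable_baseKernel γ
  have hg := measurable_gain γ
  have hbg := fun x a b => mul_nonneg (baseKernel_nonneg γ x a b) (gain_nonneg γ x a b)
  have hn := fun x a b y => mul_nonneg (hbg x a b) (br_pos y).le
  have ht := ((triBddReal_first h1 h2).add (triBddReal_second h1 h2) (by fun_prop)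
    (fun x a b => hn x a b _) (fun x a b => hn x a b _)).add
    (triBddReal_third h1 h2) (by fun_prop)
    (fun x a b => add_nonneg (hn x a b _) (hn x a b _))
    (fun x a b => hn x a b _)
  refine ht.mono 1 zero_le_one fun x a b hax hab => ?_
  rw [one_mul, ← mul_add, ← mul_add]
  gcongr
  · exact hbg x a b
  · have := br_le_add x (x - a + b)
    rw [show x - (x - a + b) = a - b by ring] at this
    linarith [abs_sub a b, abs_le_br a, abs_le_br b]

/-! ### Estimates in weighted spaces -/

/-- The weight `⟨x⟩^σ`. -/
noncomputable def wt (σ x : ℝ) : ℝ≥0∞ := ENNReal.ofReal (br x ^ σ)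

@[fun_prop] theorem measurable_wt (σ : ℝ) : Measurable (wt σ) := by unfold wt; fun_prop

theorem wt_mul_wt_neg (σ x : ℝ) : wt σ x * wt (-σ) x = 1 := by
  have := br_pos x
  rw [wt, wt, ← ENNReal.ofReal_mul (by positivity), ← Real.rpow_add this]
  simp

/-- The squared weighted norm. -/
noncomputable def nrm (σ : ℝ) (f : ℝ → ℝ≥0∞) : ℝ≥0∞ := sqNorm fun x => wt σ x * f x

/-- Conjugation with the weights turns a bound between weighted spaces into an unweighted L² bound.
-/
theorem TriBddReal.weighted {K : ℝ → ℝ → ℝ → ℝ} {σ σ₁ σ₂ σ₃ : ℝ}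
    (h : TriBddReal fun x a b =>
      br x ^ σ * K x a b * br a ^ (-σ₁) * br b ^ (-σ₂) * br (x - a + b) ^ (-σ₃)) :
    ∃ C : ℝ≥0∞, C ≠ ∞ ∧ ∀ f₁ f₂ f₃ : ℝ → ℝ≥0∞, Measurable f₁ → Measurable f₂ → Measurable f₃ →
      nrm σ (tri (fun x a b => ENNReal.ofReal (K x a b)) f₁ f₂ f₃) ≤
        C * (nrm σ₁ f₁ * nrm σ₂ f₂ * nrm σ₃ f₃) := by
  obtain ⟨C, hC, hb⟩ := h
  refine ⟨C, hC, fun f₁ f₂ f₃ h₁ h₂ h₃ => ?_⟩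
  refine le_trans (le_of_eq ?_) (hb (fun x => wt σ₁ x * f₁ x) (fun x => wt σ₂ x * f₂ x)
    (fun x => wt σ₃ x * f₃ x) (by fun_prop) (by fun_prop) (by fun_prop))
  unfold nrm
  congr 1
  funext x
  have hx : wt σ x ≠ ∞ := ENNReal.ofReal_ne_top
  unfold tri
  rw [← lintegral_const_mul' _ _ hx]
  refine lintegral_congr fun η => ?_
  have p1 := br_pos x
  have p2 := br_pos η.1
  have p3 := br_pos η.2
  have p4 := br_pos (x - η.1 + η.2)
  dsimp only
  rw [ENNReal.ofReal_mul' (by positivity), ENNReal.ofReal_mul' (by positivity),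
    ENNReal.ofReal_mul' (by positivity), ENNReal.ofReal_mul (by positivity)]
  have w1 := wt_mul_wt_neg σ₁ η.1
  have w2 := wt_mul_wt_neg σ₂ η.2
  have w3 := wt_mul_wt_neg σ₃ (x - η.1 + η.2)
  simp only [wt] at w1 w2 w3 ⊢
  rw [show ∀ A B C D E A' B' C' F₁ F₂ F₃ : ℝ≥0∞, A * B * C * D * E * (A' * F₁ * (B' * F₂) * (C' * F₃))
    = (A' * C) * (B' * D) * (C' * E) * (A * (B * (F₁ * F₂ * F₃))) from fun _ _ _ _ _ _ _ _ _ _ _ => by ring,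
    w1, w2, w3]
  ring

/-- The kernel of one generation after the modulation is bounded from below. -/
noncomputable def genKernel (s x a b : ℝ) : ℝ :=
  |b| * (1 + |x - a| * |a - b|) ^ (-(1 - theta s))

/-- Higher regularity is reduced to s₀: the bracket of x is at most the sum of the three brackets of
the children, hence at most 3 times their product, and the power s - s₀ of this distributes over the
children. -/
theorem weight_transfer {s s₀ : ℝ} (h : s₀ ≤ s) (x a b : ℝ) :
    br x ^ (s - 1) * |b| * br a ^ (-s) * br b ^ (-s) * br (x - a + b) ^ (-s) ≤
      3 ^ (s - s₀) * baseKernel (1 - s₀) x a b := by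
  have hx := br_pos x
  have ha := br_pos a
  have hb := br_pos b
  have hc := br_pos (x - a + b)
  have e1 : br x ^ (s - s₀) ≤ (3 * (br a * br b * br (x - a + b))) ^ (s - s₀) := by
    refine Real.rpow_le_rpow hx.le ?_ (by linarith)
    have h1 := br_le_add x (x - a + b)
    rw [show x - (x - a + b) = a - b by ring] at h1
    have h2 : br x ≤ br a + br b + br (x - a + b) := by
      linarith [abs_sub a b, abs_le_br a, abs_le_br b]
    have ha' := one_le_br a
    have hb' := one_le_br b
    have hc' := one_le_br (x - a + b)
    have k1 : br a ≤ br a * br b * br (x - a + b) := by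
      rw [mul_assoc]; exact le_mul_of_one_le_right ha.le (one_le_mul_of_one_le_of_one_le hb' hc')
    have k2 : br b ≤ br a * br b * br (x - a + b) := by
      rw [mul_comm (br a), mul_assoc]
      exact le_mul_of_one_le_right hb.le (one_le_mul_of_one_le_of_one_le ha' hc')
    have k3 : br (x - a + b) ≤ br a * br b * br (x - a + b) :=
      le_mul_of_one_le_left hc.le (one_le_mul_of_one_le_of_one_le ha' hb')
    linarith
  rw [Real.mul_rpow (by norm_num) (by positivity), Real.mul_rpow (by positivity) hc.le,
    Real.mul_rpow ha.le hb.le] at e1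
  calc br x ^ (s - 1) * |b| * br a ^ (-s) * br b ^ (-s) * br (x - a + b) ^ (-s)
      = (br x ^ (-(1 - s₀)) * br x ^ (s - s₀)) * |b| * br a ^ (-s) * br b ^ (-s) *
          br (x - a + b) ^ (-s) := by
        rw [← Real.rpow_add hx]; congr 5; ring
    _ ≤ (br x ^ (-(1 - s₀)) * (3 ^ (s - s₀) * (br a ^ (s - s₀) * br b ^ (s - s₀) *
          br (x - a + b) ^ (s - s₀)))) * br b * br a ^ (-s) * br b ^ (-s) *
          br (x - a + b) ^ (-s) := by
        gcongr; exact abs_le_br b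
    _ = 3 ^ (s - s₀) * (br x ^ (-(1 - s₀)) * (br b ^ (s - s₀) * br b ^ (1 : ℝ) * br b ^ (-s)) *
          (br a ^ (s - s₀) * br a ^ (-s)) *
          (br (x - a + b) ^ (s - s₀) * br (x - a + b) ^ (-s))) := by rw [Real.rpow_one]; ring
    _ = _ := by
        rw [← Real.rpow_add hb, ← Real.rpow_add hb, ← Real.rpow_add ha, ← Real.rpow_add hc,
          baseKernel]
        ring_nf

/-- The trilinear estimates for one generation. -/
structure GenerationBound (s : ℝ) (C : ℝ≥0∞) : Prop where
  high : ∀ f₁ f₂ f₃ : ℝ → ℝ≥0∞, Measurable f₁ → Measurable f₂ → Measurable f₃ →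
    nrm s (tri (fun x a b => ENNReal.ofReal (genKernel s x a b)) f₁ f₂ f₃) ≤
      C * (nrm s f₁ * nrm s f₂ * nrm s f₃)
  first : ∀ f₁ f₂ f₃ : ℝ → ℝ≥0∞, Measurable f₁ → Measurable f₂ → Measurable f₃ →
    nrm (s - 1) (tri (fun x a b => ENNReal.ofReal (genKernel s x a b)) f₁ f₂ f₃) ≤
      C * (nrm (s - 1) f₁ * nrm s f₂ * nrm s f₃)
  second : ∀ f₁ f₂ f₃ : ℝ → ℝ≥0∞, Measurable f₁ → Measurable f₂ → Measurable f₃ →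
    nrm (s - 1) (tri (fun x a b => ENNReal.ofReal (genKernel s x a b)) f₁ f₂ f₃) ≤
      C * (nrm s f₁ * nrm (s - 1) f₂ * nrm s f₃)
  third : ∀ f₁ f₂ f₃ : ℝ → ℝ≥0∞, Measurable f₁ → Measurable f₂ → Measurable f₃ →
    nrm (s - 1) (tri (fun x a b => ENNReal.ofReal (genKernel s x a b)) f₁ f₂ f₃) ≤
      C * (nrm s f₁ * nrm s f₂ * nrm (s - 1) f₃)
  last : ∀ f₁ f₂ f₃ : ℝ → ℝ≥0∞, Measurable f₁ → Measurable f₂ → Measurable f₃ →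
    nrm (s - 1) (tri (fun _ _ b => ENNReal.ofReal |b|) f₁ f₂ f₃) ≤
      C * (nrm s f₁ * nrm s f₂ * nrm s f₃)

/-- With γ = 1 - min s (3/4) this says 1 - θ = 2γ, which identifies the weight in `genKernel` with
`gain γ`. -/
theorem theta_eq (s : ℝ) : theta s = 1 - 2 * (1 - min s (3 / 4)) := by
  unfold theta
  rcases le_total s (3 / 4) with h | h
  · rw [min_eq_left (by linarith), min_eq_left h]; ring
  · rw [min_eq_right (by linarith), min_eq_right h]; norm_num

theorem exists_generationBound {s : ℝ} (hs : 1 / 2 < s) :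
    ∃ C : ℝ≥0∞, C ≠ ∞ ∧ GenerationBound s C := by
  set s₀ := min s (3 / 4) with hs₀
  have hle : s₀ ≤ s := min_le_left _ _
  set γ := 1 - s₀ with hγ
  have h1 : 1 / 4 ≤ γ := by have := min_le_right s (3 / 4); linarith
  have h2 : γ < 1 / 2 := by have := lt_min hs (by norm_num : (1 : ℝ) / 2 < 3 / 4); linarith
  have hθ : ∀ x a b, genKernel s x a b = |b| * gain γ x a b := by
    intro x a b
    rw [genKernel, gain, theta_eq]; congr 2; ring
  have hstep : ∀ y : ℝ, br y ^ (-(s - 1)) = br y ^ (-s) * br y := by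
    intro y
    nth_rewrite 3 [← Real.rpow_one (br y)]
    rw [← Real.rpow_add (br_pos y)]; congr 1; ring
  have htr := weight_transfer hle
  have h3 : (0 : ℝ) ≤ 3 ^ (s - s₀) := by positivity
  have kh : TriBddReal fun x a b =>
      br x ^ s * genKernel s x a b * br a ^ (-s) * br b ^ (-s) * br (x - a + b) ^ (-s) := by
    refine (triBddReal_outer h1 h2).mono _ h3 fun x a b _ _ => ?_
    have := mul_le_mul_of_nonneg_right (htr x a b)
      (mul_nonneg (gain_nonneg γ x a b) (br_pos x).le)
    refine le_trans (le_of_eq ?_) (this.trans (le_of_eq (by ring)))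
    have e : br x ^ s = br x ^ (s - 1) * br x := by
      nth_rewrite 3 [← Real.rpow_one (br x)]
      rw [← Real.rpow_add (br_pos x)]; congr 1; ring
    rw [hθ, e]; ring
  have kf : TriBddReal fun x a b =>
      br x ^ (s - 1) * genKernel s x a b * br a ^ (-(s - 1)) * br b ^ (-s) *
        br (x - a + b) ^ (-s) := by
    refine (triBddReal_first h1 h2).mono _ h3 fun x a b _ _ => ?_
    have := mul_le_mul_of_nonneg_right (htr x a b)
      (mul_nonneg (gain_nonneg γ x a b) (br_pos a).le)
    refine le_trans (le_of_eq ?_) (this.trans (le_of_eq (by ring)))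
    rw [hθ, hstep]; ring
  have ks : TriBddReal fun x a b =>
      br x ^ (s - 1) * genKernel s x a b * br a ^ (-s) * br b ^ (-(s - 1)) *
        br (x - a + b) ^ (-s) := by
    refine (triBddReal_second h1 h2).mono _ h3 fun x a b _ _ => ?_
    have := mul_le_mul_of_nonneg_right (htr x a b)
      (mul_nonneg (gain_nonneg γ x a b) (br_pos b).le)
    refine le_trans (le_of_eq ?_) (this.trans (le_of_eq (by ring)))
    rw [hθ, hstep]; ring
  have kt : TriBddReal fun x a b =>
      br x ^ (s - 1) * genKernel s x a b * br a ^ (-s) * br b ^ (-s) *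
        br (x - a + b) ^ (-(s - 1)) := by
    refine (triBddReal_third h1 h2).mono _ h3 fun x a b _ _ => ?_
    have := mul_le_mul_of_nonneg_right (htr x a b)
      (mul_nonneg (gain_nonneg γ x a b) (br_pos (x - a + b)).le)
    refine le_trans (le_of_eq ?_) (this.trans (le_of_eq (by ring)))
    rw [hθ, hstep]; ring
  have kl : TriBddReal fun x a b =>
      br x ^ (s - 1) * |b| * br a ^ (-s) * br b ^ (-s) * br (x - a + b) ^ (-s) :=
    (triBddReal_base h1 h2).mono _ h3 fun x a b _ _ => htr x a b
  obtain ⟨C₁, hC₁, b₁⟩ := TriBddReal.weighted kh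
  obtain ⟨C₂, hC₂, b₂⟩ := TriBddReal.weighted kf
  obtain ⟨C₃, hC₃, b₃⟩ := TriBddReal.weighted ks
  obtain ⟨C₄, hC₄, b₄⟩ := TriBddReal.weighted kt
  obtain ⟨C₅, hC₅, b₅⟩ := TriBddReal.weighted (K := fun _ _ b => |b|) kl
  refine ⟨C₁ + C₂ + C₃ + C₄ + C₅, by finiteness, ⟨?_, ?_, ?_, ?_, ?_⟩⟩
  · intro f₁ f₂ f₃ m₁ m₂ m₃
    exact (b₁ f₁ f₂ f₃ m₁ m₂ m₃).trans (mul_le_mul_left (by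
      simp only [add_assoc]; exact le_self_add) _)
  · intro f₁ f₂ f₃ m₁ m₂ m₃
    exact (b₂ f₁ f₂ f₃ m₁ m₂ m₃).trans (mul_le_mul_left (by
      simp only [add_assoc]; exact le_add_left le_self_add) _)
  · intro f₁ f₂ f₃ m₁ m₂ m₃
    exact (b₃ f₁ f₂ f₃ m₁ m₂ m₃).trans (mul_le_mul_left (by
      simp only [add_assoc]; exact le_add_left (le_add_left le_self_add)) _)
  · intro f₁ f₂ f₃ m₁ m₂ m₃
    exact (b₄ f₁ f₂ f₃ m₁ m₂ m₃).trans (mul_le_mul_left (by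
      simp only [add_assoc]; exact le_add_left (le_add_left (le_add_left le_self_add))) _)
  · intro f₁ f₂ f₃ m₁ m₂ m₃
    exact (b₅ f₁ f₂ f₃ m₁ m₂ m₃).trans (mul_le_mul_left le_add_self _)

/-! ### Removing the last generation of an ordered tree -/

theorem mem_nodes {P : Finset Node} {a : Node} :
    a ∈ nodes P ↔ a = [] ∨ ∃ b ∈ P, ∃ k : Fin 3, k :: b = a := by
  simp [nodes]

theorem cons_mem_nodes {P : Finset Node} {a : Node} {k : Fin 3} : k :: a ∈ nodes P ↔ a ∈ P := by
  simp [nodes]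

theorem nodes_mono {P Q : Finset Node} (h : P ⊆ Q) : nodes P ⊆ nodes Q := by
  intro a
  rw [mem_nodes, mem_nodes]
  rintro (h1 | ⟨b, hb, k, rfl⟩)
  · exact Or.inl h1
  · exact Or.inr ⟨b, h hb, k, rfl⟩

/-- The three children of a node. -/
def children (a : Node) : Finset Node := Finset.univ.image fun k : Fin 3 => k :: a

theorem mem_children {a b : Node} : b ∈ children a ↔ ∃ k : Fin 3, k :: a = b := by
  simp [children]

theorem cons_injective (a : Node) : Function.Injective fun k : Fin 3 => k :: a :=
  fun _ _ h => (List.cons.inj h).1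

theorem card_children (a : Node) : (children a).card = 3 := by
  rw [children, Finset.card_image_of_injective _ (cons_injective a)]; simp

theorem prod_children {M : Type*} [CommMonoid M] (a : Node) (f : Node → M) :
    ∏ b ∈ children a, f b = f (0 :: a) * f (1 :: a) * f (2 :: a) := by
  rw [children, Finset.prod_image (cons_injective a).injOn, Fin.prod_univ_three]

namespace OrderedTree

variable {J : ℕ}

/-- The tree before its last generation. -/
def init (T : OrderedTree (J + 1)) : OrderedTree J where
  r j := T.r j.castSucc
  grows j := by
    have h := T.grows j.castSucc
    convert h using 2
    ext a
    simp only [Finset.mem_image, Finset.mem_filter, Finset.mem_univ, true_and]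
    constructor
    · rintro ⟨i, hi, rfl⟩
      exact ⟨i.castSucc, Fin.castSucc_lt_castSucc_iff.2 hi, rfl⟩
    · rintro ⟨i, hi, rfl⟩
      have hlt : (i : ℕ) < J := lt_trans hi j.2
      refine ⟨⟨i, hlt⟩, hi, ?_⟩
      congr 1

/-- The root node of the last generation. -/
def last (T : OrderedTree (J + 1)) : Node := T.r (Fin.last J)

theorem parents_eq_insert (T : OrderedTree (J + 1)) : T.parents = insert T.last T.init.parents := by
  ext a
  simp only [parents, Finset.mem_image, Finset.mem_univ, true_and, Finset.mem_insert]
  rw [Fin.exists_fin_succ', or_comm, eq_comm]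
  rfl

theorem last_mem_leaves (T : OrderedTree (J + 1)) : T.last ∈ T.init.leaves := by
  have h := T.grows (Fin.last J)
  unfold leaves parents last
  convert h using 2
  ext a
  simp only [Finset.mem_image, Finset.mem_filter, Finset.mem_univ, true_and]
  constructor
  · rintro ⟨i, rfl⟩
    exact ⟨i.castSucc, Fin.castSucc_lt_last i, rfl⟩
  · rintro ⟨i, hi, rfl⟩
    exact ⟨⟨i, hi⟩, by simp only [init]; congr 1⟩

theorem parents_subset_nodes (T : OrderedTree J) : T.parents ⊆ nodes T.parents := by
  intro a ha
  obtain ⟨j, -, rfl⟩ := Finset.mem_image.1 ha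
  exact nodes_mono (Finset.image_subset_image (Finset.filter_subset _ _))
    (Finset.mem_sdiff.1 (T.grows j)).1

theorem mem_leaves {T : OrderedTree J} {a : Node} :
    a ∈ T.leaves ↔ a ∈ nodes T.parents ∧ a ∉ T.parents := Finset.mem_sdiff

theorem last_notMem_parents (T : OrderedTree (J + 1)) : T.last ∉ T.init.parents :=
  (mem_leaves.1 T.last_mem_leaves).2

theorem children_last_disjoint (T : OrderedTree (J + 1)) :
    Disjoint T.init.leaves (children T.last) := by
  rw [Finset.disjoint_right]
  intro a ha hl
  obtain ⟨k, rfl⟩ := mem_children.1 ha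
  exact T.last_notMem_parents (cons_mem_nodes.1 (mem_leaves.1 hl).1)

theorem leaves_eq_union (T : OrderedTree (J + 1)) :
    T.leaves = T.init.leaves.erase T.last ∪ children T.last := by
  have hp := T.parents_eq_insert
  have hl := T.last_notMem_parents
  have hs := T.init.parents_subset_nodes
  ext a
  rw [Finset.mem_union, Finset.mem_erase, mem_leaves, mem_leaves, mem_children, mem_nodes,
    mem_nodes, hp]
  simp only [Finset.mem_insert, not_or]
  constructor
  · rintro ⟨h | ⟨b, rfl | hb, k, rfl⟩, h2, h3⟩
    · exact Or.inl ⟨h2, Or.inl h, h3⟩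
    · exact Or.inr ⟨k, rfl⟩
    · exact Or.inl ⟨h2, Or.inr ⟨b, hb, k, rfl⟩, h3⟩
  · rintro (⟨h1, h | ⟨b, hb, k, rfl⟩, h3⟩ | ⟨k, rfl⟩)
    · exact ⟨Or.inl h, h1, h3⟩
    · exact ⟨Or.inr ⟨b, Or.inr hb, k, rfl⟩, h1, h3⟩
    · refine ⟨Or.inr ⟨_, Or.inl rfl, k, rfl⟩, ?_, fun h => hl (cons_mem_nodes.1 (hs h))⟩
      intro h
      have := congrArg List.length h
      simp at this

theorem prod_leaves {M : Type*} [CommMonoid M] (T : OrderedTree (J + 1)) (f : Node → M) :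
    ∏ a ∈ T.leaves, f a = (∏ a ∈ T.init.leaves.erase T.last, f a) *
      (f (0 :: T.last) * f (1 :: T.last) * f (2 :: T.last)) := by
  rw [leaves_eq_union, Finset.prod_union, prod_children]
  exact T.children_last_disjoint.mono_left (Finset.erase_subset _ _)

theorem leaves_zero (T : OrderedTree 0) : T.leaves = {[]} := by
  simp [leaves, parents, terminal, nodes]

theorem card_leaves : ∀ {J : ℕ} (T : OrderedTree J), T.leaves.card = 2 * J + 1
  | 0, T => by rw [leaves_zero]; rfl
  | J + 1, T => by
    rw [leaves_eq_union, Finset.card_union_of_disjoint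
      (T.children_last_disjoint.mono_left (Finset.erase_subset _ _)), card_children,
      Finset.card_erase_of_mem T.last_mem_leaves, card_leaves T.init]
    omega

instance : Subsingleton (OrderedTree 0) :=
  ⟨fun S T => by ext1; funext j; exact j.elim0⟩

/-- A tree is determined by its predecessor and the leaf that was grown, and a tree of generation J
has 2J + 1 leaves. -/
theorem card_le : ∀ J : ℕ, Fintype.card (OrderedTree J) ≤ ∏ i ∈ Finset.range J, (2 * i + 1)
  | 0 => by simpa using Fintype.card_le_one_iff_subsingleton.2 inferInstance
  | J + 1 => by
    let F : OrderedTree (J + 1) → Σ T : OrderedTree J, T.leaves :=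
      fun T => ⟨T.init, T.last, T.last_mem_leaves⟩
    have hF : Function.Injective F := by
      intro S T h
      have h1 : S.init = T.init := congrArg Sigma.fst h
      have h2 : S.last = T.last := by
        have : ∀ p q : (Σ T : OrderedTree J, T.leaves), p = q → (p.2 : Node) = q.2 := by
          rintro p q rfl; rfl
        exact this _ _ h
      ext1
      funext j
      refine Fin.lastCases h2 (fun i => ?_) j
      exact congrFun (congrArg OrderedTree.r h1) i
    refine (Fintype.card_le_of_injective F hF).trans ?_
    rw [Fintype.card_sigma, Finset.prod_range_succ]
    simp only [Fintype.card_coe, card_leaves, Finset.sum_const, Finset.card_univ, smul_eq_mul]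
    exact Nat.mul_le_mul_right _ (card_le J)

/-! ### Frequencies as linear forms in the integration variables -/

theorem freq_cons (T : OrderedTree J) (ξ : ℝ) (η : Fin J → ℝ × ℝ) (j : Fin J) (k : Fin 3) :
    T.freq ξ η (k :: T.r j) =
      ![(η j).1, (η j).2, T.freq ξ η (T.r j) - (η j).1 + (η j).2] k := by
  simp [freq, T.r_injective.eq_iff]

/-- The last pair of variables affects only the three newest leaves, because the node grown last is
not parental in the earlier tree. This makes it possible to integrate that pair out first. -/
theorem freq_init (T : OrderedTree (J + 1)) (ξ : ℝ) (η : Fin (J + 1) → ℝ × ℝ) (a : Node)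
    (ha : a ∈ nodes T.init.parents) :
    T.freq ξ η a = T.init.freq ξ (fun j => η j.castSucc) a := by
  induction a with
  | nil => simp [freq]
  | cons k a ih =>
    have hap := cons_mem_nodes.1 ha
    have hl : T.r (Fin.last J) ≠ a := fun h => T.last_notMem_parents (by rw [last, h]; exact hap)
    simp only [freq]
    rw [Fin.sum_univ_castSucc, if_neg hl, add_zero, ih (T.init.parents_subset_nodes hap)]
    rfl

theorem measurable_freq (T : OrderedTree J) (a : Node) :
    Measurable fun p : ℝ × (Fin J → ℝ × ℝ) => T.freq p.1 p.2 a := by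
  induction a with
  | nil => simpa [freq] using measurable_fst
  | cons k a ih =>
    simp only [freq]
    refine Finset.measurable_sum _ fun j _ => ?_
    split_ifs
    · fin_cases k <;> simp <;> fun_prop
    · exact measurable_const

theorem freq_add (T : OrderedTree J) (p q : ℝ × (Fin J → ℝ × ℝ)) (a : Node) :
    T.freq (p + q).1 (p + q).2 a = T.freq p.1 p.2 a + T.freq q.1 q.2 a := by
  induction a with
  | nil => simp [freq]
  | cons k a ih =>
    simp only [freq]
    rw [← Finset.sum_add_distrib, ih]
    refine Finset.sum_congr rfl fun j _ => ?_
    split_ifs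
    · fin_cases k <;> simp; ring
    · simp

theorem freq_smul (T : OrderedTree J) (c : ℝ) (p : ℝ × (Fin J → ℝ × ℝ)) (a : Node) :
    T.freq (c • p).1 (c • p).2 a = c * T.freq p.1 p.2 a := by
  induction a with
  | nil => simp [freq]
  | cons k a ih =>
    simp only [freq]
    rw [Finset.mul_sum, ih]
    refine Finset.sum_congr rfl fun j _ => ?_
    split_ifs
    · fin_cases k <;> simp; ring
    · simp

/-- Since 1 - 1 + 1 = 1, the constant family is an index function; it witnesses that the frequency
of a node is a nonzero linear form. -/
theorem freq_one (T : OrderedTree J) (a : Node) (ha : a ∈ nodes T.parents) :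
    T.freq 1 (fun _ => (1, 1)) a = 1 := by
  induction a with
  | nil => simp [freq]
  | cons k a ih =>
    have hap := cons_mem_nodes.1 ha
    obtain ⟨j, -, rfl⟩ := Finset.mem_image.1 hap
    rw [freq_cons, ih (T.parents_subset_nodes hap)]
    fin_cases k <;> simp

/-- The frequency of a node, as a linear form in all frequencies. -/
noncomputable def freqLinear (T : OrderedTree J) (a : Node) : ℝ × (Fin J → ℝ × ℝ) →ₗ[ℝ] ℝ where
  toFun p := T.freq p.1 p.2 a
  map_add' p q := T.freq_add p q a
  map_smul' c p := T.freq_smul c p a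

/-- A surjective linear form pulls null sets back to null sets. This is needed because v̂, defined
only almost everywhere, is evaluated at the leaf frequencies. -/
theorem quasiMeasurePreserving_freq (T : OrderedTree J) (a : Node) (ha : a ∈ nodes T.parents) :
    Measure.QuasiMeasurePreserving (fun p : ℝ × (Fin J → ℝ × ℝ) => T.freq p.1 p.2 a) := by
  refine ⟨T.measurable_freq a, ?_⟩
  have hsurj : Function.Surjective (T.freqLinear a) := by
    intro y
    refine ⟨y • (1, fun _ => (1, 1)), ?_⟩
    rw [map_smul]
    change y * T.freq 1 (fun _ => (1, 1)) a = y
    rw [T.freq_one a ha, mul_one]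
  have h2 : (volume : Measure (ℝ × ℝ)).IsAddHaarMeasure := by
    rw [Measure.volume_eq_prod]; infer_instance
  have hpi : (volume : Measure (Fin J → ℝ × ℝ)).IsAddHaarMeasure := by
    rw [volume_pi]; infer_instance
  have hprod : (volume : Measure (ℝ × (Fin J → ℝ × ℝ))).IsAddHaarMeasure := by
    rw [Measure.volume_eq_prod]; exact Measure.prod.instIsAddHaarMeasure _ _
  obtain ⟨c, -, hc⟩ := (T.freqLinear a).exists_map_addHaar_eq_smul_addHaar
    (volume : Measure (ℝ × (Fin J → ℝ × ℝ))) (volume : Measure ℝ) hsurj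
  change Measure.map (T.freqLinear a) volume ≪ volume
  rw [hc]
  exact Measure.smul_absolutelyContinuous

/-! ### Tree integrals -/

/-- The integral over the frequencies of the tree of a product of kernels, one for each generation,
and of functions at the leaves. -/
noncomputable def treeIntegral (k : ℝ → ℝ → ℝ → ℝ≥0∞) (T : OrderedTree J)
    (W : Node → ℝ → ℝ≥0∞) (ξ : ℝ) : ℝ≥0∞ :=
  ∫⁻ η : Fin J → ℝ × ℝ, (∏ j, k (T.freq ξ η (T.r j)) (η j).1 (η j).2) *
    ∏ a ∈ T.leaves, W a (T.freq ξ η a)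

/-- The leaf functions after the integration over the last generation. -/
noncomputable def collapse (k : ℝ → ℝ → ℝ → ℝ≥0∞) (T : OrderedTree (J + 1))
    (W : Node → ℝ → ℝ≥0∞) : Node → ℝ → ℝ≥0∞ :=
  Function.update W T.last (tri k (W (0 :: T.last)) (W (1 :: T.last)) (W (2 :: T.last)))

theorem collapse_last (k : ℝ → ℝ → ℝ → ℝ≥0∞) (T : OrderedTree (J + 1)) (W : Node → ℝ → ℝ≥0∞) :
    collapse k T W T.last = tri k (W (0 :: T.last)) (W (1 :: T.last)) (W (2 :: T.last)) :=
  Function.update_self _ _ _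

theorem collapse_of_ne (k : ℝ → ℝ → ℝ → ℝ≥0∞) (T : OrderedTree (J + 1)) (W : Node → ℝ → ℝ≥0∞)
    {a : Node} (ha : a ≠ T.last) : collapse k T W a = W a :=
  Function.update_of_ne ha _ _

theorem measurable_collapse {k : ℝ → ℝ → ℝ → ℝ≥0∞}
    (hk : Measurable fun p : ℝ × ℝ × ℝ => k p.1 p.2.1 p.2.2) (T : OrderedTree (J + 1))
    {W : Node → ℝ → ℝ≥0∞} (hW : ∀ a, Measurable (W a)) (a : Node) :
    Measurable (collapse k T W a) := by
  by_cases ha : a = T.last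
  · rw [ha, collapse_last]
    exact measurable_tri hk (hW _) (hW _) (hW _)
  · rw [collapse_of_ne k T W ha]
    exact hW a

/-- Tonelli in the last pair of variables. A separate kernel `k'` is allowed there because the last
generation of the remainder has no denominator. -/
theorem lintegral_last_generation {k k' : ℝ → ℝ → ℝ → ℝ≥0∞}
    (hk : Measurable fun p : ℝ × ℝ × ℝ => k p.1 p.2.1 p.2.2)
    (hk' : Measurable fun p : ℝ × ℝ × ℝ => k' p.1 p.2.1 p.2.2) (T : OrderedTree (J + 1))
    {W : Node → ℝ → ℝ≥0∞} (hW : ∀ a, Measurable (W a)) (ξ : ℝ) :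
    ∫⁻ η : Fin (J + 1) → ℝ × ℝ,
      (∏ j : Fin J, k (T.freq ξ η (T.r j.castSucc)) (η j.castSucc).1 (η j.castSucc).2) *
        k' (T.freq ξ η T.last) (η (Fin.last J)).1 (η (Fin.last J)).2 *
        ∏ a ∈ T.leaves, W a (T.freq ξ η a) =
      treeIntegral k T.init (collapse k' T W) ξ := by
  have hfreq : ∀ a, Measurable fun η : Fin (J + 1) → ℝ × ℝ => T.freq ξ η a :=
    fun a => (T.measurable_freq a).comp measurable_prodMk_left
  have mp := (volume_preserving_piFinSuccAbove (fun _ : Fin (J + 1) => ℝ × ℝ) (Fin.last J)).symm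
  have hmeas : Measurable fun η : Fin (J + 1) → ℝ × ℝ =>
      (∏ j : Fin J, k (T.freq ξ η (T.r j.castSucc)) (η j.castSucc).1 (η j.castSucc).2) *
        k' (T.freq ξ η T.last) (η (Fin.last J)).1 (η (Fin.last J)).2 *
        ∏ a ∈ T.leaves, W a (T.freq ξ η a) := by
    refine (Measurable.mul ?_ ?_).mul ?_
    · refine Finset.measurable_fun_prod _ fun j _ => ?_
      exact hk.comp ((hfreq _).prodMk (by fun_prop))
    · exact hk'.comp ((hfreq _).prodMk (by fun_prop))
    · exact Finset.measurable_fun_prod _ fun a _ => (hW a).comp (hfreq a)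
  refine (mp.lintegral_comp hmeas).symm.trans
    ((lintegral_prod_symm' _ (hmeas.comp mp.measurable)).trans ?_)
  unfold treeIntegral
  refine lintegral_congr fun η => ?_
  have hsnoc : ∀ y : ℝ × ℝ, (MeasurableEquiv.piFinSuccAbove (fun _ : Fin (J + 1) => ℝ × ℝ)
      (Fin.last J)).symm (y, η) = (Fin.snoc η y : Fin (J + 1) → ℝ × ℝ) := by
    intro y
    exact Fin.insertNth_last' y η
  have hnode : ∀ (y : ℝ × ℝ) (a : Node), a ∈ nodes T.init.parents →
      T.freq ξ (Fin.snoc η y : Fin (J + 1) → ℝ × ℝ) a = T.init.freq ξ η a := by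
    intro y a ha
    rw [freq_init T ξ _ a ha]
    simp only [Fin.snoc_castSucc]
  have hlast := (mem_leaves.1 T.last_mem_leaves).1
  rw [← Finset.mul_prod_erase _ _ T.last_mem_leaves, collapse_last]
  have hprod : ∏ a ∈ T.init.leaves.erase T.last, collapse k' T W a (T.init.freq ξ η a) =
      ∏ a ∈ T.init.leaves.erase T.last, W a (T.init.freq ξ η a) :=
    Finset.prod_congr rfl fun a ha => by rw [collapse_of_ne k' T W (Finset.ne_of_mem_erase ha)]
  rw [hprod, tri, mul_left_comm, mul_comm, ← lintegral_const_mul]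
  · refine lintegral_congr fun y => ?_
    simp only [Function.comp_apply]
    rw [hsnoc, prod_leaves]
    have h0 : ∀ i : Fin 3, T.freq ξ (Fin.snoc η y : Fin (J + 1) → ℝ × ℝ) (i :: T.last) =
        ![y.1, y.2, T.init.freq ξ η T.last - y.1 + y.2] i := by
      intro i
      rw [last, freq_cons]
      simp only [Fin.snoc_last]
      rw [← last, hnode y _ hlast]
    rw [h0, h0, h0, hnode y _ hlast]
    have h1 : ∏ a ∈ T.init.leaves.erase T.last,
        W a (T.freq ξ (Fin.snoc η y : Fin (J + 1) → ℝ × ℝ) a) =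
        ∏ a ∈ T.init.leaves.erase T.last, W a (T.init.freq ξ η a) :=
      Finset.prod_congr rfl fun a ha => by
        rw [hnode y a (mem_leaves.1 (Finset.mem_of_mem_erase ha)).1]
    have h2 : ∏ j : Fin J, k (T.freq ξ (Fin.snoc η y : Fin (J + 1) → ℝ × ℝ) (T.r j.castSucc))
        ((Fin.snoc η y : Fin (J + 1) → ℝ × ℝ) j.castSucc).1
        ((Fin.snoc η y : Fin (J + 1) → ℝ × ℝ) j.castSucc).2 =
        ∏ j : Fin J, k (T.init.freq ξ η (T.init.r j)) (η j).1 (η j).2 :=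
      Finset.prod_congr rfl fun j _ => by
        have : T.r j.castSucc ∈ nodes T.init.parents :=
          T.init.parents_subset_nodes (Finset.mem_image_of_mem T.init.r (Finset.mem_univ j))
        rw [hnode y _ this]
        simp only [Fin.snoc_castSucc]
        rfl
    rw [h1, h2]
    simp only [Fin.snoc_last, Matrix.cons_val_zero, Matrix.cons_val_one, Matrix.cons_val]
    ring
  · exact (measurable_tri_integrand hk' (hW _) (hW _) (hW _)).comp measurable_prodMk_left

theorem treeIntegral_succ {k : ℝ → ℝ → ℝ → ℝ≥0∞}
    (hk : Measurable fun p : ℝ × ℝ × ℝ => k p.1 p.2.1 p.2.2) (T : OrderedTree (J + 1))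
    {W : Node → ℝ → ℝ≥0∞} (hW : ∀ a, Measurable (W a)) (ξ : ℝ) :
    treeIntegral k T W ξ = treeIntegral k T.init (collapse k T W) ξ := by
  rw [← lintegral_last_generation hk hk T hW]
  unfold treeIntegral
  simp only [Fin.prod_univ_castSucc, last]

theorem measurable_genKernel (s : ℝ) :
    Measurable fun p : ℝ × ℝ × ℝ => ENNReal.ofReal (genKernel s p.1 p.2.1 p.2.2) := by
  unfold genKernel
  simp only [← Real.norm_eq_abs]
  fun_prop

/-- A tree integral with one leaf function of low regularity. -/
theorem nrm_treeIntegral_le {s : ℝ} {C : ℝ≥0∞} (hC : GenerationBound s C) :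
    ∀ {J : ℕ} (T : OrderedTree J) (W : Node → ℝ → ℝ≥0∞), (∀ a, Measurable (W a)) →
      ∀ a₀ ∈ T.leaves,
      nrm (s - 1) (treeIntegral (fun x a b => ENNReal.ofReal (genKernel s x a b)) T W) ≤
        C ^ J * ∏ a ∈ T.leaves, nrm (if a = a₀ then s - 1 else s) (W a)
  | 0, T, W, hW, a₀, h₀ => by
    rw [leaves_zero, Finset.mem_singleton] at h₀
    subst h₀
    rw [leaves_zero, Finset.prod_singleton, if_pos rfl, pow_zero, one_mul]
    refine le_of_eq ?_
    congr 1
    funext ξ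
    have hv : (volume : Measure (Fin 0 → ℝ × ℝ)) Set.univ = 1 := by
      rw [volume_pi, Measure.pi_of_empty]; simp
    simp [treeIntegral, leaves_zero, freq, lintegral_unique, hv]
  | J + 1, T, W, hW, a₀, h₀ => by
    obtain ⟨k, hkd⟩ : ∃ k : ℝ → ℝ → ℝ → ℝ≥0∞,
      k = fun x a b => ENNReal.ofReal (genKernel s x a b) := ⟨_, rfl⟩
    have hk : Measurable fun p : ℝ × ℝ × ℝ => k p.1 p.2.1 p.2.2 := by
      rw [hkd]; exact measurable_genKernel s
    rw [← hkd]
    have IH := nrm_treeIntegral_le hC T.init _ (measurable_collapse hk T hW)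
    have hC' := hC
    obtain ⟨hhigh, hfirst, hsecond, hthird, -⟩ := hC'
    rw [← hkd] at IH hhigh hfirst hsecond hthird
    have e1 : treeIntegral k T W = treeIntegral k T.init (collapse k T W) :=
      funext fun ξ => treeIntegral_succ hk T hW ξ
    have herase : ∀ b : Node, ∏ a ∈ T.init.leaves.erase T.last,
        nrm (if a = b then s - 1 else s) (collapse k T W a) =
        ∏ a ∈ T.init.leaves.erase T.last, nrm (if a = b then s - 1 else s) (W a) := fun b =>
      Finset.prod_congr rfl fun a ha => by rw [collapse_of_ne k T W (Finset.ne_of_mem_erase ha)]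
    have hdisj := Finset.disjoint_left.1 T.children_last_disjoint
    have ne : ∀ i j : Fin 3, i ≠ j → (i :: T.last : Node) ≠ j :: T.last :=
      fun i j hij h => hij (List.cons.inj h).1
    rw [e1, prod_leaves]
    rw [leaves_eq_union, Finset.mem_union] at h₀
    rcases h₀ with h₀ | h₀
    -- The low leaf is an old one: the last generation has three regular inputs and `high` keeps its
    -- output regular.
    · have hne := Finset.ne_of_mem_erase h₀
      have hmem := Finset.mem_of_mem_erase h₀
      have hch : ∀ i : Fin 3, (i :: T.last : Node) ≠ a₀ := fun i h =>
        hdisj hmem (mem_children.2 ⟨i, h⟩)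
      refine (IH a₀ hmem).trans ?_
      rw [← Finset.mul_prod_erase _ _ T.last_mem_leaves, herase, collapse_last,
        if_neg hne.symm, if_neg (hch 0), if_neg (hch 1), if_neg (hch 2)]
      calc _ ≤ C ^ J * ((C * (nrm s (W (0 :: T.last)) * nrm s (W (1 :: T.last)) *
            nrm s (W (2 :: T.last)))) * _) := by
            gcongr; exact hhigh _ _ _ (hW _) (hW _) (hW _)
        _ = _ := by ring
    -- The low leaf is one of the new children: the collapsed node becomes the low leaf of the
    -- smaller tree.
    · obtain ⟨i, rfl⟩ := mem_children.1 h₀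
      refine (IH T.last T.last_mem_leaves).trans ?_
      have he : ∏ a ∈ T.init.leaves.erase T.last, nrm (if a = i :: T.last then s - 1 else s) (W a) =
          ∏ a ∈ T.init.leaves.erase T.last, nrm (if a = T.last then s - 1 else s) (W a) :=
        Finset.prod_congr rfl fun a ha => by
          rw [if_neg (Finset.ne_of_mem_erase ha), if_neg]
          rintro rfl
          exact hdisj (Finset.mem_of_mem_erase ha) h₀
      rw [← Finset.mul_prod_erase _ _ T.last_mem_leaves, herase, collapse_last, he, if_pos rfl]
      have key : nrm (s - 1) (tri k (W (0 :: T.last)) (W (1 :: T.last)) (W (2 :: T.last))) ≤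
          C * (nrm (if (0 :: T.last : Node) = i :: T.last then s - 1 else s) (W (0 :: T.last)) *
            nrm (if (1 :: T.last : Node) = i :: T.last then s - 1 else s) (W (1 :: T.last)) *
            nrm (if (2 :: T.last : Node) = i :: T.last then s - 1 else s) (W (2 :: T.last))) := by
        fin_cases i
        · simpa using hfirst _ _ _ (hW _) (hW _) (hW _)
        · simpa using hsecond _ _ _ (hW _) (hW _) (hW _)
        · simpa using hthird _ _ _ (hW _) (hW _) (hW _)
      calc _ ≤ C ^ J * ((C * _) * _) := by gcongr
        _ = _ := by ring

/-- The tree integral of the remainder, in which the last generation has no gain from the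
modulation. -/
theorem nrm_remainder_tree_le {s : ℝ} {C : ℝ≥0∞} (hC : GenerationBound s C)
    (T : OrderedTree (J + 1)) {w : ℝ → ℝ≥0∞} (hw : Measurable w) :
    nrm (s - 1) (fun ξ => ∫⁻ η : Fin (J + 1) → ℝ × ℝ,
      (∏ j : Fin J, ENNReal.ofReal (genKernel s (T.freq ξ η (T.r j.castSucc)) (η j.castSucc).1
        (η j.castSucc).2)) * ENNReal.ofReal |(η (Fin.last J)).2| *
        ∏ a ∈ T.leaves, w (T.freq ξ η a)) ≤ C ^ (J + 1) * nrm s w ^ (2 * J + 3) := by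
  have hk' : Measurable fun p : ℝ × ℝ × ℝ => ENNReal.ofReal |p.2.2| := by
    simp only [← Real.norm_eq_abs]; fun_prop
  have hW : ∀ a : Node, Measurable ((fun _ => w) a) := fun _ => hw
  have hcol := measurable_collapse (k := fun _ _ b => ENNReal.ofReal |b|) hk' T hW
  have e := fun ξ => lintegral_last_generation (measurable_genKernel s)
    (k := fun x a b => ENNReal.ofReal (genKernel s x a b))
    (k' := fun _ _ b => ENNReal.ofReal |b|) hk' T hW ξ
  simp_rw [e]
  -- The node collapsed without smoothing is the one low leaf; the other 2J leaves of the smaller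
  -- tree still carry `w`.
  refine (nrm_treeIntegral_le hC T.init _ hcol T.last T.last_mem_leaves).trans ?_
  rw [← Finset.mul_prod_erase _ _ T.last_mem_leaves, collapse_last, if_pos rfl]
  have he : ∏ a ∈ T.init.leaves.erase T.last, nrm (if a = T.last then s - 1 else s)
      (collapse (fun _ _ b => ENNReal.ofReal |b|) T (fun _ => w) a) =
      nrm s w ^ (2 * J) := by
    rw [Finset.prod_congr rfl (g := fun _ => nrm s w), Finset.prod_const,
      Finset.card_erase_of_mem T.last_mem_leaves, card_leaves]
    · rfl
    · intro a ha
      rw [if_neg (Finset.ne_of_mem_erase ha), collapse_of_ne _ T _ (Finset.ne_of_mem_erase ha)]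
  rw [he]
  calc _ ≤ C ^ J * ((C * (nrm s w * nrm s w * nrm s w)) * nrm s w ^ (2 * J)) := by
        gcongr; exact hC.last _ _ _ hw hw hw
    _ = _ := by ring

end OrderedTree
/-! ### Distributions whose Fourier transform is a function -/

theorem map_mul_left_eq {r : ℝ} (hr : r ≠ 0) :
    Measure.map (r * ·) (volume : Measure ℝ) = ENNReal.ofReal |r⁻¹| • volume :=
  Real.map_volume_mul_left hr

theorem quasiMeasurePreserving_mul_left {r : ℝ} (hr : r ≠ 0) :
    Measure.QuasiMeasurePreserving (fun x : ℝ => r * x) := by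
  refine ⟨by fun_prop, ?_⟩
  rw [map_mul_left_eq hr]
  exact Measure.smul_absolutelyContinuous

theorem two_pi_ne_zero : (2 * Real.pi : ℝ) ≠ 0 := by positivity

/-- The Fourier transform, as a function, is locally integrable. -/
theorem HasFourier.locallyIntegrable {f : 𝓢'(ℝ, ℂ)} {g : ℝ → ℂ} (h : HasFourier f g) :
    LocallyIntegrable (fun η : ℝ => g (2 * Real.pi * η)) := by
  intro x
  let χ : ContDiffBump x := ⟨1, 2, one_pos, one_lt_two⟩
  have hs : HasCompactSupport (Complex.ofRealCLM ∘ χ) := χ.hasCompactSupport.comp_left rfl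
  have hd : ContDiff ℝ ((⊤ : ℕ∞) : WithTop ℕ∞) (Complex.ofRealCLM ∘ χ) :=
    Complex.ofRealCLM.contDiff.comp χ.contDiff
  have hi := (h.2 (hs.toSchwartzMap hd)).1
  refine ⟨Metric.closedBall x 1, Metric.closedBall_mem_nhds x one_pos, ?_⟩
  refine hi.integrableOn.congr_fun (fun η hη => ?_) measurableSet_closedBall
  have : χ η = 1 := χ.one_of_mem_closedBall hη
  simp [this]

/-- Testing against smooth compactly supported functions determines a locally integrable function.
Hence the infimum in `sobolevNorm` runs over a single value. -/
theorem HasFourier.ae_eq {f : 𝓢'(ℝ, ℂ)} {g g' : ℝ → ℂ} (h : HasFourier f g)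
    (h' : HasFourier f g') : g =ᵐ[volume] g' := by
  have h0 : ∀ᵐ η : ℝ, g (2 * Real.pi * η) - g' (2 * Real.pi * η) = 0 := by
    refine ae_eq_zero_of_integral_contDiff_smul_eq_zero
      (h.locallyIntegrable.sub h'.locallyIntegrable) fun χ hχ hc => ?_
    have hs : HasCompactSupport (Complex.ofRealCLM ∘ χ) := hc.comp_left rfl
    have hd : ContDiff ℝ ((⊤ : ℕ∞) : WithTop ℕ∞) (Complex.ofRealCLM ∘ χ) :=
      Complex.ofRealCLM.contDiff.comp hχ
    obtain ⟨i1, e1⟩ := h.2 (hs.toSchwartzMap hd)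
    obtain ⟨i2, e2⟩ := h'.2 (hs.toSchwartzMap hd)
    have := integral_sub i1 i2
    rw [← e1, ← e2, sub_self] at this
    rw [← this]
    refine integral_congr_ae (Eventually.of_forall fun η => ?_)
    simp [mul_sub]
  have h1 := (quasiMeasurePreserving_mul_left (inv_ne_zero two_pi_ne_zero)).ae h0
  filter_upwards [h1] with ξ hξ
  rw [← mul_assoc, mul_inv_cancel₀ two_pi_ne_zero, one_mul] at hξ
  exact sub_eq_zero.1 hξ

theorem eLpNorm_weight_eq (σ : ℝ) (g : ℝ → ℂ) :
    eLpNorm (fun ξ : ℝ => (((1 + ξ ^ 2) ^ (σ / 2) : ℝ) : ℂ) * g ξ) 2 volume =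
      nrm σ (fun ξ => ‖g ξ‖ₑ) ^ (1 / 2 : ℝ) := by
  rw [eLpNorm_eq_lintegral_rpow_enorm_toReal (by norm_num) (by norm_num)]
  simp only [ENNReal.toReal_ofNat, ENNReal.rpow_two]
  congr 1
  refine lintegral_congr fun ξ => ?_
  change _ = (wt σ ξ * ‖g ξ‖ₑ) ^ 2
  rw [enorm_mul, one_add_sq_rpow, wt]
  congr 2
  rw [← ofReal_norm, Complex.norm_real, Real.norm_of_nonneg
    (Real.rpow_nonneg (br_pos ξ).le _)]

theorem nrm_congr {σ : ℝ} {f g : ℝ → ℝ≥0∞} (h : f =ᵐ[volume] g) : nrm σ f = nrm σ g := by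
  refine lintegral_congr_ae ?_
  filter_upwards [h] with x hx
  simp only [hx]

theorem nrm_mono {σ : ℝ} {f g : ℝ → ℝ≥0∞} (h : ∀ᵐ x, f x ≤ g x) : nrm σ f ≤ nrm σ g := by
  refine lintegral_mono_ae ?_
  filter_upwards [h] with x hx
  gcongr

theorem sobolevNorm_eq {σ : ℝ} {f : 𝓢'(ℝ, ℂ)} {g : ℝ → ℂ} (h : HasFourier f g) :
    sobolevNorm σ f = ENNReal.ofReal ((2 * Real.pi) ^ (-(1 / 2) : ℝ)) *
      nrm σ (fun ξ => ‖g ξ‖ₑ) ^ (1 / 2 : ℝ) := by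
  unfold sobolevNorm
  simp_rw [eLpNorm_weight_eq]
  refine le_antisymm (iInf₂_le g h) (le_iInf₂ fun g' h' => le_of_eq ?_)
  congr 2
  refine nrm_congr ?_
  filter_upwards [h.ae_eq h'] with x hx
  rw [hx]

theorem hasFourier_hat {f : 𝓢'(ℝ, ℂ)} (h : ∃ g, HasFourier f g) : HasFourier f (hat f) := by
  unfold hat
  rw [dif_pos h]
  exact h.choose_spec

theorem hasFourier_invHat {g : ℝ → ℂ} (h : ∃ f, HasFourier f g) : HasFourier (invHat g) g := by
  unfold invHat
  rw [dif_pos h]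
  exact h.choose_spec

theorem exists_hasFourier_of_sobolevNorm_lt_top {σ : ℝ} {f : 𝓢'(ℝ, ℂ)}
    (h : sobolevNorm σ f < ⊤) : ∃ g, HasFourier f g := by
  by_contra hc
  push Not at hc
  refine h.ne ?_
  unfold sobolevNorm
  simp [hc]

theorem hasTemperateGrowth_weight (σ r : ℝ) :
    Function.HasTemperateGrowth fun η : ℝ => (((1 + (r * η) ^ 2) ^ σ : ℝ) : ℂ) := by
  have h1 := Function.hasTemperateGrowth_one_add_norm_sq_rpow ℝ σ
  have h2 : Function.HasTemperateGrowth fun η : ℝ => r * η :=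
    (Function.HasTemperateGrowth.const r).mul .id'
  have h3 := Function.Complex.hasTemperateGrowth_ofReal.comp (h1.comp h2)
  refine (congrArg Function.HasTemperateGrowth (funext fun η => ?_)).mp h3
  simp

/-- A function with finite weighted norm is the Fourier transform of a tempered distribution. -/
theorem exists_hasFourier {σ : ℝ} {g : ℝ → ℂ} (hg : AEStronglyMeasurable g volume)
    (h : nrm σ (fun ξ => ‖g ξ‖ₑ) ≠ ∞) : ∃ f, HasFourier f g := by
  set r := 2 * Real.pi with hr
  have hr0 : r ≠ 0 := two_pi_ne_zero
  have hm : Measurable fun ξ : ℝ => (((1 + ξ ^ 2) ^ (σ / 2) : ℝ) : ℂ) := by fun_prop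
  have hG : MemLp (fun ξ : ℝ => (((1 + ξ ^ 2) ^ (σ / 2) : ℝ) : ℂ) * g ξ) 2 volume := by
    refine ⟨hm.aestronglyMeasurable.mul hg, ?_⟩
    rw [eLpNorm_weight_eq]
    exact ENNReal.rpow_lt_top_of_nonneg (by norm_num) h
  have hu : MemLp (fun η : ℝ => (((1 + (r * η) ^ 2) ^ (σ / 2) : ℝ) : ℂ) * g (r * η)) 2 volume := by
    refine MemLp.comp_of_map (f := fun η : ℝ => r * η)
      (g := fun ξ : ℝ => (((1 + ξ ^ 2) ^ (σ / 2) : ℝ) : ℂ) * g ξ) ?_ (by fun_prop)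
    rw [map_mul_left_eq hr0]
    exact hG.smul_measure ENNReal.ofReal_ne_top
  -- The weighted function is in L², hence a tempered distribution. The inverse weight has temperate
  -- growth, so multiplication by it recovers `g` as a distribution.
  let m : ℝ → ℂ := fun η => (((1 + (r * η) ^ 2) ^ (-(σ / 2)) : ℝ) : ℂ)
  have hmg : m.HasTemperateGrowth := hasTemperateGrowth_weight _ _
  let U : 𝓢'(ℝ, ℂ) := TemperedDistribution.smulLeftCLM ℂ m (Lp.toTemperedDistribution hu.toLp)
  have hmul : ∀ (φ : 𝓢(ℝ, ℂ)) (η : ℝ), SchwartzMap.smulLeftCLM ℂ m φ η *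
      ((((1 + (r * η) ^ 2) ^ (σ / 2) : ℝ) : ℂ) * g (r * η)) = φ η * g (r * η) := by
    intro φ η
    rw [SchwartzMap.smulLeftCLM_apply_apply hmg, smul_eq_mul]
    have : m η * (((1 + (r * η) ^ 2) ^ (σ / 2) : ℝ) : ℂ) = 1 := by
      simp only [m]
      rw [← Complex.ofReal_mul, ← Real.rpow_add (by positivity)]
      simp
    linear_combination φ η * g (r * η) * this
  refine ⟨𝓕⁻ U, hg, fun φ => ⟨?_, ?_⟩⟩
  · have hi := ((SchwartzMap.smulLeftCLM ℂ m φ).memLp 2 volume).integrable_mul hu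
    exact hi.congr (Eventually.of_forall (hmul φ))
  · rw [FourierTransform.fourier_fourierInv_eq]
    simp only [U, TemperedDistribution.smulLeftCLM_apply_apply, Lp.toTemperedDistribution_apply]
    refine integral_congr_ae ?_
    filter_upwards [hu.coeFn_toLp] with η hη
    rw [hη, smul_eq_mul]
    exact hmul φ η

/-! ### Pointwise bound for the integrand -/

section pointwise

variable {J : ℕ} {κ : Convention} {T : OrderedTree J} {ξ : ℝ} {η : Fin J → ℝ × ℝ}

/-- The factorization of the resonance function; the sign from the convention disappears with the
absolute value. -/
theorem abs_modulation (j : Fin J) :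
    |modulation κ T ξ η j| =
      2 * (|T.freq ξ η (T.r j) - (η j).1| * |(η j).1 - (η j).2|) := by
  have hs : ∀ b : Bool, |(if b then -1 else 1 : ℝ)| = 1 := by intro b; cases b <;> simp
  rw [modulation, abs_mul, hs, one_mul, T.freq_cons, T.freq_cons, T.freq_cons]
  simp only [Matrix.cons_val_zero, Matrix.cons_val_one, Matrix.cons_val]
  refine (congrArg abs (show _ = 2 * ((T.freq ξ η (T.r j) - (η j).1) * ((η j).1 - (η j).2)) by
    ring)).trans ?_
  rw [abs_mul, abs_mul, abs_two]

theorem modulationSum_zero : modulationSum κ T ξ η 0 = 0 := by simp [modulationSum]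

theorem modulationSum_succ (j : Fin J) :
    modulationSum κ T ξ η ((j : ℕ) + 1) = modulationSum κ T ξ η j + modulation κ T ξ η j := by
  unfold modulationSum
  have : Finset.univ.filter (fun i : Fin J => (i : ℕ) < (j : ℕ) + 1) =
      insert j (Finset.univ.filter fun i : Fin J => (i : ℕ) < j) := by
    ext i
    simp only [Finset.mem_filter, Finset.mem_univ, true_and, Finset.mem_insert, Fin.ext_iff]
    omega
  rw [this, Finset.sum_insert (by simp), add_comm]

theorem bProd_succ (β : ℕ → ℝ) (n : ℕ) : bProd β (n + 1) = bProd β n * β n :=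
  Finset.prod_range_succ _ _

theorem one_le_bProd {β : ℕ → ℝ} (h0 : β 0 = 1) (h2 : ∀ j, 1 ≤ j → 2 ≤ β j) (n : ℕ) :
    1 ≤ bProd β n := by
  induction n with
  | zero => simp [bProd]
  | succ n ih =>
    rw [bProd_succ]
    refine one_le_mul_of_one_le_of_one_le ih ?_
    rcases n.eq_zero_or_pos with h | h
    · rw [h, h0]
    · linarith [h2 n h]

theorem bProd_mul_le_modulationSum {β : ℕ → ℝ} (h0 : β 0 = 1) (h2 : ∀ j, 1 ≤ j → 2 ≤ β j)
    {N : ℝ} {n : ℕ} (h : farFromResonance κ T ξ η β N n) :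
    ∀ j, j + 1 ≤ n → bProd β (j + 1) * N ≤ |modulationSum κ T ξ η (j + 1)|
  | 0, _ => by simpa [bProd, h0] using h.1.le
  | j + 1, hj => by
    have ih := bProd_mul_le_modulationSum h0 h2 h j (by omega)
    have h3 := h.2 (j + 1) (by omega) hj
    have h4 := h2 (j + 1) (by omega)
    rw [bProd_succ]
    calc bProd β (j + 1) * β (j + 1) * N = β (j + 1) * (bProd β (j + 1) * N) := by ring
      _ ≤ β (j + 1) * |modulationSum κ T ξ η (j + 1)| := by gcongr
      _ ≤ _ := h3.le

theorem two_mul_modulationSum_le {β : ℕ → ℝ} (h2 : ∀ j, 1 ≤ j → 2 ≤ β j)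
    {N : ℝ} {n : ℕ} (h : farFromResonance κ T ξ η β N n) {j : ℕ} (hj : j + 1 ≤ n) :
    2 * |modulationSum κ T ξ η j| ≤ |modulationSum κ T ξ η (j + 1)| := by
  rcases j.eq_zero_or_pos with rfl | hj0
  · rw [modulationSum_zero]; simp
  · refine le_trans ?_ (h.2 j hj0 hj).le
    gcongr
    exact h2 j hj0

theorem norm_generationFactor (t : ℝ) (j : Fin J) :
    ‖generationFactor κ T ξ η t j‖ = |(η j).2| := by
  rw [generationFactor, norm_mul, Complex.norm_exp, Complex.norm_real, T.freq_cons]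
  simp

theorem theta_pos {s : ℝ} (hs : 1 / 2 < s) : 0 < theta s :=
  lt_min (by linarith) (by norm_num)

theorem theta_le_half (s : ℝ) : theta s ≤ 1 / 2 := min_le_right _ _

/-- The denominator is split into the powers θ and 1 - θ: the first is bounded through the
thresholds, the second becomes the smoothing weight. -/
theorem norm_factor_le {s : ℝ} (hs : 1 / 2 < s) {β : ℕ → ℝ} (h0 : β 0 = 1)
    (h2 : ∀ j, 1 ≤ j → 2 ≤ β j) {N : ℝ} (hN : 1 < N) {n : ℕ}
    (h : farFromResonance κ T ξ η β N n) (t : ℝ) (j : Fin J) (hj : (j : ℕ) + 1 ≤ n) :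
    ‖generationFactor κ T ξ η t j / (modulationSum κ T ξ η ((j : ℕ) + 1) : ℂ)‖ ≤
      3 * (bProd β (j + 1) * N) ^ (-theta s) *
        genKernel s (T.freq ξ η (T.r j)) (η j).1 (η j).2 := by
  have hθ := theta_pos hs
  have hθ' := theta_le_half s
  have hb := one_le_bProd h0 h2 (j + 1)
  have hS := bProd_mul_le_modulationSum h0 h2 h j hj
  have hS2 := two_mul_modulationSum_le h2 h hj
  have hadd := modulationSum_succ (κ := κ) (T := T) (ξ := ξ) (η := η) j
  have hμ := abs_modulation (κ := κ) (T := T) (ξ := ξ) (η := η) j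
  have hbN : 1 ≤ bProd β (j + 1) * N := one_le_mul_of_one_le_of_one_le hb hN.le
  rw [norm_div, norm_generationFactor, Complex.norm_real, Real.norm_eq_abs, genKernel]
  set S := |modulationSum κ T ξ η ((j : ℕ) + 1)| with hSdef
  set m := |T.freq ξ η (T.r j) - (η j).1| * |(η j).1 - (η j).2| with hm
  have hm0 : 0 ≤ m := by positivity
  have hS1 : 1 ≤ S := hbN.trans hS
  have hS0 : 0 < S := by linarith
  -- The new modulation is a difference of consecutive sums, the earlier at most half the later: 2m
  -- ≤ S + S/2, and 1 ≤ S.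
  have hm1 : 1 + m ≤ 3 * S := by
    have : |modulation κ T ξ η j| ≤ S + |modulationSum κ T ξ η j| := by
      rw [hSdef, hadd]
      have := abs_sub (modulationSum κ T ξ η j + modulation κ T ξ η j) (modulationSum κ T ξ η j)
      simpa using this
    linarith
  have e1 : S ^ (-theta s) ≤ (bProd β (j + 1) * N) ^ (-theta s) :=
    Real.rpow_le_rpow_of_nonpos (by linarith) hS (by linarith)
  have e2 : S ^ (-(1 - theta s)) ≤ 3 * (1 + m) ^ (-(1 - theta s)) :=
    rpow_neg_le_mul_rpow_neg hS0 (by linarith) (by norm_num) hm1 (by linarith) (by linarith)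
  have e3 : S⁻¹ = S ^ (-theta s) * S ^ (-(1 - theta s)) := by
    rw [← Real.rpow_add hS0, ← Real.rpow_neg_one]; congr 1; ring
  rw [div_eq_mul_inv, e3]
  calc |(η j).2| * (S ^ (-theta s) * S ^ (-(1 - theta s)))
      ≤ |(η j).2| * ((bProd β (j + 1) * N) ^ (-theta s) * (3 * (1 + m) ^ (-(1 - theta s)))) := by
        gcongr
    _ = _ := by ring

theorem norm_leafProduct (w : ℝ → ℂ) :
    ‖leafProduct κ T ξ η w‖ₑ = ∏ a ∈ T.leaves, ‖w (T.freq ξ η a)‖ₑ := by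
  unfold leafProduct
  have : ∀ (s : Finset Node) (F : Node → ℂ), ‖∏ a ∈ s, F a‖ₑ = ∏ a ∈ s, ‖F a‖ₑ := by
    intro s F
    induction s using Finset.induction_on with
    | empty => simp
    | insert a s ha ih => rw [Finset.prod_insert ha, Finset.prod_insert ha, enorm_mul, ih]
  rw [this]
  refine Finset.prod_congr rfl fun a _ => ?_
  split_ifs
  · rw [← ofReal_norm, ← ofReal_norm, RCLike.norm_conj]
  · rfl

end pointwise

/-- The product of the decay factors of the first `J` generations. -/
noncomputable def decay (s N : ℝ) (β : ℕ → ℝ) (J : ℕ) : ℝ :=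
  ∏ j ∈ Finset.range J, 3 * (bProd β (j + 1) * N) ^ (-theta s)

/-- The nonnegative integrand that dominates the one of the remainder. -/
noncomputable def majorant (s : ℝ) {J : ℕ} (T : OrderedTree (J + 1)) (w : ℝ → ℝ≥0∞) (ξ : ℝ)
    (η : Fin (J + 1) → ℝ × ℝ) : ℝ≥0∞ :=
  (∏ j : Fin J, ENNReal.ofReal (genKernel s (T.freq ξ η (T.r j.castSucc)) (η j.castSucc).1
    (η j.castSucc).2)) * ENNReal.ofReal |(η (Fin.last J)).2| * ∏ a ∈ T.leaves, w (T.freq ξ η a)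

theorem enorm_integrand_le {s : ℝ} (hs : 1 / 2 < s) {β : ℕ → ℝ} (h0 : β 0 = 1)
    (h2 : ∀ j, 1 ≤ j → 2 ≤ β j) {N : ℝ} (hN : 1 < N) (κ : Convention) (t : ℝ) {J : ℕ}
    (w : ℝ → ℂ) (T : OrderedTree (J + 1)) (ξ : ℝ) (η : Fin (J + 1) → ℝ × ℝ) :
    ‖integrand κ β N t w T ξ η‖ₑ ≤
      ENNReal.ofReal (decay s N β J) * majorant s T (fun x => ‖w x‖ₑ) ξ η := by
  unfold integrand
  split_ifs with hfar
  swap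
  · simp
  have hdec : ∀ j, 0 ≤ 3 * (bProd β (j + 1) * N) ^ (-theta s) := fun j => by
    have := one_le_bProd h0 h2 (j + 1)
    positivity
  have hker : ∀ x a b, 0 ≤ genKernel s x a b := fun x a b => by unfold genKernel; positivity
  rw [enorm_mul, enorm_mul, norm_leafProduct, ← ofReal_norm (generationFactor _ _ _ _ _ _),
    norm_generationFactor, majorant, ← mul_assoc, ← mul_assoc]
  gcongr
  rw [← ofReal_norm, norm_prod, decay, ← ENNReal.ofReal_prod_of_nonneg fun j _ => hker _ _ _,
    ← ENNReal.ofReal_mul (Finset.prod_nonneg fun j _ => hdec j), Finset.prod_range,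
    ← Finset.prod_mul_distrib]
  refine ENNReal.ofReal_le_ofReal (Finset.prod_le_prod (fun _ _ => norm_nonneg _) fun j _ => ?_)
  exact norm_factor_le hs h0 h2 hN hfar t j.castSucc (by simp only [Fin.val_castSucc]; omega)

/-! ### Measurability -/

section measurability

variable {J : ℕ} (κ : Convention) (T : OrderedTree J)

theorem measurable_modulation (j : Fin J) :
    Measurable fun p : ℝ × (Fin J → ℝ × ℝ) => modulation κ T p.1 p.2 j := by
  have h := T.measurable_freq
  unfold modulation
  refine Measurable.const_mul ?_ _
  exact ((((h _).pow_const 2).sub ((h _).pow_const 2)).add ((h _).pow_const 2)).sub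
    ((h _).pow_const 2)

theorem measurable_modulationSum (n : ℕ) :
    Measurable fun p : ℝ × (Fin J → ℝ × ℝ) => modulationSum κ T p.1 p.2 n :=
  Finset.measurable_sum _ fun j _ => measurable_modulation κ T j

theorem measurableSet_farFromResonance (β : ℕ → ℝ) (N : ℝ) (n : ℕ) :
    MeasurableSet {p : ℝ × (Fin J → ℝ × ℝ) | farFromResonance κ T p.1 p.2 β N n} := by
  have h : ∀ n, Measurable fun p : ℝ × (Fin J → ℝ × ℝ) => |modulationSum κ T p.1 p.2 n| :=
    fun n => by
      simp only [← Real.norm_eq_abs]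
      exact (measurable_modulationSum κ T n).norm
  have h1 : MeasurableSet (⋂ j : ℕ, ⋂ _ : 1 ≤ j, ⋂ _ : j + 1 ≤ n,
      {p : ℝ × (Fin J → ℝ × ℝ) | β j * |modulationSum κ T p.1 p.2 j| <
        |modulationSum κ T p.1 p.2 (j + 1)|}) :=
    MeasurableSet.iInter fun j => MeasurableSet.iInter fun _ => MeasurableSet.iInter fun _ =>
      measurableSet_lt ((h j).const_mul _) (h (j + 1))
  convert (measurableSet_lt (measurable_const (a := N)) (h 1)).inter h1 using 1
  ext p
  simp [farFromResonance]

theorem measurable_leafProduct {w : ℝ → ℂ} (hw : Measurable w) :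
    Measurable fun p : ℝ × (Fin J → ℝ × ℝ) => leafProduct κ T p.1 p.2 w := by
  unfold leafProduct
  refine Finset.measurable_fun_prod _ fun a _ => ?_
  have := hw.comp (T.measurable_freq a)
  split_ifs
  · exact Complex.continuous_conj.measurable.comp this
  · exact this

theorem measurable_generationFactor (t : ℝ) (j : Fin J) :
    Measurable fun p : ℝ × (Fin J → ℝ × ℝ) => generationFactor κ T p.1 p.2 t j := by
  unfold generationFactor
  have h1 := measurable_modulation κ T j
  have h2 := T.measurable_freq (1 :: T.r j)
  fun_prop

theorem measurable_integrand (β : ℕ → ℝ) (N t : ℝ) {w : ℝ → ℂ} (hw : Measurable w)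
    (T : OrderedTree (J + 1)) :
    Measurable fun p : ℝ × (Fin (J + 1) → ℝ × ℝ) => integrand κ β N t w T p.1 p.2 := by
  unfold integrand
  refine Measurable.ite (measurableSet_farFromResonance κ T β N J) ?_ measurable_const
  refine ((Finset.measurable_fun_prod _ fun j _ => ?_).mul
    (measurable_generationFactor κ T t _)).mul (measurable_leafProduct κ T hw)
  exact (measurable_generationFactor κ T t _).div
    (Complex.measurable_ofReal.comp (measurable_modulationSum κ T _))

theorem measurable_majorant (s : ℝ) {w : ℝ → ℝ≥0∞} (hw : Measurable w)
    (T : OrderedTree (J + 1)) :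
    Measurable fun p : ℝ × (Fin (J + 1) → ℝ × ℝ) => majorant s T w p.1 p.2 := by
  unfold majorant
  refine (Measurable.mul ?_ ?_).mul ?_
  · refine Finset.measurable_fun_prod _ fun j _ => ?_
    exact (OrderedTree.measurable_genKernel s).comp
      ((T.measurable_freq _).prodMk (by fun_prop))
  · simp only [← Real.norm_eq_abs]
    fun_prop
  · exact Finset.measurable_fun_prod _ fun a _ => hw.comp (T.measurable_freq a)

/-- Changing the function on a null set does not change the integrand almost everywhere. -/
theorem integrand_congr_ae (β : ℕ → ℝ) (N t : ℝ) {w w' : ℝ → ℂ} (h : w =ᵐ[volume] w')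
    (T : OrderedTree (J + 1)) :
    ∀ᵐ ξ : ℝ, integrand κ β N t w T ξ =ᵐ[volume] integrand κ β N t w' T ξ := by
  have h1 : ∀ᵐ p : ℝ × (Fin (J + 1) → ℝ × ℝ), ∀ a ∈ T.leaves,
      w (T.freq p.1 p.2 a) = w' (T.freq p.1 p.2 a) := by
    rw [Filter.eventually_all_finset]
    intro a ha
    exact (T.quasiMeasurePreserving_freq a (OrderedTree.mem_leaves.1 ha).1).ae h
  rw [Measure.volume_eq_prod] at h1
  filter_upwards [Measure.ae_ae_of_ae_prod h1] with ξ hξ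
  filter_upwards [hξ] with η hη
  have : leafProduct κ T ξ η w = leafProduct κ T ξ η w' := by
    unfold leafProduct
    exact Finset.prod_congr rfl fun a ha => by rw [hη a ha]
  simp only [integrand, this]

end measurability

theorem remainderHat_congr_ae (κ : Convention) (β : ℕ → ℝ) (N t : ℝ) (J : ℕ) {w w' : ℝ → ℂ}
    (h : w =ᵐ[volume] w') :
    remainderHat κ β N t J w =ᵐ[volume] remainderHat κ β N t J w' := by
  have := fun T : OrderedTree (J + 1) => integrand_congr_ae κ β N t h T
  filter_upwards [eventually_all.2 this] with ξ hξ
  exact Finset.sum_congr rfl fun T _ => integral_congr_ae (hξ T)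

theorem measurable_remainderHat (κ : Convention) (β : ℕ → ℝ) (N t : ℝ) (J : ℕ) {w : ℝ → ℂ}
    (hw : Measurable w) : Measurable (remainderHat κ β N t J w) := by
  unfold remainderHat
  refine Finset.measurable_sum _ fun T _ => ?_
  exact (measurable_integrand κ β N t hw T).stronglyMeasurable.integral_prod_right'.measurable

/-! ### The weighted L² bound for the sum over all trees -/

theorem sq_sum_le {ι : Type*} (s : Finset ι) (f : ι → ℝ≥0∞) :
    (∑ i ∈ s, f i) ^ 2 ≤ s.card * ∑ i ∈ s, f i ^ 2 := by
  have := ENNReal.inner_le_Lp_mul_Lq s (fun _ => 1) f Real.HolderConjugate.two_two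
  simp only [one_mul, Finset.sum_const, nsmul_eq_mul, ENNReal.rpow_two] at this
  calc (∑ i ∈ s, f i) ^ 2 ≤ _ := pow_le_pow_left' this 2
    _ = _ := by rw [mul_pow, rpow_half_sq, rpow_half_sq, one_pow, mul_one]

theorem nrm_sum_le {ι : Type*} (s : Finset ι) (σ : ℝ) {f : ι → ℝ → ℝ≥0∞}
    (hf : ∀ i, Measurable (f i)) :
    nrm σ (fun x => ∑ i ∈ s, f i x) ≤ s.card * ∑ i ∈ s, nrm σ (f i) := by
  unfold nrm sqNorm
  rw [← lintegral_finsetSum _ (fun i _ => by have := hf i; fun_prop),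
    ← lintegral_const_mul' _ _ (by finiteness)]
  refine lintegral_mono fun x => ?_
  simp only
  rw [Finset.mul_sum]
  exact sq_sum_le _ _

theorem nrm_const_mul {σ : ℝ} {c : ℝ≥0∞} (hc : c ≠ ∞) (f : ℝ → ℝ≥0∞) :
    nrm σ (fun x => c * f x) = c ^ 2 * nrm σ f := by
  unfold nrm sqNorm
  rw [← lintegral_const_mul' _ _ (by finiteness)]
  refine lintegral_congr fun x => ?_
  ring

section mainEstimate

variable {s : ℝ} {C : ℝ≥0∞}

/-- The sum over all trees of the dominating integrals. -/
noncomputable def majorantSum (s : ℝ) (J : ℕ) (w : ℝ → ℝ≥0∞) (ξ : ℝ) : ℝ≥0∞ :=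
  ∑ T : OrderedTree (J + 1), ∫⁻ η, majorant s T w ξ η

theorem nrm_majorantSum_le (hC : GenerationBound s C) (J : ℕ) {w : ℝ → ℝ≥0∞} (hw : Measurable w) :
    nrm (s - 1) (majorantSum s J w) ≤
      ((∏ i ∈ Finset.range (J + 1), (2 * i + 1) : ℕ) : ℝ≥0∞) ^ 2 *
        (C ^ (J + 1) * nrm s w ^ (2 * J + 3)) := by
  refine (nrm_sum_le Finset.univ (s - 1) (f := fun (T : OrderedTree (J + 1)) ξ =>
    ∫⁻ η, majorant s T w ξ η)
    fun T => (measurable_majorant s hw T).lintegral_prod_right').trans ?_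
  have hcard := OrderedTree.card_le (J + 1)
  calc _ ≤ ((Finset.univ : Finset (OrderedTree (J + 1))).card : ℝ≥0∞) *
        ∑ T : OrderedTree (J + 1), C ^ (J + 1) * nrm s w ^ (2 * J + 3) := by
        gcongr with T
        exact OrderedTree.nrm_remainder_tree_le hC T hw
    _ = (Fintype.card (OrderedTree (J + 1)) : ℝ≥0∞) ^ 2 *
        (C ^ (J + 1) * nrm s w ^ (2 * J + 3)) := by
        rw [Finset.sum_const, nsmul_eq_mul, Finset.card_univ]; ring
    _ ≤ _ := by gcongr

variable {β : ℕ → ℝ} {N : ℝ}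

theorem lintegral_integrand_le (hs : 1 / 2 < s) (h0 : β 0 = 1)
    (h2 : ∀ j, 1 ≤ j → 2 ≤ β j) (hN : 1 < N) (κ : Convention) (t : ℝ) {J : ℕ}
    (w : ℝ → ℂ) (T : OrderedTree (J + 1)) (ξ : ℝ) :
    ∫⁻ η, ‖integrand κ β N t w T ξ η‖ₑ ≤
      ENNReal.ofReal (decay s N β J) * ∫⁻ η, majorant s T (fun x => ‖w x‖ₑ) ξ η := by
  rw [← lintegral_const_mul' _ _ ENNReal.ofReal_ne_top]
  exact lintegral_mono fun η => enorm_integrand_le hs h0 h2 hN κ t w T ξ η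

theorem enorm_remainderHat_le (hs : 1 / 2 < s) (h0 : β 0 = 1)
    (h2 : ∀ j, 1 ≤ j → 2 ≤ β j) (hN : 1 < N) (κ : Convention) (t : ℝ) (J : ℕ)
    (w : ℝ → ℂ) (ξ : ℝ) :
    ‖remainderHat κ β N t J w ξ‖ₑ ≤
      ENNReal.ofReal (decay s N β J) * majorantSum s J (fun x => ‖w x‖ₑ) ξ := by
  unfold remainderHat majorantSum
  rw [Finset.mul_sum]
  refine (enorm_sum_le _ _).trans (Finset.sum_le_sum fun T _ => ?_)
  exact (enorm_integral_le_lintegral_enorm _).trans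
    (lintegral_integrand_le hs h0 h2 hN κ t w T ξ)

theorem nrm_remainderHat_le (hs : 1 / 2 < s) (hC : GenerationBound s C) (h0 : β 0 = 1)
    (h2 : ∀ j, 1 ≤ j → 2 ≤ β j) (hN : 1 < N) (κ : Convention) (t : ℝ) (J : ℕ)
    {w : ℝ → ℂ} (hw : AEStronglyMeasurable w volume) :
    nrm (s - 1) (fun ξ => ‖remainderHat κ β N t J w ξ‖ₑ) ≤
      ENNReal.ofReal (decay s N β J) ^ 2 *
        (((∏ i ∈ Finset.range (J + 1), (2 * i + 1) : ℕ) : ℝ≥0∞) ^ 2 *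
        (C ^ (J + 1) * nrm s (fun ξ => ‖w ξ‖ₑ) ^ (2 * J + 3))) := by
  have hae := hw.ae_eq_mk
  have hm := hw.stronglyMeasurable_mk.measurable
  rw [nrm_congr (g := fun ξ => ‖remainderHat κ β N t J (hw.mk w) ξ‖ₑ),
    nrm_congr (σ := s) (g := fun ξ => ‖hw.mk w ξ‖ₑ)]
  · refine (nrm_mono (Eventually.of_forall
      (enorm_remainderHat_le hs h0 h2 hN κ t J (hw.mk w)))).trans ?_
    rw [nrm_const_mul ENNReal.ofReal_ne_top]
    gcongr
    exact nrm_majorantSum_le hC J hm.enorm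
  · filter_upwards [hae] with ξ hξ
    rw [hξ]
  · filter_upwards [remainderHat_congr_ae κ β N t J hae] with ξ hξ
    rw [hξ]

/-- The sum of the dominating integrals has finite weighted L² norm, so it is finite for almost
every ξ. -/
theorem integrable_integrand (hs : 1 / 2 < s) (hC : GenerationBound s C) (hC' : C ≠ ∞)
    (h0 : β 0 = 1) (h2 : ∀ j, 1 ≤ j → 2 ≤ β j) (hN : 1 < N) (κ : Convention) (t : ℝ) (J : ℕ)
    {w : ℝ → ℂ} (hw : AEStronglyMeasurable w volume) (hfin : nrm s (fun ξ => ‖w ξ‖ₑ) ≠ ∞) :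
    ∀ᵐ ξ : ℝ, ∀ T : OrderedTree (J + 1), Integrable (integrand κ β N t w T ξ) volume := by
  have hae := hw.ae_eq_mk
  have hm := hw.stronglyMeasurable_mk.measurable
  have hfin' : nrm s (fun ξ => ‖hw.mk w ξ‖ₑ) ≠ ∞ := by
    rw [nrm_congr (g := fun ξ => ‖w ξ‖ₑ)]
    · exact hfin
    · filter_upwards [hae] with ξ hξ
      rw [hξ]
  have hsum : nrm (s - 1) (majorantSum s J fun x => ‖hw.mk w x‖ₑ) ≠ ∞ :=
    ne_top_of_le_ne_top (by finiteness) (nrm_majorantSum_le hC J hm.enorm)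
  have hmeas : Measurable (majorantSum s J fun x => ‖hw.mk w x‖ₑ) :=
    Finset.measurable_sum _ fun T _ => (measurable_majorant s hm.enorm T).lintegral_prod_right'
  have hlt := ae_lt_top (by fun_prop) hsum
  have hcongr := eventually_all.2 fun T : OrderedTree (J + 1) => integrand_congr_ae κ β N t hae T
  filter_upwards [hlt, hcongr] with ξ hξ hξ' T
  refine Integrable.congr ⟨?_, ?_⟩ (hξ' T).symm
  · exact ((measurable_integrand κ β N t hm T).comp measurable_prodMk_left).aestronglyMeasurable
  · have hwt : wt (s - 1) ξ ≠ 0 := by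
      have := br_pos ξ
      simp only [wt, ne_eq, ENNReal.ofReal_eq_zero, not_le]
      positivity
    have hne : majorantSum s J (fun x => ‖hw.mk w x‖ₑ) ξ ≠ ∞ := by
      intro h
      rw [h, ENNReal.mul_top hwt] at hξ
      simp at hξ
    have hT : ∫⁻ η, majorant s T (fun x => ‖hw.mk w x‖ₑ) ξ η ≠ ∞ :=
      ne_top_of_le_ne_top hne (Finset.single_le_sum
        (f := fun T : OrderedTree (J + 1) => ∫⁻ η, majorant s T (fun x => ‖hw.mk w x‖ₑ) ξ η)
        (fun _ _ => zero_le) (Finset.mem_univ T))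
    exact (lintegral_integrand_le hs h0 h2 hN κ t (hw.mk w) T ξ).trans_lt
      (ENNReal.mul_lt_top ENNReal.ofReal_lt_top hT.lt_top)

end mainEstimate

/-! ### The estimate of the remainder in Sobolev spaces -/

section remainder

variable {s M : ℝ} {β : ℕ → ℝ} {N : ℝ}

theorem decay_nonneg (h0 : β 0 = 1) (h2 : ∀ j, 1 ≤ j → 2 ≤ β j) (hN : 1 < N) (J : ℕ) :
    0 ≤ decay s N β J := by
  refine Finset.prod_nonneg fun j _ => ?_
  have := one_le_bProd h0 h2 (j + 1)
  positivity

theorem nrm_remainderHat_le_sq (hs : 1 / 2 < s) (hC : GenerationBound s (ENNReal.ofReal M ^ 2))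
    (hM : 0 ≤ M) (h0 : β 0 = 1) (h2 : ∀ j, 1 ≤ j → 2 ≤ β j) (hN : 1 < N) (κ : Convention) (t : ℝ)
    (J : ℕ) {w : ℝ → ℂ} (hw : AEStronglyMeasurable w volume) :
    nrm (s - 1) (fun ξ => ‖remainderHat κ β N t J w ξ‖ₑ) ^ (1 / 2 : ℝ) ≤
      ENNReal.ofReal (decay s N β J * (∏ i ∈ Finset.range (J + 1), (2 * (i : ℝ) + 1)) *
        M ^ (J + 1)) * (nrm s (fun ξ => ‖w ξ‖ₑ) ^ (1 / 2 : ℝ)) ^ (2 * J + 3) := by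
  have hd := decay_nonneg (s := s) h0 h2 hN J
  have hc : (0 : ℝ) ≤ ∏ i ∈ Finset.range (J + 1), (2 * (i : ℝ) + 1) :=
    Finset.prod_nonneg fun i _ => by positivity
  have hcast : ((∏ i ∈ Finset.range (J + 1), (2 * i + 1) : ℕ) : ℝ≥0∞) =
      ENNReal.ofReal (∏ i ∈ Finset.range (J + 1), (2 * (i : ℝ) + 1)) := by
    rw [← ENNReal.ofReal_natCast]
    push_cast
    rfl
  set Y := nrm s (fun ξ => ‖w ξ‖ₑ) ^ (1 / 2 : ℝ) with hY
  have hY2 : nrm s (fun ξ => ‖w ξ‖ₑ) = Y ^ 2 := (rpow_half_sq _).symm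
  have hmain := nrm_remainderHat_le hs hC h0 h2 hN κ t J hw
  rw [hY2, hcast] at hmain
  have hsq : ∀ a : ℝ≥0∞, (a ^ 2) ^ (1 / 2 : ℝ) = a := fun a => by
    rw [← ENNReal.rpow_two, ← ENNReal.rpow_mul]; norm_num
  rw [← hsq (ENNReal.ofReal _ * Y ^ (2 * J + 3))]
  gcongr
  refine hmain.trans (le_of_eq ?_)
  rw [ENNReal.ofReal_mul (by positivity), ENNReal.ofReal_mul hd, ENNReal.ofReal_pow hM]
  ring

theorem sobolevNorm_remainder_le (hs : 1 / 2 < s)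
    (hC : GenerationBound s (ENNReal.ofReal M ^ 2)) (hM : 0 ≤ M) (h0 : β 0 = 1)
    (h2 : ∀ j, 1 ≤ j → 2 ≤ β j) (hN : 1 < N) (κ : Convention) (t : ℝ) (J : ℕ) {v : 𝓢'(ℝ, ℂ)}
    (hv : sobolevNorm s v < ⊤) :
    (∀ᵐ ξ : ℝ, ∀ T : OrderedTree (J + 1),
      Integrable (integrand κ β N t (hat v) T ξ) volume) ∧
    HasFourier (remainder κ β N t J v) (remainderHat κ β N t J (hat v)) ∧
    sobolevNorm (s - 1) (remainder κ β N t J v) ≤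
      ENNReal.ofReal (decay s N β J * (∏ i ∈ Finset.range (J + 1), (2 * (i : ℝ) + 1)) *
        (2 * Real.pi * M) ^ (J + 1)) * sobolevNorm s v ^ (2 * J + 3) := by
  have hF := hasFourier_hat (exists_hasFourier_of_sobolevNorm_lt_top hv)
  have hnorm := sobolevNorm_eq (σ := s) hF
  have hp : (0 : ℝ) < (2 * Real.pi) ^ (-(1 / 2) : ℝ) := by positivity
  set c : ℝ≥0∞ := ENNReal.ofReal ((2 * Real.pi) ^ (-(1 / 2) : ℝ)) with hc
  set r : ℝ≥0∞ := ENNReal.ofReal ((2 * Real.pi) ^ (1 / 2 : ℝ)) with hr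
  have hcr : r * c = 1 := by
    rw [hc, hr, ← ENNReal.ofReal_mul (by positivity), ← Real.rpow_add (by positivity)]
    simp
  have hr2 : r ^ 2 = ENNReal.ofReal (2 * Real.pi) := by
    rw [hr, ← ENNReal.ofReal_pow (by positivity), ← Real.rpow_mul_natCast (by positivity)]
    norm_num
  set Y := nrm s (fun ξ => ‖hat v ξ‖ₑ) ^ (1 / 2 : ℝ) with hY
  have hY' : Y = r * sobolevNorm s v := by rw [hnorm, ← mul_assoc, hcr, one_mul]
  have hYfin : Y ≠ ∞ := by
    rw [hY']; exact ENNReal.mul_ne_top ENNReal.ofReal_ne_top hv.ne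
  have hfin : nrm s (fun ξ => ‖hat v ξ‖ₑ) ≠ ∞ := by
    rw [← rpow_half_sq (nrm s (fun ξ => ‖hat v ξ‖ₑ))]
    exact ENNReal.pow_ne_top hYfin
  have hmeas : AEStronglyMeasurable (remainderHat κ β N t J (hat v)) volume :=
    (measurable_remainderHat κ β N t J hF.1.stronglyMeasurable_mk.measurable).aestronglyMeasurable.congr
      (remainderHat_congr_ae κ β N t J hF.1.ae_eq_mk).symm
  have hle := nrm_remainderHat_le_sq hs hC hM h0 h2 hN κ t J hF.1
  have hRfin : nrm (s - 1) (fun ξ => ‖remainderHat κ β N t J (hat v) ξ‖ₑ) ≠ ∞ := by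
    rw [← rpow_half_sq (nrm (s - 1) _)]
    refine ENNReal.pow_ne_top (ne_top_of_le_ne_top ?_ hle)
    exact ENNReal.mul_ne_top ENNReal.ofReal_ne_top (ENNReal.pow_ne_top hYfin)
  have hR : HasFourier (remainder κ β N t J v) (remainderHat κ β N t J (hat v)) :=
    hasFourier_invHat (exists_hasFourier hmeas hRfin)
  refine ⟨integrable_integrand hs hC (by finiteness) h0 h2 hN κ t J hF.1 hfin, hR, ?_⟩
  rw [sobolevNorm_eq hR]
  have hd := decay_nonneg (s := s) h0 h2 hN J
  have hprod : (0 : ℝ) ≤ ∏ i ∈ Finset.range (J + 1), (2 * (i : ℝ) + 1) :=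
    Finset.prod_nonneg fun i _ => by positivity
  calc c * nrm (s - 1) (fun ξ => ‖remainderHat κ β N t J (hat v) ξ‖ₑ) ^ (1 / 2 : ℝ)
      ≤ c * (ENNReal.ofReal (decay s N β J * (∏ i ∈ Finset.range (J + 1), (2 * (i : ℝ) + 1)) *
        M ^ (J + 1)) * Y ^ (2 * J + 3)) := by gcongr
    -- Each of the 2J + 3 input norms contributes (2π)^{1/2} and the output norm (2π)^{-1/2}; what
    -- remains is (2π)^{J+1}.
    _ = (r * c) * (ENNReal.ofReal (decay s N β J *
        (∏ i ∈ Finset.range (J + 1), (2 * (i : ℝ) + 1)) * M ^ (J + 1)) * (r ^ 2) ^ (J + 1)) *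
          sobolevNorm s v ^ (2 * J + 3) := by
        rw [hY']; ring
    _ = _ := by
        rw [hcr, one_mul, hr2, ← ENNReal.ofReal_pow (by positivity),
          ← ENNReal.ofReal_mul (by positivity), mul_pow (2 * Real.pi)]
        congr 2
        ring

/-- Admissibility involves b_j only up to index J - 1, so the last factor b_J^θ ≥ 1 is given away.
-/
theorem decay_le (hs : 1 / 2 < s) (h0 : β 0 = 1) (h2 : ∀ j, 1 ≤ j → 2 ≤ β j) (hN : 1 < N)
    (n : ℕ) : decay s N β (n + 1) ≤ 3 ^ (n + 1) * N ^ (-(theta s * ((n + 1 : ℕ) : ℝ))) /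
      ∏ j ∈ Finset.Icc 1 n, bProd β j ^ theta s := by
  have hθ := theta_pos hs
  have hN0 : 0 < N := by linarith
  have hb := one_le_bProd h0 h2
  have hstep : ∀ n, 3 * (bProd β (n + 1) * N) ^ (-theta s) =
      3 * N ^ (-theta s) / bProd β (n + 1) ^ theta s := by
    intro n
    have hbn : 0 < bProd β (n + 1) := by linarith [hb (n + 1)]
    rw [Real.mul_rpow hbn.le hN0.le, Real.rpow_neg hbn.le, div_eq_mul_inv]
    ring
  have heq : ∀ n, decay s N β n = 3 ^ n * N ^ (-(theta s * (n : ℝ))) /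
      ∏ j ∈ Finset.Icc 1 n, bProd β j ^ theta s := by
    intro n
    induction n with
    | zero => simp [decay]
    | succ n ih =>
      have e : decay s N β (n + 1) = decay s N β n * (3 * (bProd β (n + 1) * N) ^ (-theta s)) :=
        Finset.prod_range_succ _ _
      have e2 : N ^ (-(theta s * ((n + 1 : ℕ) : ℝ))) =
          N ^ (-(theta s * (n : ℝ))) * N ^ (-theta s) := by
        rw [← Real.rpow_add hN0]; congr 1; push_cast; ring
      rw [e, hstep, ih, Finset.prod_Icc_succ_top (by omega), e2, div_mul_div_comm]
      ring
  have hpos : 0 < ∏ j ∈ Finset.Icc 1 n, bProd β j ^ theta s :=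
    Finset.prod_pos fun j _ => Real.rpow_pos_of_pos (by linarith [hb j]) _
  rw [heq, Finset.prod_Icc_succ_top (by omega)]
  refine div_le_div_of_nonneg_left (by positivity) hpos ?_
  exact le_mul_of_one_le_right hpos.le (Real.one_le_rpow (hb _) hθ.le)

/-- The constant in the estimate of the remainder is controlled by admissibility. -/
theorem const_le_of_admissible {K R A : ℝ} (hs : 1 / 2 < s) (hM : 0 ≤ M)
    (hK : K = 6 * Real.pi * (M + 1)) (hR : 0 < R) (h0 : β 0 = 1) (h2 : ∀ j, 1 ≤ j → 2 ≤ β j)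
    (hA : ∀ J : ℕ, 1 ≤ J →
      (∏ i ∈ Finset.range (J + 1), (2 * (i : ℝ) + 1)) * β J * (K * R) ^ (J + 1) *
        (2 * (J : ℝ) + 6) / ∏ j ∈ Finset.Icc 1 (J - 1), bProd β j ^ theta s ≤ A)
    (hN : 1 < N) {J : ℕ} (hJ : 1 ≤ J) :
    decay s N β J * (∏ i ∈ Finset.range (J + 1), (2 * (i : ℝ) + 1)) *
        (2 * Real.pi * M) ^ (J + 1) ≤ A * N ^ (-(theta s * (J : ℝ))) / R ^ (J + 1) := by
  obtain ⟨n, rfl⟩ : ∃ n, J = n + 1 := ⟨J - 1, by omega⟩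
  have hA' := hA (n + 1) hJ
  rw [Nat.add_sub_cancel] at hA'
  have hd := decay_le hs h0 h2 hN n
  have hb := one_le_bProd h0 h2
  have hpos : 0 < ∏ j ∈ Finset.Icc 1 n, bProd β j ^ theta s :=
    Finset.prod_pos fun j _ => Real.rpow_pos_of_pos (by linarith [hb j]) _
  set P := ∏ j ∈ Finset.Icc 1 n, bProd β j ^ theta s
  have hc : (0 : ℝ) ≤ ∏ i ∈ Finset.range (n + 1 + 1), (2 * (i : ℝ) + 1) :=
    Finset.prod_nonneg fun i _ => by positivity
  set c := ∏ i ∈ Finset.range (n + 1 + 1), (2 * (i : ℝ) + 1)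
  have hNp : 0 < N ^ (-(theta s * ((n + 1 : ℕ) : ℝ))) := Real.rpow_pos_of_pos (by linarith) _
  set ν := N ^ (-(theta s * ((n + 1 : ℕ) : ℝ)))
  -- These two factors in the admissibility condition are not required for the remainder and are
  -- only bounded below by 1.
  have hβ : 1 ≤ β (n + 1) * (2 * ((n + 1 : ℕ) : ℝ) + 6) :=
    one_le_mul_of_one_le_of_one_le (by linarith [h2 (n + 1) hJ])
      (by have : (0 : ℝ) ≤ ((n + 1 : ℕ) : ℝ) := by positivity
          linarith)
  have hK0 : 0 < K := by rw [hK]; positivity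
  have h3 : 3 ^ (n + 1) * (2 * Real.pi * M) ^ (n + 1 + 1) ≤ K ^ (n + 1 + 1) := by
    calc (3 : ℝ) ^ (n + 1) * (2 * Real.pi * M) ^ (n + 1 + 1)
        ≤ 3 ^ (n + 1 + 1) * (2 * Real.pi * (M + 1)) ^ (n + 1 + 1) := by
          gcongr
          · norm_num
          · omega
          · linarith
      _ = K ^ (n + 1 + 1) := by rw [← mul_pow, hK]; congr 1; ring
  rw [le_div_iff₀ (by positivity)]
  calc decay s N β (n + 1) * c * (2 * Real.pi * M) ^ (n + 1 + 1) * R ^ (n + 1 + 1)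
      ≤ (3 ^ (n + 1) * ν / P) * c * (2 * Real.pi * M) ^ (n + 1 + 1) * R ^ (n + 1 + 1) := by gcongr
    _ = (c * (3 ^ (n + 1) * (2 * Real.pi * M) ^ (n + 1 + 1)) * R ^ (n + 1 + 1) * 1 / P) * ν := by ring
    _ ≤ (c * K ^ (n + 1 + 1) * R ^ (n + 1 + 1) * (β (n + 1) * (2 * ((n + 1 : ℕ) : ℝ) + 6)) / P) *
          ν := by gcongr
    _ = (c * β (n + 1) * (K * R) ^ (n + 1 + 1) * (2 * ((n + 1 : ℕ) : ℝ) + 6) / P) * ν := by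
        rw [mul_pow]; ring
    _ ≤ A * ν := by gcongr

end remainder

theorem tendsto_zero_of_le_geometric {f : ℕ → ℝ≥0∞} {a q : ℝ} (hq0 : 0 ≤ q) (hq : q < 1)
    (h : ∀ J, 1 ≤ J → f J ≤ ENNReal.ofReal (a * q ^ J)) : Tendsto f atTop (𝓝 0) := by
  have h1 : Tendsto (fun J : ℕ => ENNReal.ofReal (a * q ^ J)) atTop (𝓝 0) := by
    have := (tendsto_pow_atTop_nhds_zero_of_lt_one hq0 hq).const_mul a
    rw [mul_zero] at this
    simpa using ENNReal.tendsto_ofReal this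
  refine tendsto_of_tendsto_of_tendsto_of_le_of_le' tendsto_const_nhds h1
    (Eventually.of_forall fun _ => zero_le) ?_
  filter_upwards [eventually_ge_atTop 1] with J hJ using h J hJ

/-! ### The model thresholds -/

theorem bounded_of_eventually_antitone {a : ℕ → ℝ} (h0 : ∀ n, 0 ≤ a n) (n₀ : ℕ)
    (h : ∀ n, n₀ ≤ n → a (n + 1) ≤ a n) : ∃ A, ∀ n, a n ≤ A := by
  refine ⟨∑ j ∈ Finset.range (n₀ + 1), a j, fun n => ?_⟩
  have hle : ∀ m ≤ n₀, a m ≤ ∑ j ∈ Finset.range (n₀ + 1), a j := fun m hm =>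
    Finset.single_le_sum (fun j _ => h0 j) (Finset.mem_range.2 (by omega))
  rcases le_total n n₀ with hn | hn
  · exact hle n hn
  · induction n, hn using Nat.le_induction with
    | base => exact hle n₀ le_rfl
    | succ n hn ih => exact (h n hn).trans ih

theorem modelBeta_of_pos (s : ℝ) {j : ℕ} (hj : 1 ≤ j) :
    modelBeta s j = (2 * (j : ℝ) + 3) ^ (2 / theta s) := by
  rw [modelBeta, if_neg (by omega)]

theorem two_le_modelBeta {s : ℝ} (hs : 1 / 2 < s) (j : ℕ) (hj : 1 ≤ j) : 2 ≤ modelBeta s j := by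
  have hθ := theta_pos hs
  have hθ' := theta_le_half s
  have hjr : (1 : ℝ) ≤ j := by exact_mod_cast hj
  rw [modelBeta_of_pos s hj]
  calc (2 : ℝ) ≤ (2 * (j : ℝ) + 3) ^ (1 : ℝ) := by rw [Real.rpow_one]; linarith
    _ ≤ _ := by
      refine Real.rpow_le_rpow_of_exponent_le (by linarith) ?_
      rw [le_div_iff₀ hθ]; linarith

/-- In the ratio of consecutive terms the new denominator is at least (2n + 3)², while the numerator
grows only linearly in n. The terms are therefore eventually decreasing. -/
theorem admissible_modelBeta {s : ℝ} (hs : 1 / 2 < s) {K : ℝ} (hK : 0 < K) :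
    Admissible s K (modelBeta s) := by
  have hθ := theta_pos hs
  have h0 : modelBeta s 0 = 1 := by simp [modelBeta]
  have h2 := two_le_modelBeta hs
  have hb := one_le_bProd h0 h2
  refine ⟨h0, h2, ?_⟩
  -- The term for J = n + 1, which avoids the truncated subtraction in J - 1.
  let a : ℕ → ℝ := fun n => (∏ i ∈ Finset.range (n + 1 + 1), (2 * (i : ℝ) + 1)) *
    modelBeta s (n + 1) * K ^ (n + 1 + 1) * (2 * ((n + 1 : ℕ) : ℝ) + 6) /
      ∏ j ∈ Finset.Icc 1 n, bProd (modelBeta s) j ^ theta s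
  have hP : ∀ n, 0 < ∏ j ∈ Finset.Icc 1 n, bProd (modelBeta s) j ^ theta s := fun n =>
    Finset.prod_pos fun j _ => Real.rpow_pos_of_pos (by linarith [hb j]) _
  have hc : ∀ n : ℕ, (0 : ℝ) < ∏ i ∈ Finset.range n, (2 * (i : ℝ) + 1) := fun n =>
    Finset.prod_pos fun i _ => by positivity
  have hβ0 : ∀ n, 0 < modelBeta s (n + 1) := fun n => by linarith [h2 (n + 1) (by omega)]
  have ha : ∀ n, 0 ≤ a n := fun n => by
    have := hP n; have := hc (n + 1 + 1); have := hβ0 n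
    positivity
  set E : ℝ := 2 ^ (2 / theta s) with hE
  have hE0 : 0 < E := by positivity
  obtain ⟨n₀, hn₀⟩ := exists_nat_ge (4 * K * E)
  obtain ⟨A, hA⟩ := bounded_of_eventually_antitone ha (n₀ + 1) (by
    intro n hn
    have hn1 : 1 ≤ n := by omega
    have hnr : (n₀ : ℝ) + 1 ≤ n := by exact_mod_cast hn
    have hn0 : (0 : ℝ) ≤ n₀ := by positivity
    have hβ : modelBeta s (n + 1 + 1) ≤ E * modelBeta s (n + 1) := by
      rw [modelBeta_of_pos s (by omega), modelBeta_of_pos s (by omega), hE,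
        ← Real.mul_rpow (by norm_num) (by positivity)]
      refine Real.rpow_le_rpow (by positivity) ?_ (by positivity)
      push_cast
      linarith
    -- The exponent 2/θ of the thresholds is chosen so that β_n^θ = (2n + 3)².
    have hbn : (2 * (n : ℝ) + 3) ^ 2 ≤ bProd (modelBeta s) (n + 1) ^ theta s := by
      have e : (2 * (n : ℝ) + 3) ^ 2 = modelBeta s n ^ theta s := by
        rw [modelBeta_of_pos s hn1, ← Real.rpow_mul (by positivity), div_mul_cancel₀ _ hθ.ne',
          Real.rpow_two]
      rw [e, bProd_succ]
      have : 0 < modelBeta s n := by linarith [h2 n hn1]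
      exact Real.rpow_le_rpow this.le (le_mul_of_one_le_left this.le (hb n)) hθ.le
    have hP0 := hP n
    have hbpos : 0 < bProd (modelBeta s) (n + 1) ^ theta s := lt_of_lt_of_le (by positivity) hbn
    have hcn := hc (n + 1 + 1)
    have hβn := hβ0 n
    simp only [a]
    rw [Finset.prod_Icc_succ_top (by omega), Finset.prod_range_succ _ (n + 1 + 1), pow_succ K (n + 1 + 1)]
    set c := ∏ i ∈ Finset.range (n + 1 + 1), (2 * (i : ℝ) + 1)
    set P := ∏ j ∈ Finset.Icc 1 n, bProd (modelBeta s) j ^ theta s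
    set B := bProd (modelBeta s) (n + 1) ^ theta s
    rw [div_le_div_iff₀ (by positivity) hP0]
    have hq : (2 * ((n + 1 + 1 : ℕ) : ℝ) + 1) * (2 * ((n + 1 + 1 : ℕ) : ℝ) + 6) * (K * E) ≤
        (2 * ((n + 1 : ℕ) : ℝ) + 6) * B := by
      have e1 : (2 * ((n + 1 + 1 : ℕ) : ℝ) + 1) ≤ 2 * (2 * (n : ℝ) + 3) := by push_cast; linarith
      have e2 : (2 * ((n + 1 + 1 : ℕ) : ℝ) + 6) ≤ 2 * (2 * ((n + 1 : ℕ) : ℝ) + 6) := by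
        push_cast; linarith
      have e3 : 4 * (K * E) ≤ 2 * (n : ℝ) + 3 := by linarith
      calc _ ≤ (2 * (2 * (n : ℝ) + 3)) * (2 * (2 * ((n + 1 : ℕ) : ℝ) + 6)) * (K * E) := by gcongr
        _ = (2 * ((n + 1 : ℕ) : ℝ) + 6) * ((2 * (n : ℝ) + 3) * (4 * (K * E))) := by ring
        _ ≤ (2 * ((n + 1 : ℕ) : ℝ) + 6) * ((2 * (n : ℝ) + 3) * (2 * (n : ℝ) + 3)) := by gcongr
        _ = (2 * ((n + 1 : ℕ) : ℝ) + 6) * (2 * (n : ℝ) + 3) ^ 2 := by ring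
        _ ≤ _ := by gcongr
    calc c * (2 * ((n + 1 + 1 : ℕ) : ℝ) + 1) * modelBeta s (n + 1 + 1) * (K ^ (n + 1 + 1) * K) *
          (2 * ((n + 1 + 1 : ℕ) : ℝ) + 6) * P
        ≤ c * (2 * ((n + 1 + 1 : ℕ) : ℝ) + 1) * (E * modelBeta s (n + 1)) * (K ^ (n + 1 + 1) * K) *
          (2 * ((n + 1 + 1 : ℕ) : ℝ) + 6) * P := by gcongr
      _ = c * modelBeta s (n + 1) * K ^ (n + 1 + 1) * P * ((2 * ((n + 1 + 1 : ℕ) : ℝ) + 1) *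
          (2 * ((n + 1 + 1 : ℕ) : ℝ) + 6) * (K * E)) := by ring
      _ ≤ c * modelBeta s (n + 1) * K ^ (n + 1 + 1) * P * ((2 * ((n + 1 : ℕ) : ℝ) + 6) * B) := by
          gcongr
      _ = _ := by ring)
  refine ⟨A, fun J hJ => ?_⟩
  obtain ⟨n, rfl⟩ : ∃ n, J = n + 1 := ⟨J - 1, by omega⟩
  exact hA n

end NormalForm

/-! ### The three claims -/

open NormalForm
theorem lemma4p6 (s : ℝ) (hs : 1 / 2 < s) :
    (∀ K : ℝ, 0 < K → Admissible s K (modelBeta s)) ∧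
    (∃ K : ℝ, 0 < K ∧ ∀ β : ℕ → ℝ, Admissible s K β →
      ∃ C : ℝ, 0 < C ∧ ∀ (κ : Convention) (N : ℝ), 1 < N → ∀ (t : ℝ) (v : 𝓢'(ℝ, ℂ)),
        sobolevNorm s v < ⊤ →
        (∀ J : ℕ, 1 ≤ J →
          (∀ᵐ ξ : ℝ, ∀ T : OrderedTree (J + 1),
            Integrable (integrand κ β N t (hat v) T ξ) volume) ∧
          HasFourier (remainder κ β N t J v) (remainderHat κ β N t J (hat v)) ∧
          sobolevNorm (s - 1) (remainder κ β N t J v) ≤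
            ENNReal.ofReal (C * N ^ (-(theta s * (J : ℝ)))) * sobolevNorm s v ^ (2 * J + 3)) ∧
        (sobolevNorm s v ^ 2 < ENNReal.ofReal (N ^ theta s) →
          Tendsto (fun J : ℕ => sobolevNorm (s - 1) (remainder κ β N t J v)) atTop (𝓝 0))) ∧
    (∀ (κ : Convention) (N : ℝ), 1 < N → ∀ (t : ℝ) (v : 𝓢'(ℝ, ℂ)), sobolevNorm s v < ⊤ →
      Tendsto (fun J : ℕ => sobolevNorm (s - 1) (remainder κ (modelBeta s) N t J v))
        atTop (𝓝 0)) := by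
  obtain ⟨L, hL, hgen⟩ := exists_generationBound hs
  -- `L` bounds squared norms, hence the square root.
  set M : ℝ := √L.toReal with hMdef
  have hM : 0 ≤ M := Real.sqrt_nonneg _
  have hLM : L = ENNReal.ofReal M ^ 2 := by
    rw [← ENNReal.ofReal_pow hM, Real.sq_sqrt ENNReal.toReal_nonneg, ENNReal.ofReal_toReal hL]
  rw [hLM] at hgen
  -- Per generation: 3 from `norm_factor_le`, 2π from the normalization and the trilinear constant
  -- M; adding 1 to M makes K positive.
  set K : ℝ := 6 * Real.pi * (M + 1) with hK
  have hK0 : 0 < K := by positivity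
  have hθ := theta_pos hs
  refine ⟨fun K hK => admissible_modelBeta hs hK, ⟨K, hK0, ?_⟩, ?_⟩
  · rintro β ⟨h0, h2, A, hA⟩
    have key : ∀ (κ : Convention) (N : ℝ), 1 < N → ∀ (t : ℝ) (v : 𝓢'(ℝ, ℂ)),
        sobolevNorm s v < ⊤ → ∀ J : ℕ, 1 ≤ J →
          (∀ᵐ ξ : ℝ, ∀ T : OrderedTree (J + 1),
            Integrable (integrand κ β N t (hat v) T ξ) volume) ∧
          HasFourier (remainder κ β N t J v) (remainderHat κ β N t J (hat v)) ∧
          sobolevNorm (s - 1) (remainder κ β N t J v) ≤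
            ENNReal.ofReal ((|A| + 1) * N ^ (-(theta s * (J : ℝ)))) *
              sobolevNorm s v ^ (2 * J + 3) := by
      intro κ N hN t v hv J hJ
      obtain ⟨h3, h4, h5⟩ := sobolevNorm_remainder_le hs hgen hM h0 h2 hN κ t J hv
      refine ⟨h3, h4, h5.trans (mul_le_mul_left (ENNReal.ofReal_le_ofReal ?_) _)⟩
      have := const_le_of_admissible (R := 1) hs hM hK one_pos h0 h2
        (by simpa only [mul_one] using hA) hN hJ
      rw [one_pow, div_one] at this
      refine this.trans ?_
      gcongr
      linarith [le_abs_self A]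
    refine ⟨|A| + 1, by positivity, fun κ N hN t v hv => ⟨key κ N hN t v hv, fun hsmall => ?_⟩⟩
    have hN0 : 0 < N := by linarith
    set x := (sobolevNorm s v).toReal with hx
    have hx0 : 0 ≤ x := ENNReal.toReal_nonneg
    have hvx : sobolevNorm s v = ENNReal.ofReal x := (ENNReal.ofReal_toReal hv.ne).symm
    have hNθ : 0 < N ^ theta s := Real.rpow_pos_of_pos hN0 _
    have hq : x ^ 2 < N ^ theta s := by
      rw [hvx, ← ENNReal.ofReal_pow hx0] at hsmall
      exact (ENNReal.ofReal_lt_ofReal_iff hNθ).1 hsmall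
    -- The bound N^{-θJ} x^{2J+3} is x³ times the J-th power of this ratio.
    refine tendsto_zero_of_le_geometric (a := (|A| + 1) * x ^ 3) (q := x ^ 2 / N ^ theta s)
      (by positivity) ((div_lt_one hNθ).2 hq) fun J hJ => ?_
    refine (key κ N hN t v hv J hJ).2.2.trans (le_of_eq ?_)
    rw [hvx, ← ENNReal.ofReal_pow hx0, ← ENNReal.ofReal_mul (by positivity)]
    congr 1
    rw [Real.rpow_neg hN0.le, Real.rpow_mul hN0.le, Real.rpow_natCast, div_pow]
    ring
  · intro κ N hN t v hv
    set x := (sobolevNorm s v).toReal with hx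
    have hx0 : 0 ≤ x := ENNReal.toReal_nonneg
    have hvx : sobolevNorm s v = ENNReal.ofReal x := (ENNReal.ofReal_toReal hv.ne).symm
    have hR : 0 < x ^ 2 + 1 := by positivity
    -- Admissibility with the enlarged constant K(x² + 1) gains the factor (x² + 1)^{-(J+1)}, which
    -- beats x^{2J+3} whatever the size of v; the decay in N is not needed.
    obtain ⟨h0, h2, A, hA⟩ := admissible_modelBeta hs (mul_pos hK0 hR)
    refine tendsto_zero_of_le_geometric (a := |A| * x ^ 3) (q := x ^ 2 / (x ^ 2 + 1))
      (by positivity) ((div_lt_one hR).2 (by linarith)) fun J hJ => ?_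
    refine (sobolevNorm_remainder_le hs hgen hM h0 h2 hN κ t J hv).2.2.trans ?_
    rw [hvx, ← ENNReal.ofReal_pow hx0, ← ENNReal.ofReal_mul' (by positivity)]
    refine ENNReal.ofReal_le_ofReal ?_
    have hν : N ^ (-(theta s * (J : ℝ))) ≤ 1 :=
      Real.rpow_le_one_of_one_le_of_nonpos hN.le (by
        have : 0 ≤ theta s * (J : ℝ) := by positivity
        linarith)
    have hν0 : 0 ≤ N ^ (-(theta s * (J : ℝ))) := Real.rpow_nonneg (by linarith) _
    calc _ ≤ (A * N ^ (-(theta s * (J : ℝ))) / (x ^ 2 + 1) ^ (J + 1)) * x ^ (2 * J + 3) := by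
          gcongr
          exact const_le_of_admissible hs hM hK hR h0 h2 hA hN hJ
      _ ≤ (|A| * 1 / (x ^ 2 + 1) ^ J) * x ^ (2 * J + 3) := by
          gcongr
          · exact le_abs_self A
          · linarith [sq_nonneg x]
          · omega
      _ = |A| * x ^ 3 * (x ^ 2 / (x ^ 2 + 1)) ^ J := by
          rw [div_pow]; ring
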